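/- **Notation.** Let $N\ge 1$ be an integer. A partition $\lambda\vdash N$ is a vector $\lambda=(\lambda_1,\dots,\lambda_\ell)$ of positive integers with $\lambda_1\ge\dots\ge\lambda_\ell$ and $\sum_k\lambda_k=N$; $\ell(\lambda)=\ell$ is its length, and $m(\lambda)=m_1!\,m_2!\cdots m_N!$, where $m_i$ is the number of times $i$ appears in $\lambda$. For $\vec w\in\mathbb C^{\ell(\lambda)}$ let $$\vec w\circ\lambda=(w_1,w_1+1,\dots,w_1+\lambda_1-1,\;w_2,\dots,w_2+\lambda_2-1,\;\dots,\;w_{\ell(\lambda)},\dots,w_{\ell(\lambda)}+\lambda_{\ell(\lambda)}-1)\in\mathbb C^N .$$ For $F:\mathbb C^N\to\mathbb C$ let $$E^F(z_1,\dots,z_N)=\sum_{\sigma\in S_N}\Big(\prod_{1\le B<A\le N}\frac{z_{\sigma(A)}-z_{\sigma(B)}-1}{z_{\sigma(A)}-z_{\sigma(B)}}\Big)F(z_{\sigma(1)},\dots,z_{\sigma(N)}).$$ All vertical lines are oriented upwards. **Lemma 3.2.** Let $a_1,\dots,a_N\in\mathbb R$ satisfy $a_j-a_{j+1}>1$ for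 $1\le j\le N-1$, and put $\gamma_k=a_k+\mathbf i\mathbb R$. Let $\theta\in\mathbb R$ and $\gamma=\theta+\mathbf i\mathbb R$. Let $\alpha<\beta$ be real numbers with $\alpha<a_k<\beta$ for all $k$, $\alpha<\theta$ and $\theta+N-1<\beta$. Suppose that $F:\mathbb C^N\to\mathbb C$ is analytic on the open tube $T=\{z\in\mathbb C^N:\alpha<\operatorname{Re}z_k<\beta\text{ for all }k\}$ and that there are constants $C\in\mathbb R$ and $\delta>0$ such that $$|F(z)|\le C\prod_{k=1}^N(1+|z_k|)^{-(1+\delta)}\qquad\text{for all }z\in T.$$ Then all the integrals below converge absolutely, and $$\oint_{\gamma_1}\cdots\oint_{\gamma_N}\Big(\prod_{1\le i<j\le N}\frac{z_i-z_j}{z_i-z_j-1}\Big)F(z_1,\dots,z_N)\prod_{i=1}^N\frac{dz_i}{2\pi\mathbf i} =\sum_{\lambda\vdash N}\oint_\gamma\cdots\oint_\gamma\frac1{m(\lambda)}\det\Big[\frac1{w_i+\lambda_i-w_j}\Big]_{i,j=1}^{\ell(\lambda)}E^F(\vec w\circ\lambda)\prod_{i=1}^{\ell(\lambda)}\frac{dw_i}{2\pi\mathbf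 i},$$ where the integral in the summand of $\lambda$ is an $\ell(\lambda)$-fold integral, every variable running over the same line $\gamma$. (In particular, if $F$ is entire and satisfies such a bound on every tube $T$, then $\theta\in\mathbb R$ is arbitrary.) -/

import Mathlib

open MeasureTheory

noncomputable section

namespace ContourFormula

/-! ### Partitions -/

/-- The parts `l₁ ≥ l₂ ≥ ⋯` of a partition, listed in nonincreasing order. -/
def sortedParts {N : ℕ} (l : Nat.Partition N) : List ℕ :=
  l.parts.sort (· ≥ ·)

/-- The length of a partition: its number of parts. -/
def len {N : ℕ} (l : Nat.Partition N) : ℕ :=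
  (sortedParts l).length

/-- The `i`-th largest part of a partition (indices start at `0`). -/
def part {N : ℕ} (l : Nat.Partition N) (i : Fin (len l)) : ℕ :=
  (sortedParts l)[(i : ℕ)]'i.isLt

/-- The constant `m₁! m₂! ⋯ m_N!`, where `mᵢ` is the number of times that `i` appears as a part. -/
def mult {N : ℕ} (l : Nat.Partition N) : ℕ :=
  ∏ i ∈ Finset.Icc 1 N, (l.parts.count i).factorial

theorem sum_part {N : ℕ} (l : Nat.Partition N) : ∑ i, part l i = N := by
  have h1 : ∑ i, part l i = (sortedParts l).sum :=
    Fin.sum_univ_getElem (sortedParts l)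
  have h2 : ((sortedParts l : List ℕ) : Multiset ℕ) = l.parts := Multiset.sort_eq _ _
  rw [h1, ← Multiset.sum_coe, h2, l.parts_sum]

/-- The vector `(w₁, w₁+1, …, w₁+l₁-1, w₂, …, w₂+l₂-1, …)` with `N` entries. The equivalence
`finSigmaFinEquiv` concatenates the blocks `Fin l₁, Fin l₂, …` in this order, so that its inverse
sends a position to the pair consisting of its block and its place in that block. -/
def strings {N : ℕ} (l : Nat.Partition N) (w : Fin (len l) → ℂ) : Fin N → ℂ := fun k =>
  let p := finSigmaFinEquiv.symm (Fin.cast (sum_part l).symm k)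
  w p.1 + ((p.2 : ℕ) : ℂ)

/-! ### Integrals over vertical lines -/

/-- The point of `(a₁ + iℝ) × ⋯ × (aₙ + iℝ)` with imaginary parts `y`. -/
def linePoint {n : ℕ} (a y : Fin n → ℝ) : Fin n → ℂ := fun k =>
  (a k : ℂ) + (y k : ℂ) * Complex.I

/-- `f` is absolutely integrable over `(a₁ + iℝ) × ⋯ × (aₙ + iℝ)`. -/
def LineIntegrable {n : ℕ} (a : Fin n → ℝ) (f : (Fin n → ℂ) → ℂ) : Prop :=
  Integrable (fun y : Fin n → ℝ => f (linePoint a y))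

/-- The `n`-fold integral of `f(z) ∏ dzₖ/(2πi)` over `(a₁ + iℝ) × ⋯ × (aₙ + iℝ)`, the lines being
oriented upwards: `dzₖ = i dyₖ` for `zₖ = aₖ + i yₖ`. -/
def lineIntegral {n : ℕ} (a : Fin n → ℝ) (f : (Fin n → ℂ) → ℂ) : ℂ :=
  ∫ y : Fin n → ℝ, f (linePoint a y) * (Complex.I / (2 * (Real.pi : ℂ) * Complex.I)) ^ n

/-- The open tube `{z | α < Re zₖ < β for all k}`. -/
def tube (n : ℕ) (α β : ℝ) : Set (Fin n → ℂ) :=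
  {z | ∀ k, α < (z k).re ∧ (z k).re < β}

/-! ### The two integrands -/

/-- `∏_{i<j} (zᵢ - zⱼ)/(zᵢ - zⱼ - 1) · F(z)`. -/
def nestedIntegrand {N : ℕ} (F : (Fin N → ℂ) → ℂ) (z : Fin N → ℂ) : ℂ :=
  (∏ i : Fin N, ∏ j ∈ Finset.Ioi i, (z i - z j) / (z i - z j - 1)) * F z

/-- The symmetrization
`E^F(z) = ∑_σ ∏_{B<A} (z_{σ(A)} - z_{σ(B)} - 1)/(z_{σ(A)} - z_{σ(B)}) · F(z_{σ(1)}, …, z_{σ(N)})`. -/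
def symm {N : ℕ} (F : (Fin N → ℂ) → ℂ) (z : Fin N → ℂ) : ℂ :=
  ∑ σ : Equiv.Perm (Fin N),
    (∏ B : Fin N, ∏ A ∈ Finset.Ioi B, (z (σ A) - z (σ B) - 1) / (z (σ A) - z (σ B))) *
      F (fun k => z (σ k))

/-- `1/m(l) · det[1/(wᵢ + lᵢ - wⱼ)] · E^F(w ∘ l)`. -/
def partitionIntegrand {N : ℕ} (F : (Fin N → ℂ) → ℂ) (l : Nat.Partition N)
    (w : Fin (len l) → ℂ) : ℂ :=
  1 / (mult l : ℂ) *
    (Matrix.of fun i j : Fin (len l) => 1 / (w i + (part l i : ℂ) - w j)).det *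
      symm F (strings l w)

end ContourFormula

end

open Filter Topology Set

noncomputable section

namespace ContourFormula

/-! ### Removable singularities and integrals over vertical lines in one variable -/

/-! The proof is an induction on the number of variables, carried out for ordered strings: the
nested integral equals `∑ₙ 1/n! ∑_c` of string integrals over `γ`, where `c` runs over the
compositions of `N` into `n` positive parts (`lineIntegral_nestedIntegrand_eq`). A partition with
`n` parts has `n!/m(λ)` orderings, which turns `1/n!` into `1/m(λ)` (`sum_comps_eq_sum_partition`).

Inductive step. The first variable `z` has the rightmost contour, and moving it further right meets
no pole of `1/(z - z_j - 1)`. Once `Re z > θ + N`, the product of its interactions with `F(z, ·)` is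
holomorphic on a tube large enough for the induction hypothesis, which replaces the remaining nested
integral by string integrals over `γ`. The interaction is symmetric in the other variables, so it
leaves the symmetrization, and along strings it telescopes to `∏ (z - w_i)/(z - w_i - c_i)`.
Bringing `z` back to `γ` crosses only the simple poles `z = w_i + c_i`, where `z` becomes the new
top point of the `i`-th string (`shift_first_variable`). In the term without a residue, `z` starts a
string of length one.

It remains to recognize these terms in the expansion for `N + 1` variables. On a union of strings
the factors `z_A - z_B - 1` kill every permutation whose first variable is not the top of a string
(`symmSet_stringSet_succ`). The coefficient of a top, multiplied by the Cauchy determinant, does not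
depend on the length of that string (`topCoeff_cons`). Hence the residue at a string of length `m`
is exactly the term in which a string of length `m + 1` loses its top, and `m = 0` is the newborn
string. The `n + 1` choices of the string reduce `1/(n+1)!` to `1/n!`.

For the analysis, the poles of the symmetrization on the diagonals are only apparent, because its
common numerator is antisymmetric. The maximum principle, used in one variable at a time, bounds it
by the decay of `F` with a constant independent of `F` (`exists_norm_symm_le`). Applied to slices of
`F`, this gives the absolute convergence needed for Fubini and for the residue theorem. Coinciding
imaginary parts form a null set; away from it the strings are disjoint. -/

theorem exists_differentiableOn_eq_off_finset {U : Set ℂ} (hU : IsOpen U) (S : Finset ℂ) :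
    ∀ f : ℂ → ℂ, DifferentiableOn ℂ f (U \ S) →
    (∀ s ∈ S, s ∈ U → Tendsto (fun z => (z - s) * f z) (𝓝[≠] s) (𝓝 0)) →
    ∃ g : ℂ → ℂ, DifferentiableOn ℂ g U ∧ ∀ z ∉ S, g z = f z := by
  induction S using Finset.induction_on with
  | empty =>
    intro f hf _
    exact ⟨f, by simpa using hf, fun _ _ => rfl⟩
  | insert s S hs ih =>
    intro f hf hS
    by_cases hsU : s ∈ U
    · have hopen : U \ (S : Set ℂ) ∈ 𝓝 s :=
        (hU.sdiff S.finite_toSet.isClosed).mem_nhds ⟨hsU, by simpa using hs⟩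
      -- The value `f s` is arbitrary; it does no harm because `(z - s) * f s` tends to zero.
      have ho : (fun z => f z - f s) =o[𝓝[≠] s] fun z => (z - s)⁻¹ := by
        have hne : ∀ᶠ z in 𝓝[≠] s, (z - s)⁻¹ = 0 → f z - f s = 0 := by
          filter_upwards [self_mem_nhdsWithin] with z hz h0
          exact absurd (inv_eq_zero.1 h0) (sub_ne_zero.2 hz)
        refine (Asymptotics.isLittleO_iff_tendsto' hne).2 ?_
        have h1 := hS s (by simp) hsU
        have h2 : Tendsto (fun z => (z - s) * f s) (𝓝[≠] s) (𝓝 0) := by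
          have : Tendsto (fun z => (z - s) * f s) (𝓝 s) (𝓝 ((s - s) * f s)) :=
            Continuous.tendsto (by fun_prop) s
          simpa using this.mono_left nhdsWithin_le_nhds
        have h3 := h1.sub h2
        rw [sub_zero] at h3
        refine h3.congr fun z => ?_
        rw [div_inv_eq_mul]; ring
      have hd := Complex.differentiableOn_update_limUnder_of_isLittleO hopen
        (f := f) (by
          refine hf.mono ?_
          rintro z ⟨⟨h1, h2⟩, h3⟩
          refine ⟨h1, ?_⟩
          simp only [Finset.coe_insert, Set.mem_insert_iff, not_or]
          exact ⟨h3, h2⟩) ho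
      obtain ⟨g, hg, hgf⟩ := ih _ hd (by
        intro t ht htU
        have hts : t ≠ s := fun h => hs (h ▸ ht)
        refine (hS t (by simp [ht]) htU).congr' ?_
        have : ∀ᶠ z in 𝓝 t, z ≠ s := isOpen_ne.mem_nhds hts
        filter_upwards [nhdsWithin_le_nhds this] with z hz
        rw [Function.update_of_ne hz])
      refine ⟨g, hg, fun z hz => ?_⟩
      simp only [Finset.mem_insert, not_or] at hz
      rw [hgf z hz.2, Function.update_of_ne hz.1]
    · have heq : U \ ((insert s S : Finset ℂ) : Set ℂ) = U \ S := by
        ext z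
        simp only [Finset.coe_insert, Set.mem_sdiff, Set.mem_insert_iff, not_or]
        constructor
        · rintro ⟨h1, _, h2⟩; exact ⟨h1, h2⟩
        · rintro ⟨h1, h2⟩; exact ⟨h1, fun h => hsU (h ▸ h1), h2⟩
      obtain ⟨g, hg, hgf⟩ := ih f (heq ▸ hf) fun t ht => hS t (by simp [ht])
      refine ⟨g, hg, fun z hz => hgf z ?_⟩
      simp only [Finset.mem_insert, not_or] at hz
      exact hz.2

/-- The maximum principle for the holomorphic extension of `f`, which agrees with `f` at the centre
and on the circle since neither meets the exceptional set. -/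
theorem norm_le_of_sphere_of_removable {c : ℂ} {r R M : ℝ} (hr : 0 < r) (hrR : r < R)
    (S : Finset ℂ) (f : ℂ → ℂ) (hf : DifferentiableOn ℂ f (Metric.ball c R \ S))
    (hS : ∀ s ∈ S, s ∈ Metric.ball c R → Tendsto (fun z => (z - s) * f z) (𝓝[≠] s) (𝓝 0))
    (hSr : ∀ s ∈ S, s ∉ Metric.sphere c r) (hc : c ∉ S)
    (hM : ∀ z ∈ Metric.sphere c r, ‖f z‖ ≤ M) : ‖f c‖ ≤ M := by
  obtain ⟨g, hg, hgf⟩ := exists_differentiableOn_eq_off_finset Metric.isOpen_ball S f hf hS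
  rw [← hgf c hc]
  have hsub : closure (Metric.ball c r) ⊆ Metric.ball c R := by
    rw [closure_ball c hr.ne']
    exact Metric.closedBall_subset_ball hrR
  refine Complex.norm_le_of_forall_mem_frontier_norm_le Metric.isBounded_ball
    (DifferentiableOn.diffContOnCl (hg.mono hsub)) ?_ (subset_closure (Metric.mem_ball_self hr))
  intro z hz
  rw [frontier_ball c hr.ne'] at hz
  rw [hgf z fun h => hSr z h hz]
  exact hM z hz

/-- The integral over a vertical line does not depend on the line, for a function that is
holomorphic and tends to zero at infinity in the strip between. -/
theorem integral_vertical_eq {a b : ℝ} (hab : a ≤ b) {f : ℂ → ℂ}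
    (hf : DifferentiableOn ℂ f {z | a ≤ z.re ∧ z.re ≤ b})
    (hia : Integrable fun y : ℝ => f (a + y * Complex.I))
    (hib : Integrable fun y : ℝ => f (b + y * Complex.I))
    {B : ℝ → ℝ} (hB : Tendsto B atTop (𝓝 0))
    (hfB : ∀ᶠ T in atTop, ∀ z : ℂ, a ≤ z.re → z.re ≤ b → |z.im| = T → ‖f z‖ ≤ B T) :
    ∫ y : ℝ, f (a + y * Complex.I) = ∫ y : ℝ, f (b + y * Complex.I) := by
  have hA := intervalIntegral_tendsto_integral hia tendsto_neg_atTop_atBot tendsto_id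
  have hA' := intervalIntegral_tendsto_integral hib tendsto_neg_atTop_atBot tendsto_id
  have hdiff := hA'.sub hA
  have hzero : Tendsto (fun T : ℝ => (∫ y in (-T)..(id T), f (b + y * Complex.I)) -
      ∫ y in (-T)..(id T), f (a + y * Complex.I)) atTop (𝓝 0) := by
    rw [tendsto_zero_iff_norm_tendsto_zero]
    have hlim : Tendsto (fun T => 2 * (B T * |b - a|)) atTop (𝓝 0) := by
      simpa using (hB.mul_const |b - a|).const_mul 2
    refine tendsto_of_tendsto_of_tendsto_of_le_of_le' tendsto_const_nhds hlim
      (Eventually.of_forall fun _ => norm_nonneg _) ?_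
    filter_upwards [hfB, eventually_ge_atTop 0] with T hT hT0
    -- By Cauchy on the rectangle of height `2T`, the vertical sides differ by the horizontal ones,
    -- each at most `B T * |b - a|`.
    have hrect := Complex.integral_boundary_rect_eq_zero_of_differentiableOn f
      ⟨a, -T⟩ ⟨b, T⟩ (hf.mono (by
        rintro z ⟨h1, _⟩
        simpa [uIcc_of_le hab] using h1))
    simp only [] at hrect
    have h1 : ‖∫ x : ℝ in a..b, f (x + ((-T : ℝ) : ℂ) * Complex.I)‖ ≤ B T * |b - a| := by
      refine intervalIntegral.norm_integral_le_of_norm_le_const fun x hx => ?_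
      rw [uIoc_of_le hab] at hx
      refine hT _ ?_ ?_ ?_
      · simpa using hx.1.le
      · simpa using hx.2
      · simp [abs_of_nonneg hT0]
    have h2 : ‖∫ x : ℝ in a..b, f (x + (T : ℂ) * Complex.I)‖ ≤ B T * |b - a| := by
      refine intervalIntegral.norm_integral_le_of_norm_le_const fun x hx => ?_
      rw [uIoc_of_le hab] at hx
      refine hT _ ?_ ?_ ?_
      · simpa using hx.1.le
      · simpa using hx.2
      · simp [abs_of_nonneg hT0]
    have h3 : Complex.I * ((∫ y in (-T)..T, f (b + y * Complex.I)) -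
        ∫ y in (-T)..T, f (a + y * Complex.I)) =
        (∫ x : ℝ in a..b, f (x + (T : ℂ) * Complex.I)) -
          ∫ x : ℝ in a..b, f (x + ((-T : ℝ) : ℂ) * Complex.I) := by
      simp only [smul_eq_mul] at hrect
      linear_combination hrect
    have h4 := congrArg norm h3
    rw [norm_mul, Complex.norm_I, one_mul] at h4
    simp only [id]
    rw [h4]
    refine (norm_sub_le _ _).trans ?_
    linarith
  have := tendsto_nhds_unique hdiff hzero
  exact (sub_eq_zero.1 this).symm

theorem integral_inv_sq_add_sq {s : ℝ} (hs : 0 < s) :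
    ∫ y : ℝ, (s ^ 2 + y ^ 2)⁻¹ = Real.pi / s := by
  have h := Measure.integral_comp_div (fun y : ℝ => (1 + y ^ 2)⁻¹) s
  rw [integral_univ_inv_one_add_sq] at h
  have h2 : ∀ y : ℝ, (s ^ 2 + y ^ 2)⁻¹ = (s ^ 2)⁻¹ * (1 + (y / s) ^ 2)⁻¹ := by
    intro y
    rw [← mul_inv]
    congr 1
    field_simp
  simp_rw [h2]
  rw [integral_const_mul, h, abs_of_pos hs, smul_eq_mul]
  field_simp

/-- A non-integrable function has integral `0` by convention, whereas this integral is `π / s`. -/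
theorem integrable_inv_sq_add_sq {s : ℝ} (hs : 0 < s) :
    Integrable fun y : ℝ => (s ^ 2 + y ^ 2)⁻¹ := by
  by_contra h
  have h1 := integral_inv_sq_add_sq hs
  rw [integral_undef h] at h1
  exact (div_pos Real.pi_pos hs).ne h1

/-- A decaying kernel with residue `1` at `0` and no other pole with real part above `-A`. -/
def poleKernel (A : ℝ) (u : ℂ) : ℂ := A / (u * (u + A))

theorem norm_poleKernel_le {A t : ℝ} (ht : 0 < t) {u : ℂ} (h1 : t ≤ |u.re|)
    (h2 : t ≤ |u.re + A|) : ‖poleKernel A u‖ ≤ |A| * (t ^ 2 + u.im ^ 2)⁻¹ := by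
  have key : ∀ v : ℂ, t ≤ |v.re| → Real.sqrt (t ^ 2 + v.im ^ 2) ≤ ‖v‖ := by
    intro v hv
    rw [Complex.norm_def, Complex.normSq_apply]
    apply Real.sqrt_le_sqrt
    have : t ^ 2 ≤ v.re ^ 2 := by rw [← sq_abs v.re]; gcongr
    nlinarith
  have k1 := key u h1
  have k2 := key (u + A) (by simpa using h2)
  have him : (u + A).im = u.im := by simp
  rw [him] at k2
  have hpos : 0 < t ^ 2 + u.im ^ 2 := by positivity
  rw [poleKernel, norm_div, norm_mul, div_eq_mul_inv, Complex.norm_real, Real.norm_eq_abs]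
  gcongr
  calc t ^ 2 + u.im ^ 2 = Real.sqrt (t ^ 2 + u.im ^ 2) * Real.sqrt (t ^ 2 + u.im ^ 2) :=
        (Real.mul_self_sqrt hpos.le).symm
    _ ≤ _ := by gcongr

theorem poleKernel_differentiableAt {A : ℝ} {u : ℂ} (h1 : u ≠ 0) (h2 : u + A ≠ 0) :
    DifferentiableAt ℂ (poleKernel A) u := by
  unfold poleKernel
  exact DifferentiableAt.div (by fun_prop) (by fun_prop) (mul_ne_zero h1 h2)

theorem add_mul_I_ne_zero {s : ℝ} (hs : s ≠ 0) (y : ℝ) : (s : ℂ) + y * Complex.I ≠ 0 := by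
  intro h
  have := congrArg Complex.re h
  simp at this
  exact hs this

theorem continuous_poleKernel_vertical {A s : ℝ} (h1 : s ≠ 0) (h2 : s + A ≠ 0) :
    Continuous fun y : ℝ => poleKernel A (s + y * Complex.I) := by
  unfold poleKernel
  refine Continuous.div (by fun_prop) (by fun_prop) fun y => ?_
  refine mul_ne_zero (add_mul_I_ne_zero h1 y) ?_
  have := add_mul_I_ne_zero h2 y
  push_cast at this
  convert this using 1
  ring

theorem integrable_poleKernel {A s : ℝ} (h1 : s ≠ 0) (h2 : s + A ≠ 0) :
    Integrable fun y : ℝ => poleKernel A (s + y * Complex.I) := by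
  have ht : 0 < min |s| |s + A| := lt_min (abs_pos.2 h1) (abs_pos.2 h2)
  refine ((integrable_inv_sq_add_sq ht).const_mul |A|).mono'
    (continuous_poleKernel_vertical h1 h2).aestronglyMeasurable (Eventually.of_forall fun y => ?_)
  have := norm_poleKernel_le (A := A) ht (u := s + y * Complex.I) (by simp) (by simp)
  simpa using this

theorem tendsto_const_mul_inv_sq_atTop (A : ℝ) :
    Tendsto (fun T : ℝ => A * (T ^ 2)⁻¹) atTop (𝓝 0) := by
  have h : Tendsto (fun T : ℝ => (T ^ 2)⁻¹) atTop (𝓝 0) :=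
    (tendsto_pow_atTop (two_ne_zero)).inv_tendsto_atTop
  simpa using h.const_mul A

theorem norm_poleKernel_le_of_im {A : ℝ} {u : ℂ} (h : u.im ≠ 0) :
    ‖poleKernel A u‖ ≤ |A| * (u.im ^ 2)⁻¹ := by
  have k1 : |u.im| ≤ ‖u‖ := Complex.abs_im_le_norm u
  have k2 : |u.im| ≤ ‖u + A‖ := by simpa using Complex.abs_im_le_norm (u + A)
  have h0 := abs_pos.2 h
  rw [poleKernel, norm_div, norm_mul, div_eq_mul_inv, Complex.norm_real, Real.norm_eq_abs]
  rw [← sq_abs u.im, sq]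
  gcongr

theorem integral_poleKernel_eq {A s t : ℝ} (hst : s ≤ t)
    (h : ∀ u ∈ Icc s t, u ≠ 0 ∧ u + A ≠ 0) :
    ∫ y : ℝ, poleKernel A (s + y * Complex.I) = ∫ y : ℝ, poleKernel A (t + y * Complex.I) := by
  have hs := h s ⟨le_rfl, hst⟩
  have ht := h t ⟨hst, le_rfl⟩
  refine integral_vertical_eq hst ?_ (integrable_poleKernel hs.1 hs.2)
    (integrable_poleKernel ht.1 ht.2) (tendsto_const_mul_inv_sq_atTop |A|) ?_
  · intro z hz
    have := h z.re hz
    refine (poleKernel_differentiableAt ?_ ?_).differentiableWithinAt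
    · rintro rfl; simp at this
    · intro h0
      have h1 := congrArg Complex.re h0
      simp at h1
      exact this.2 h1
  · filter_upwards [eventually_gt_atTop 0] with T hT z _ _ hz
    have := norm_poleKernel_le_of_im (A := A) (u := z) (by
      intro h0; rw [h0, abs_zero] at hz; exact hT.ne hz)
    rwa [← sq_abs, hz] at this

/-- There is no pole to the right, so the line can be pushed to infinity, where the integral is
`O(1/t)`. -/
theorem integral_poleKernel_of_pos {A s : ℝ} (hA : 0 < A) (hs : 0 < s) :
    ∫ y : ℝ, poleKernel A (s + y * Complex.I) = 0 := by
  have hbound : ∀ t : ℝ, s ≤ t →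
      ‖∫ y : ℝ, poleKernel A (s + y * Complex.I)‖ ≤ A * (Real.pi / t) := by
    intro t hst
    have ht := hs.trans_le hst
    rw [integral_poleKernel_eq hst (fun u hu => by
      have := hs.trans_le hu.1
      exact ⟨this.ne', by positivity⟩), ← integral_inv_sq_add_sq ht, ← integral_const_mul]
    refine norm_integral_le_of_norm_le ((integrable_inv_sq_add_sq ht).const_mul A)
      (Eventually.of_forall fun y => ?_)
    have := norm_poleKernel_le (A := A) ht (u := t + y * Complex.I)
      (by simp [le_abs_self]) (by
        simp only [Complex.add_re, Complex.ofReal_re, Complex.mul_re, Complex.I_re, mul_zero,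
          Complex.ofReal_im, Complex.I_im, mul_one, sub_self, add_zero]
        exact (by linarith : t ≤ t + A).trans (le_abs_self _))
    simpa [abs_of_pos hA] using this
  have hlim : Tendsto (fun t : ℝ => A * (Real.pi / t)) atTop (𝓝 0) := by
    simpa using (tendsto_const_nhds.div_atTop tendsto_id : Tendsto (fun t : ℝ => Real.pi / t)
      atTop (𝓝 0)).const_mul A
  have := ge_of_tendsto hlim ((eventually_ge_atTop s).mono hbound)
  exact norm_le_zero_iff.1 this

/-- Halfway between the two poles the kernel is real, equal to `-A / ((A/2)² + y²)`, and any line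
between the poles can be moved there. -/
theorem integral_poleKernel_of_neg {A s : ℝ} (hA : 0 < A) (hs : s < 0) (hsA : 0 < s + A) :
    ∫ y : ℝ, poleKernel A (s + y * Complex.I) = -(2 * Real.pi) := by
  have hmid : ∫ y : ℝ, poleKernel A (((-(A / 2) : ℝ) : ℂ) + y * Complex.I) =
      -(2 * Real.pi) := by
    have : ∀ y : ℝ, poleKernel A (((-(A / 2) : ℝ) : ℂ) + y * Complex.I) =
        ((-(A * ((A / 2) ^ 2 + y ^ 2)⁻¹) : ℝ) : ℂ) := by
      intro y
      unfold poleKernel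
      have e : (((-(A / 2) : ℝ) : ℂ) + y * Complex.I) *
          (((-(A / 2) : ℝ) : ℂ) + y * Complex.I + A) = ((-((A / 2) ^ 2 + y ^ 2) : ℝ) : ℂ) := by
        push_cast
        linear_combination (y : ℂ) ^ 2 * Complex.I_sq
      rw [e, ← Complex.ofReal_div, div_neg, div_eq_mul_inv]
    simp_rw [this]
    rw [integral_complex_ofReal, integral_neg, integral_const_mul, integral_inv_sq_add_sq (by positivity)]
    push_cast
    have : (A : ℂ) ≠ 0 := by exact_mod_cast hA.ne'
    field_simp
  rw [← hmid]
  rcases le_total s (-(A / 2)) with h | h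
  · exact integral_poleKernel_eq h fun u hu => ⟨by linarith [hu.2], by linarith [hu.1]⟩
  · exact (integral_poleKernel_eq h fun u hu =>
      ⟨by linarith [hu.2], by linarith [hu.1]⟩).symm

theorem tendsto_sub_mul_poleKernel {A : ℝ} (hA : 0 < A) (s : ℂ) :
    Tendsto (fun z => (z - s) * poleKernel A (z - s)) (𝓝[≠] s) (𝓝 1) := by
  have hA' : (A : ℂ) ≠ 0 := by exact_mod_cast hA.ne'
  have h : ContinuousAt (fun z : ℂ => (A : ℂ) / (z - s + A)) s :=
    ContinuousAt.div (by fun_prop) (by fun_prop) (by simpa using hA')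
  have h1 : Tendsto (fun z : ℂ => (A : ℂ) / (z - s + A)) (𝓝[≠] s) (𝓝 1) := by
    have := h.tendsto.mono_left (nhdsWithin_le_nhds (s := {s}ᶜ))
    simpa [div_self hA'] using this
  refine h1.congr' ?_
  filter_upwards [self_mem_nhdsWithin] with z hz
  have : z - s ≠ 0 := sub_ne_zero.2 hz
  rw [poleKernel, mul_div_assoc', mul_div_mul_left _ _ this]

/-- The difference of the integrals of a meromorphic function over two vertical lines is the sum
of the residues at the simple poles between the lines. -/
theorem integral_vertical_sub_eq_sum_residues {a b α β : ℝ} (hαa : α < a) (hab : a ≤ b)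
    (hbβ : b < β) (S : Finset ℂ) (hSab : ∀ s ∈ S, a < s.re ∧ s.re < b) {f : ℂ → ℂ}
    (hf : DifferentiableOn ℂ f ({z | α < z.re ∧ z.re < β} \ S)) (r : ℂ → ℂ)
    (hr : ∀ s ∈ S, Tendsto (fun z => (z - s) * f z) (𝓝[≠] s) (𝓝 (r s)))
    (hia : Integrable fun y : ℝ => f (a + y * Complex.I))
    (hib : Integrable fun y : ℝ => f (b + y * Complex.I))
    {B : ℝ → ℝ} (hB : Tendsto B atTop (𝓝 0))
    (hfB : ∀ᶠ T in atTop, ∀ z : ℂ, a ≤ z.re → z.re ≤ b → |z.im| = T → ‖f z‖ ≤ B T) :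
    (∫ y : ℝ, f (b + y * Complex.I)) - ∫ y : ℝ, f (a + y * Complex.I) =
      2 * Real.pi * ∑ s ∈ S, r s := by
  set U : Set ℂ := {z | α < z.re ∧ z.re < β} with hU
  have hUo : IsOpen U :=
    (isOpen_lt continuous_const Complex.continuous_re).inter
      (isOpen_lt Complex.continuous_re continuous_const)
  -- Larger than the width of the strip, so that the second pole `s - A` of each kernel lies to the
  -- left of the strip.
  set A : ℝ := β - α + 1 with hAdef
  have hA : 0 < A := by linarith
  have hSU : ∀ s ∈ S, s ∈ U := fun s hs => ⟨by linarith [(hSab s hs).1], by linarith [(hSab s hs).2]⟩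
  have hne : ∀ z ∈ U, ∀ s ∈ S, z - s + A ≠ 0 := by
    intro z hz s hs h
    have h1 := congrArg Complex.re h
    simp at h1
    have := (hSU s hs).2
    have := hz.1
    linarith
  -- Subtracting integrable kernels instead of bare principal parts removes the poles and keeps both
  -- line integrals convergent. Each kernel has integral `-2π` on the left line and `0` on the right
  -- one.
  set h : ℂ → ℂ := fun z => f z - ∑ s ∈ S, r s * poleKernel A (z - s) with hh
  have hkd : ∀ z ∈ U, ∀ s ∈ S, z ≠ s → DifferentiableAt ℂ (fun z => r s * poleKernel A (z - s)) z := by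
    intro z hz s hs hzs
    have h1 := poleKernel_differentiableAt (sub_ne_zero.2 hzs) (hne z hz s hs)
    exact (h1.comp z (f := fun z => z - s) (by fun_prop)).const_mul (r s)
  have hhd : DifferentiableOn ℂ h (U \ S) := by
    refine hf.sub ?_
    refine DifferentiableOn.fun_sum fun s hs z hz => ?_
    exact (hkd z hz.1 s hs (fun h => hz.2 (h ▸ hs))).differentiableWithinAt
  obtain ⟨g, hg, hgh⟩ := exists_differentiableOn_eq_off_finset hUo S h hhd (by
    intro s hs hsU
    have h1 := hr s hs
    have h2 := (tendsto_sub_mul_poleKernel hA s).const_mul (r s)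
    have h3 : Tendsto (fun z => (z - s) * ∑ t ∈ S.erase s, r t * poleKernel A (z - t))
        (𝓝[≠] s) (𝓝 0) := by
      have hc : ContinuousAt (fun z => (z - s) * ∑ t ∈ S.erase s, r t * poleKernel A (z - t)) s := by
        refine ContinuousAt.mul (by fun_prop) ?_
        refine tendsto_finsetSum _ fun t ht => ?_
        exact (hkd s hsU t (Finset.mem_of_mem_erase ht) (Finset.ne_of_mem_erase ht).symm).continuousAt
      have := hc.tendsto.mono_left (nhdsWithin_le_nhds (s := {s}ᶜ))
      simpa using this
    have h4 := (h1.sub h2).sub h3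
    simp only [mul_one, sub_self] at h4
    refine h4.congr fun z => ?_
    simp only [hh]
    rw [← Finset.add_sum_erase S _ hs]
    ring)
  have hline : ∀ c : ℝ, (∀ s ∈ S, s.re ≠ c) → ∀ y : ℝ,
      g (c + y * Complex.I) = h (c + y * Complex.I) := by
    intro c hc y
    refine hgh _ fun hs => hc _ hs (by simp)
  have hia' : ∀ s ∈ S, Integrable fun y : ℝ => poleKernel A ((a + y * Complex.I) - s) := by
    intro s hs
    have h1 := (integrable_poleKernel (A := A) (s := a - s.re) (by linarith [(hSab s hs).1]) (by
      have := (hSU s hs).2; intro h0; linarith)).comp_sub_right s.im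
    refine h1.congr (Eventually.of_forall fun y => ?_)
    simp only []
    congr 1
    apply Complex.ext <;> simp
  have hib' : ∀ s ∈ S, Integrable fun y : ℝ => poleKernel A ((b + y * Complex.I) - s) := by
    intro s hs
    have h1 := (integrable_poleKernel (A := A) (s := b - s.re) (by linarith [(hSab s hs).2]) (by
      have := (hSab s hs).2; intro h0; linarith)).comp_sub_right s.im
    refine h1.congr (Eventually.of_forall fun y => ?_)
    simp only []
    congr 1
    apply Complex.ext <;> simp
  have hva : ∀ s ∈ S, ∫ y : ℝ, poleKernel A ((a + y * Complex.I) - s) = -(2 * Real.pi) := by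
    intro s hs
    rw [← integral_poleKernel_of_neg hA (s := a - s.re) (by linarith [(hSab s hs).1])
      (by linarith [(hSU s hs).2]), ← integral_add_right_eq_self (fun y : ℝ => poleKernel A ((a + y * Complex.I) - s)) s.im]
    congr 1; ext y; congr 1
    apply Complex.ext <;> simp
  have hvb : ∀ s ∈ S, ∫ y : ℝ, poleKernel A ((b + y * Complex.I) - s) = 0 := by
    intro s hs
    rw [← integral_poleKernel_of_pos hA (s := b - s.re) (by linarith [(hSab s hs).2]),
      ← integral_add_right_eq_self (fun y : ℝ => poleKernel A ((b + y * Complex.I) - s)) s.im]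
    congr 1; ext y; congr 1
    apply Complex.ext <;> simp
  have hsia : Integrable fun y : ℝ => ∑ s ∈ S, r s * poleKernel A ((a + y * Complex.I) - s) :=
    integrable_finsetSum _ fun s hs => (hia' s hs).const_mul _
  have hsib : Integrable fun y : ℝ => ∑ s ∈ S, r s * poleKernel A ((b + y * Complex.I) - s) :=
    integrable_finsetSum _ fun s hs => (hib' s hs).const_mul _
  have hga : ∀ y : ℝ, g (a + y * Complex.I) = h (a + y * Complex.I) :=
    hline a fun s hs => (hSab s hs).1.ne'
  have hgb : ∀ y : ℝ, g (b + y * Complex.I) = h (b + y * Complex.I) :=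
    hline b fun s hs => (hSab s hs).2.ne
  have hmain := integral_vertical_eq hab (f := g)
    (hg.mono fun z hz => ⟨by linarith [hz.1], by linarith [hz.2]⟩)
    (by simp_rw [hga]; exact hia.sub hsia) (by simp_rw [hgb]; exact hib.sub hsib)
    (B := fun T => B T + ∑ s ∈ S, ‖r s‖ * (A * 4 * (T ^ 2)⁻¹))
    (by
      have : Tendsto (fun T : ℝ => ∑ s ∈ S, ‖r s‖ * (A * 4 * (T ^ 2)⁻¹)) atTop (𝓝 0) := by
        rw [← Finset.sum_const_zero (s := S)]
        refine tendsto_finsetSum _ fun s _ => ?_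
        simpa using (tendsto_const_mul_inv_sq_atTop (A * 4)).const_mul ‖r s‖
      simpa using hB.add this)
    (by
      -- Beyond twice the height of every pole, `|Im (z - s)| ≥ T / 2`; this is the source of the
      -- factor `4` in the bound.
      have hbig : ∀ᶠ T : ℝ in atTop, ∀ s ∈ S, 2 * |s.im| < T := by
        rw [Filter.eventually_all_finset]
        exact fun s _ => eventually_gt_atTop _
      filter_upwards [hfB, hbig, eventually_gt_atTop 0] with T h1 h2 hT z hz1 hz2 hz
      have him : ∀ s ∈ S, T / 2 ≤ |(z - s).im| := by
        intro s hs
        have := h2 s hs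
        have h3 := abs_sub_abs_le_abs_sub z.im s.im
        rw [Complex.sub_im]
        linarith
      have hzS : z ∉ S := fun hs => by
        have := him z hs
        simp at this
        linarith
      rw [hgh z hzS]
      refine (norm_sub_le _ _).trans (add_le_add (h1 z hz1 hz2 hz) ?_)
      refine norm_sum_le_of_le _ fun s hs => ?_
      rw [norm_mul]
      gcongr
      have h4 := him s hs
      have h5 : (z - s).im ≠ 0 := by
        intro h0; rw [h0, abs_zero] at h4; linarith
      refine (norm_poleKernel_le_of_im h5).trans ?_
      rw [abs_of_pos hA, mul_assoc]
      gcongr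
      have h6 : (T / 2) ^ 2 ≤ (z - s).im ^ 2 := by
        rw [← sq_abs (z - s).im]; gcongr
      calc ((z - s).im ^ 2)⁻¹ ≤ ((T / 2) ^ 2)⁻¹ := by gcongr
        _ = 4 * (T ^ 2)⁻¹ := by field_simp; norm_num)
  simp_rw [hga, hgb, hh] at hmain
  rw [integral_sub hia hsia, integral_sub hib hsib,
    integral_finsetSum _ (fun s hs => (hia' s hs).const_mul _),
    integral_finsetSum _ (fun s hs => (hib' s hs).const_mul _)] at hmain
  simp_rw [integral_const_mul] at hmain
  have ea : ∑ s ∈ S, r s * ∫ y : ℝ, poleKernel A ((a + y * Complex.I) - s) =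
      (∑ s ∈ S, r s) * -(2 * Real.pi) := by
    rw [Finset.sum_mul]
    exact Finset.sum_congr rfl fun s hs => by rw [hva s hs]
  have eb : ∑ s ∈ S, r s * ∫ y : ℝ, poleKernel A ((b + y * Complex.I) - s) = 0 :=
    Finset.sum_eq_zero fun s hs => by rw [hvb s hs, mul_zero]
  rw [ea, eb] at hmain
  linear_combination -hmain

/-! ### Boundedness of the symmetrization -/

/-- The weight `∏ (1 + |zₖ|)^(-p)`. -/
def decay {N : ℕ} (p : ℝ) (z : Fin N → ℂ) : ℝ := ∏ k, (1 + ‖z k‖) ^ (-p)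

theorem decay_pos {N : ℕ} (p : ℝ) (z : Fin N → ℂ) : 0 < decay p z :=
  Finset.prod_pos fun k _ => Real.rpow_pos_of_pos (by positivity) _

theorem decay_comp_perm {N : ℕ} (p : ℝ) (z : Fin N → ℂ) (σ : Equiv.Perm (Fin N)) :
    decay p (fun k => z (σ k)) = decay p z :=
  Equiv.prod_comp σ fun k => (1 + ‖z k‖) ^ (-p)

theorem rpow_neg_le_of_dist_le {p r : ℝ} (hp : 0 ≤ p) {u v : ℂ} (h : ‖u - v‖ ≤ r) :
    (1 + ‖u‖) ^ (-p) ≤ (1 + r) ^ p * (1 + ‖v‖) ^ (-p) := by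
  have hr : 0 ≤ r := (norm_nonneg _).trans h
  have h1 : 1 + ‖v‖ ≤ (1 + r) * (1 + ‖u‖) := by
    have : ‖v‖ ≤ ‖u‖ + r := by
      have := norm_sub_norm_le v u
      rw [norm_sub_rev] at this
      linarith
    nlinarith [norm_nonneg u]
  have hv : 0 < 1 + ‖v‖ := by positivity
  have hu : 0 < 1 + ‖u‖ := by positivity
  rw [Real.rpow_neg hu.le, Real.rpow_neg hv.le]
  have h2 := Real.rpow_le_rpow hv.le h1 hp
  rw [Real.mul_rpow (by positivity) hu.le] at h2
  rw [← div_eq_mul_inv, le_div_iff₀ (Real.rpow_pos_of_pos hv p), inv_mul_le_iff₀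
    (Real.rpow_pos_of_pos hu p)]
  linarith

theorem decay_update_le {N : ℕ} {p r : ℝ} (hp : 0 ≤ p) (z : Fin N → ℂ) (k : Fin N) {u : ℂ}
    (h : ‖u - z k‖ ≤ r) :
    decay p (Function.update z k u) ≤ (1 + r) ^ p * decay p z := by
  unfold decay
  rw [← Finset.mul_prod_erase _ _ (Finset.mem_univ k),
    ← Finset.mul_prod_erase _ (fun i => (1 + ‖z i‖) ^ (-p)) (Finset.mem_univ k), ← mul_assoc]
  have : ∏ x ∈ Finset.univ.erase k, (1 + ‖Function.update z k u x‖) ^ (-p) =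
      ∏ x ∈ Finset.univ.erase k, (1 + ‖z x‖) ^ (-p) :=
    Finset.prod_congr rfl fun x hx => by rw [Function.update_of_ne (Finset.ne_of_mem_erase hx)]
  rw [this, Function.update_self]
  refine mul_le_mul_of_nonneg_right (rpow_neg_le_of_dist_le hp h) ?_
  exact Finset.prod_nonneg fun x _ => Real.rpow_nonneg (by positivity) _

/-- Bisect once for each point: a point lies in the interior of at most one half. -/
theorem exists_subinterval_avoiding (S : Finset ℝ) : ∀ u v : ℝ, u ≤ v →
    ∃ u' v' : ℝ, u ≤ u' ∧ v' ≤ v ∧ v' - u' = (v - u) / 2 ^ S.card ∧ ∀ s ∈ S, s ∉ Ioo u' v' := by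
  induction S using Finset.induction_on with
  | empty => exact fun u v _ => ⟨u, v, le_rfl, le_rfl, by simp, by simp⟩
  | insert s S hs ih =>
    intro u v huv
    rw [Finset.card_insert_of_notMem hs]
    rcases le_total s ((u + v) / 2) with h | h
    · obtain ⟨u', v', h1, h2, h3, h4⟩ := ih ((u + v) / 2) v (by linarith)
      refine ⟨u', v', by linarith, h2, by rw [h3, pow_succ]; field_simp; ring, ?_⟩
      intro t ht
      rcases Finset.mem_insert.1 ht with rfl | ht
      · exact fun h5 => by linarith [h5.1]
      · exact h4 t ht
    · obtain ⟨u', v', h1, h2, h3, h4⟩ := ih u ((u + v) / 2) (by linarith)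
      refine ⟨u', v', h1, by linarith, by rw [h3, pow_succ]; field_simp; ring, ?_⟩
      intro t ht
      rcases Finset.mem_insert.1 ht with rfl | ht
      · exact fun h5 => by linarith [h5.2]
      · exact h4 t ht

/-- At most `N` bisections of `[ρ/2, ρ]` leave a free interval of length at least `ρ / 2^(N+1)`; the
radius is its midpoint. -/
theorem exists_radius_avoiding {N : ℕ} {ρ : ℝ} (hρ : 0 < ρ) (S : Finset ℝ) (hS : S.card ≤ N) :
    ∃ r, 0 < r ∧ r ≤ ρ ∧ ∀ s ∈ S, ρ / 2 ^ (N + 2) ≤ |s - r| := by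
  obtain ⟨u, v, h1, h2, h3, h4⟩ := exists_subinterval_avoiding S (ρ / 2) ρ (by linarith)
  have h5 : ρ / 2 ^ (N + 1) ≤ v - u := by
    rw [h3, show ρ - ρ / 2 = ρ / 2 by ring, div_div, ← pow_succ']
    gcongr
    norm_num
  have h6 : 0 < ρ / 2 ^ (N + 1) := by positivity
  have h7 : ρ / 2 ^ (N + 2) = ρ / 2 ^ (N + 1) / 2 := by rw [pow_succ _ (N + 1)]; field_simp
  refine ⟨(u + v) / 2, by linarith, by linarith, fun s hs => ?_⟩
  have := h4 s hs
  rw [mem_Ioo, not_and_or, not_lt, not_lt] at this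
  rw [h7]
  rcases this with h | h
  · rw [abs_of_nonpos (by linarith)]; linarith
  · rw [abs_of_nonneg (by linarith)]; linarith

/-- The Vandermonde product. -/
def vander {N : ℕ} (z : Fin N → ℂ) : ℂ := ∏ B : Fin N, ∏ A ∈ Finset.Ioi B, (z A - z B)

/-- The antisymmetric numerator of the symmetrization. -/
def symmNum {N : ℕ} (F : (Fin N → ℂ) → ℂ) (z : Fin N → ℂ) : ℂ :=
  ∑ σ : Equiv.Perm (Fin N), ((Equiv.Perm.sign σ : ℤ) : ℂ) *
    ((∏ B : Fin N, ∏ A ∈ Finset.Ioi B, (z (σ A) - z (σ B) - 1)) * F (fun k => z (σ k)))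

theorem vander_comp_perm {N : ℕ} (z : Fin N → ℂ) (σ : Equiv.Perm (Fin N)) :
    vander (fun k => z (σ k)) = ((Equiv.Perm.sign σ : ℤ) : ℂ) * vander z := by
  unfold vander
  rw [← Matrix.det_vandermonde, ← Matrix.det_vandermonde, ← Matrix.det_permute]
  rfl

theorem vander_ne_zero {N : ℕ} {z : Fin N → ℂ} (hz : Function.Injective z) : vander z ≠ 0 :=
  Finset.prod_ne_zero_iff.2 fun _ _ => Finset.prod_ne_zero_iff.2 fun _ hA =>
    sub_ne_zero.2 fun h => (Finset.mem_Ioi.1 hA).ne (hz h).symm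

/-- The denominator belonging to `σ` is the Vandermonde product of the permuted vector, that is,
`sign σ` times a common one. -/
theorem symm_eq_div {N : ℕ} (F : (Fin N → ℂ) → ℂ) {z : Fin N → ℂ} (hz : Function.Injective z) :
    symm F z = symmNum F z / vander z := by
  unfold symm symmNum
  rw [Finset.sum_div]
  refine Finset.sum_congr rfl fun σ _ => ?_
  have h1 : vander (fun k => z (σ k)) = ∏ B : Fin N, ∏ A ∈ Finset.Ioi B, (z (σ A) - z (σ B)) := rfl
  simp_rw [Finset.prod_div_distrib]
  rw [← h1, vander_comp_perm]
  have hv := vander_ne_zero hz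
  rcases Int.units_eq_one_or (Equiv.Perm.sign σ) with h | h <;> rw [h] <;> simp <;> field_simp

theorem symmNum_comp_perm {N : ℕ} (F : (Fin N → ℂ) → ℂ) (z : Fin N → ℂ)
    (τ : Equiv.Perm (Fin N)) :
    symmNum F (fun k => z (τ k)) = ((Equiv.Perm.sign τ : ℤ) : ℂ) * symmNum F z := by
  unfold symmNum
  rw [Finset.mul_sum]
  refine Fintype.sum_equiv (Equiv.mulLeft τ) _ _ fun σ => ?_
  simp only [Equiv.coe_mulLeft, Equiv.Perm.coe_mul, Function.comp_apply, Equiv.Perm.sign_mul]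
  rcases Int.units_eq_one_or (Equiv.Perm.sign τ) with h | h <;> rw [h] <;> simp

/-- Antisymmetry under the exchange of the two equal entries. This cancels the poles of `symm` on
the diagonals. -/
theorem symmNum_eq_zero {N : ℕ} (F : (Fin N → ℂ) → ℂ) {z : Fin N → ℂ} {k q : Fin N}
    (hkq : k ≠ q) (h : z k = z q) : symmNum F z = 0 := by
  have h1 := symmNum_comp_perm F z (Equiv.swap k q)
  have h2 : (fun i => z (Equiv.swap k q i)) = z := by
    funext i
    rw [Equiv.swap_apply_def]
    split_ifs with h3 h4
    · rw [h3, h]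
    · rw [h4, h]
    · rfl
  rw [h2, Equiv.Perm.sign_swap hkq] at h1
  simp at h1
  have h3 : (2 : ℂ) * symmNum F z = 0 := by linear_combination h1
  simpa using h3

theorem differentiable_update_apply {N : ℕ} (z : Fin N → ℂ) (k i : Fin N) :
    Differentiable ℂ fun u : ℂ => Function.update z k u i := by
  by_cases h : i = k
  · subst h; simp
  · simp only [Function.update_of_ne h]; exact differentiable_const _

theorem isOpen_tube (n : ℕ) (α β : ℝ) : IsOpen (tube n α β) := by
  have : tube n α β = ⋂ k, {z : Fin n → ℂ | α < (z k).re ∧ (z k).re < β} := by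
    ext z; simp [tube]
  rw [this]
  refine isOpen_iInter_of_finite fun k => ?_
  have hc : Continuous fun z : Fin n → ℂ => (z k).re :=
    Complex.continuous_re.comp (continuous_apply k)
  exact (isOpen_lt continuous_const hc).inter (isOpen_lt hc continuous_const)

theorem symmNum_update_differentiableAt {N : ℕ} {α β : ℝ} {F : (Fin N → ℂ) → ℂ}
    (hF : DifferentiableOn ℂ F (tube N α β)) {z : Fin N → ℂ} (k : Fin N) {u : ℂ}
    (h : Function.update z k u ∈ tube N α β) :
    DifferentiableAt ℂ (fun u => symmNum F (Function.update z k u)) u := by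
  unfold symmNum
  refine DifferentiableAt.fun_sum fun σ _ => DifferentiableAt.const_mul ?_ _
  refine DifferentiableAt.mul ?_ ?_
  · refine DifferentiableAt.fun_finsetProd fun B _ => DifferentiableAt.fun_finsetProd fun A _ => ?_
    exact (((differentiable_update_apply z k _).differentiableAt).sub
      ((differentiable_update_apply z k _).differentiableAt)).sub_const 1
  · have h1 : DifferentiableAt ℂ F (fun i => Function.update z k u (σ i)) :=
      hF.differentiableAt ((isOpen_tube N α β).mem_nhds fun i => h (σ i))
    exact h1.comp u (f := fun u i => Function.update z k u (σ i))
      (differentiableAt_pi.2 fun i => (differentiable_update_apply z k _).differentiableAt)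

theorem vander_update_differentiable {N : ℕ} (z : Fin N → ℂ) (k : Fin N) :
    Differentiable ℂ fun u => vander (Function.update z k u) := by
  unfold vander
  refine Differentiable.fun_finsetProd fun B _ => Differentiable.fun_finsetProd fun A _ => ?_
  exact (differentiable_update_apply z k _).sub (differentiable_update_apply z k _)

/-- As the `z i` are distinct, exactly one factor of the Vandermonde product vanishes at `u = z q`,
so the zero is simple. -/
theorem tendsto_sub_div_vander_update {N : ℕ} {z : Fin N → ℂ} (hz : Function.Injective z)
    {k q : Fin N} (hkq : q ≠ k) :
    ∃ L, Tendsto (fun u => (u - z q) / vander (Function.update z k u)) (𝓝[≠] (z q)) (𝓝 L) := by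
  have hv : ∀ w : Fin N → ℂ, vander w =
      ∏ p ∈ (Finset.univ : Finset (Fin N)).sigma (fun B => Finset.Ioi B), (w p.2 - w p.1) :=
    fun w => by rw [vander, Finset.prod_sigma']
  -- `p₀` is the pair `{k, q}` in increasing order, and `ε = ±1` records which of the two comes
  -- first.
  obtain ⟨p₀, hp₀, ε, hε, hεu, hp₀'⟩ : ∃ p₀ ∈ (Finset.univ : Finset (Fin N)).sigma
      (fun B => Finset.Ioi B), ∃ ε : ℂ, ε ≠ 0 ∧
      (∀ u, Function.update z k u p₀.2 - Function.update z k u p₀.1 = ε * (u - z q)) ∧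
      (∀ p : (_ : Fin N) × Fin N, p.1 < p.2 → (p.1 = k ∧ p.2 = q ∨ p.1 = q ∧ p.2 = k) →
        p = p₀) := by
    rcases lt_or_gt_of_ne hkq with h | h
    · refine ⟨⟨q, k⟩, by simpa using h, 1, one_ne_zero, fun u => ?_, ?_⟩
      · simp [Function.update_of_ne hkq]
      · rintro ⟨i, j⟩ h1 (⟨rfl, rfl⟩ | ⟨rfl, rfl⟩)
        · exact absurd h1 (not_lt.2 h.le)
        · rfl
    · refine ⟨⟨k, q⟩, by simpa using h, -1, by norm_num, fun u => ?_, ?_⟩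
      · simp [Function.update_of_ne hkq]
      · rintro ⟨i, j⟩ h1 (⟨rfl, rfl⟩ | ⟨rfl, rfl⟩)
        · rfl
        · exact absurd h1 (not_lt.2 h.le)
  set R : ℂ → ℂ := fun u => ∏ p ∈ ((Finset.univ : Finset (Fin N)).sigma
    (fun B => Finset.Ioi B)).erase p₀,
      (Function.update z k u p.2 - Function.update z k u p.1) with hR
  have hRc : Continuous R := by
    refine continuous_finsetProd _ fun p _ => ?_
    exact ((differentiable_update_apply z k _).sub (differentiable_update_apply z k _)).continuous
  have hR0 : R (z q) ≠ 0 := by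
    refine Finset.prod_ne_zero_iff.2 fun p hp => sub_ne_zero.2 fun h => ?_
    have hlt : p.1 < p.2 := by
      have := Finset.mem_of_mem_erase hp
      simpa using this
    refine Finset.ne_of_mem_erase hp (hp₀' p hlt ?_)
    by_cases h1 : p.1 = k
    · have h2 : p.2 ≠ k := fun h2 => hlt.ne (h1.trans h2.symm)
      rw [Function.update_of_ne h2, h1, Function.update_self] at h
      exact Or.inl ⟨h1, hz h⟩
    · by_cases h2 : p.2 = k
      · rw [Function.update_of_ne h1, h2, Function.update_self] at h
        exact Or.inr ⟨(hz h).symm, h2⟩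
      · rw [Function.update_of_ne h1, Function.update_of_ne h2] at h
        exact absurd (hz h) hlt.ne'
  refine ⟨(ε * R (z q))⁻¹, ?_⟩
  have h1 : Tendsto (fun u => (ε * R u)⁻¹) (𝓝[≠] (z q)) (𝓝 (ε * R (z q))⁻¹) :=
    ((hRc.const_mul ε).tendsto (z q)).inv₀ (mul_ne_zero hε hR0) |>.mono_left nhdsWithin_le_nhds
  refine h1.congr' ?_
  filter_upwards [self_mem_nhdsWithin] with u hu
  have hu' : u - z q ≠ 0 := sub_ne_zero.2 hu
  rw [hv, ← Finset.mul_prod_erase _ _ hp₀, hεu]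
  rw [mul_right_comm, div_mul_cancel_right₀ hu']

theorem injective_update {N : ℕ} {z : Fin N → ℂ} (hz : Function.Injective z) {k : Fin N} {u : ℂ}
    (hu : ∀ i, i ≠ k → u ≠ z i) : Function.Injective (Function.update z k u) := by
  intro i j hij
  by_cases hi : i = k
  · by_cases hj : j = k
    · rw [hi, hj]
    · rw [hi, Function.update_self, Function.update_of_ne hj] at hij
      exact absurd hij (hu j hj)
  · by_cases hj : j = k
    · rw [hj, Function.update_self, Function.update_of_ne hi] at hij
      exact absurd hij.symm (hu i hi)
    · rw [Function.update_of_ne hi, Function.update_of_ne hj] at hij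
      exact hz hij

/-- The numerator vanishes where the Vandermonde product has a simple zero, so the singularity is
removable. -/
theorem tendsto_sub_mul_symm_update {N : ℕ} {α β : ℝ} {F : (Fin N → ℂ) → ℂ}
    (hF : DifferentiableOn ℂ F (tube N α β)) {z : Fin N → ℂ} (hz : Function.Injective z)
    {k q : Fin N} (hkq : q ≠ k) (h : Function.update z k (z q) ∈ tube N α β) :
    Tendsto (fun u => (u - z q) * symm F (Function.update z k u)) (𝓝[≠] (z q)) (𝓝 0) := by
  obtain ⟨L, hL⟩ := tendsto_sub_div_vander_update hz hkq
  have h1 := (symmNum_update_differentiableAt hF k h).continuousAt.tendsto.mono_left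
    (nhdsWithin_le_nhds (s := {z q}ᶜ))
  rw [symmNum_eq_zero F hkq.symm (by simp [Function.update_of_ne hkq])] at h1
  have h2 := h1.mul hL
  rw [zero_mul] at h2
  refine h2.congr' ?_
  have hfin : ∀ᶠ u in 𝓝[≠] (z q), ∀ i : Fin N, i ≠ k → u ≠ z i := by
    rw [eventually_all]
    intro i
    by_cases hi : i = q
    · subst hi
      filter_upwards [self_mem_nhdsWithin] with u hu _
      exact hu
    · have : ∀ᶠ u in 𝓝 (z q), u ≠ z i := isOpen_ne.mem_nhds fun h => hi (hz h).symm
      filter_upwards [nhdsWithin_le_nhds this] with u hu _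
      exact hu
  filter_upwards [hfin] with u hu
  rw [symm_eq_div F (injective_update hz hu)]
  ring

theorem norm_symm_le_of_separated {N : ℕ} {F : (Fin N → ℂ) → ℂ} {d M p : ℝ} (hd : 0 < d)
    {z : Fin N → ℂ} (hz : ∀ k q, q ≠ k → d ≤ ‖z k - z q‖)
    (hF : ∀ σ : Equiv.Perm (Fin N), ‖F (fun k => z (σ k))‖ ≤ M * decay p z) :
    ‖symm F z‖ ≤ (Fintype.card (Equiv.Perm (Fin N)) *
      ∏ B : Fin N, ∏ _A ∈ Finset.Ioi B, (1 + 1 / d)) * M * decay p z := by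
  unfold symm
  have h1 : ∀ σ : Equiv.Perm (Fin N), ‖(∏ B : Fin N, ∏ A ∈ Finset.Ioi B,
      (z (σ A) - z (σ B) - 1) / (z (σ A) - z (σ B))) * F (fun k => z (σ k))‖ ≤
      (∏ B : Fin N, ∏ _A ∈ Finset.Ioi B, (1 + 1 / d)) * (M * decay p z) := by
    intro σ
    rw [norm_mul]
    refine mul_le_mul ?_ (hF σ) (norm_nonneg _) (Finset.prod_nonneg fun _ _ =>
      Finset.prod_nonneg fun _ _ => by positivity)
    rw [norm_prod]
    refine Finset.prod_le_prod (fun _ _ => norm_nonneg _) fun B _ => ?_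
    rw [norm_prod]
    refine Finset.prod_le_prod (fun _ _ => norm_nonneg _) fun A hA => ?_
    have h2 := hz (σ A) (σ B) fun h => (Finset.mem_Ioi.1 hA).ne (σ.injective h)
    have h3 : z (σ A) - z (σ B) ≠ 0 := norm_pos_iff.1 (hd.trans_le h2)
    rw [sub_div, div_self h3]
    refine (norm_sub_le _ _).trans ?_
    rw [norm_one, norm_div, norm_one]
    gcongr
  refine (norm_sum_le_of_le _ fun σ _ => h1 σ).trans ?_
  rw [Finset.sum_const, nsmul_eq_mul, Finset.card_univ]
  exact le_of_eq (by ring)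

/-- Induction on the set `t` of variables that may come close to others. The maximum principle on a
circle about `z k`, of radius at most `ρ`, replaces `z k` by points separated from all the others;
the price is a factor `(1 + ρ)^p` in the decay. Each variable is moved at most once, so a margin of
`2ρ` keeps everything inside the tube. -/
theorem norm_symm_le_of_separated_off {N : ℕ} {α β ρ p C : ℝ} (hρ : 0 < ρ) (hp : 0 ≤ p) (hC : 0 ≤ C)
    {F : (Fin N → ℂ) → ℂ} (hF : DifferentiableOn ℂ F (tube N α β))
    (hFC : ∀ z ∈ tube N α β, ‖F z‖ ≤ C * decay p z) (t : Finset (Fin N)) :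
    ∀ z : Fin N → ℂ, Function.Injective z → z ∈ tube N α β →
      (∀ k ∈ t, α + 2 * ρ < (z k).re ∧ (z k).re < β - 2 * ρ) →
      (∀ k ∉ t, ∀ q, q ≠ k → ρ / 2 ^ (N + 2) ≤ ‖z k - z q‖) →
      ‖symm F z‖ ≤ (Fintype.card (Equiv.Perm (Fin N)) *
        ∏ B : Fin N, ∏ _A ∈ Finset.Ioi B, (1 + 1 / (ρ / 2 ^ (N + 2)))) *
          (C * ((1 + ρ) ^ p) ^ t.card) * decay p z := by
  have hd : 0 < ρ / 2 ^ (N + 2) := by positivity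
  set K₀ : ℝ := Fintype.card (Equiv.Perm (Fin N)) *
        ∏ B : Fin N, ∏ _A ∈ Finset.Ioi B, (1 + 1 / (ρ / 2 ^ (N + 2))) with hK₀
  have hK₀' : 0 ≤ K₀ := by positivity
  induction t using Finset.induction_on with
  | empty =>
    intro z _ hzt _ hsep
    rw [Finset.card_empty, pow_zero, mul_one]
    refine norm_symm_le_of_separated hd (fun k q h => hsep k (by simp) q h) fun σ => ?_
    rw [← decay_comp_perm p z σ]
    exact hFC _ fun k => hzt (σ k)
  | insert k t hk ih =>
    intro z hz hzt hmargin hsep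
    have hkm := hmargin k (by simp)
    -- A radius far from every distance `‖z k - z q‖` gives a circle far from every point `z q`.
    obtain ⟨r, hr0, hrρ, hr⟩ := exists_radius_avoiding (N := N) hρ
      ((Finset.univ.erase k).image fun q => ‖z k - z q‖) (by
        refine Finset.card_image_le.trans ((Finset.card_le_univ _).trans ?_)
        simp)
    have hball : ∀ u ∈ Metric.ball (z k) (2 * ρ), Function.update z k u ∈ tube N α β := by
      intro u hu i
      by_cases hi : i = k
      · subst hi
        rw [Function.update_self]
        have h1 : |(u - z i).re| < 2 * ρ :=
          (Complex.abs_re_le_norm _).trans_lt (by simpa [dist_eq_norm] using hu)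
        rw [Complex.sub_re, abs_lt] at h1
        constructor <;> linarith [h1.1, h1.2, hkm.1, hkm.2]
      · rw [Function.update_of_ne hi]; exact hzt i
    set S : Finset ℂ := (Finset.univ.erase k).image z with hS
    have hmemS : ∀ s, s ∈ S ↔ ∃ q, q ≠ k ∧ z q = s := fun s => by simp [hS]
    have hinj : ∀ u ∉ S, Function.Injective (Function.update z k u) := fun u hu =>
      injective_update hz fun i hi h => hu ((hmemS u).2 ⟨i, hi, h.symm⟩)
    have key := norm_le_of_sphere_of_removable (c := z k) (r := r) (R := 2 * ρ)
      (M := K₀ * (C * ((1 + ρ) ^ p) ^ (insert k t).card) * decay p z) hr0 (by linarith) S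
      (fun u => symm F (Function.update z k u)) ?_ ?_ ?_ ?_ ?_
    · simpa using key
    · intro u hu
      have h1 : DifferentiableAt ℂ (fun u => symmNum F (Function.update z k u) /
          vander (Function.update z k u)) u :=
        (symmNum_update_differentiableAt hF k (hball u hu.1)).div
          (vander_update_differentiable z k u) (vander_ne_zero (hinj u hu.2))
      refine h1.differentiableWithinAt.congr (fun v hv => ?_) ?_
      · exact symm_eq_div F (hinj v hv.2)
      · exact symm_eq_div F (hinj u hu.2)
    · intro s hs hsb
      obtain ⟨q, hq, rfl⟩ := (hmemS s).1 hs
      exact tendsto_sub_mul_symm_update hF hz hq (hball _ hsb)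
    · intro s hs hsr
      obtain ⟨q, hq, rfl⟩ := (hmemS s).1 hs
      have h1 := hr ‖z k - z q‖ (Finset.mem_image_of_mem _ (by simp [hq]))
      rw [mem_sphere_iff_norm, norm_sub_rev] at hsr
      rw [hsr, sub_self, abs_zero] at h1
      linarith
    · intro h
      obtain ⟨q, hq, h⟩ := (hmemS _).1 h
      exact hq (hz h)
    · intro u hu
      rw [mem_sphere_iff_norm] at hu
      have hsepu : ∀ q, q ≠ k → ρ / 2 ^ (N + 2) ≤ ‖u - z q‖ := by
        intro q hq
        refine (hr ‖z k - z q‖ (Finset.mem_image_of_mem _ (by simp [hq]))).trans ?_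
        rw [← hu]
        have := abs_norm_sub_norm_le (z k - z q) (z k - u)
        rw [norm_sub_rev (z k) u] at this
        refine this.trans (le_of_eq ?_)
        congr 1; ring
      have huS : u ∉ S := fun h => by
        obtain ⟨q, hq, h⟩ := (hmemS u).1 h
        have := hsepu q hq
        rw [h, sub_self, norm_zero] at this
        linarith
      have h1 := ih (Function.update z k u) (hinj u huS)
        (hball u (by rw [Metric.mem_ball, dist_eq_norm]; linarith))
        (fun i hi => by
          have hik : i ≠ k := fun h => hk (h ▸ hi)
          rw [Function.update_of_ne hik]
          exact hmargin i (by simp [hi]))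
        (fun i hi q hq => by
          by_cases hik : i = k
          · subst hik
            rw [Function.update_self, Function.update_of_ne hq]
            exact hsepu q hq
          · rw [Function.update_of_ne hik]
            by_cases hqk : q = k
            · subst hqk
              rw [Function.update_self, norm_sub_rev]
              exact hsepu i hik
            · rw [Function.update_of_ne hqk]
              exact hsep i (by simp [hik, hi]) q hq)
      refine h1.trans ?_
      have h2 := decay_update_le hp z k (u := u) (r := ρ) (by rw [hu]; exact hrρ)
      rw [Finset.card_insert_of_notMem hk, pow_succ]
      calc _ ≤ K₀ * (C * ((1 + ρ) ^ p) ^ t.card) * ((1 + ρ) ^ p * decay p z) := by gcongr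
        _ = _ := by ring

/-- The symmetrization of a holomorphic function satisfies the same decay bound as the function,
uniformly on smaller tubes. -/
theorem exists_norm_symm_le (N : ℕ) {ρ p : ℝ} (hρ : 0 < ρ) (hp : 0 ≤ p) :
    ∃ K : ℝ, 0 ≤ K ∧ ∀ (α β C : ℝ) (F : (Fin N → ℂ) → ℂ), DifferentiableOn ℂ F (tube N α β) →
      (∀ z ∈ tube N α β, ‖F z‖ ≤ C * decay p z) →
      ∀ z : Fin N → ℂ, Function.Injective z → z ∈ tube N (α + 2 * ρ) (β - 2 * ρ) →
        ‖symm F z‖ ≤ K * C * decay p z := by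
  refine ⟨(Fintype.card (Equiv.Perm (Fin N)) *
        ∏ B : Fin N, ∏ _A ∈ Finset.Ioi B, (1 + 1 / (ρ / 2 ^ (N + 2)))) *
          (((1 + ρ) ^ p) ^ (Finset.univ : Finset (Fin N)).card), by positivity, ?_⟩
  intro α β C F hF hFC z hz hzt
  have hzt' : z ∈ tube N α β := fun k => ⟨by linarith [(hzt k).1], by linarith [(hzt k).2]⟩
  have hC : 0 ≤ C := by
    have h := (norm_nonneg _).trans (hFC z hzt')
    exact nonneg_of_mul_nonneg_left h (decay_pos p z)
  refine (norm_symm_le_of_separated_off hρ hp hC hF hFC Finset.univ z hz hzt' (fun k _ => hzt k)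
    (fun k hk => absurd (Finset.mem_univ k) hk)).trans (le_of_eq ?_)
  ring

/-! ### The symmetrization as a function of a finite set -/

/-- The symmetrization, as a function of the set of the values of its variables: the first
variable is summed over the set, the others over the remaining points. -/
def symmSet : (N : ℕ) → ((Fin N → ℂ) → ℂ) → Finset ℂ → ℂ
  | 0, F, _ => F fun i => i.elim0
  | N + 1, F, S => ∑ p ∈ S, (∏ q ∈ S.erase p, (q - p - 1) / (q - p)) *
      symmSet N (fun v => F (Fin.cons p v)) (S.erase p)

/-- A permutation is the image `p` of `0` together with a permutation of the remaining indices,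
which `Equiv.swap 0 p q.succ` enumerates. -/
theorem symm_succ {N : ℕ} (F : (Fin (N + 1) → ℂ) → ℂ) (z : Fin (N + 1) → ℂ) :
    symm F z = ∑ p : Fin (N + 1),
      (∏ q : Fin N, (z (Equiv.swap 0 p q.succ) - z p - 1) / (z (Equiv.swap 0 p q.succ) - z p)) *
        symm (fun v => F (Fin.cons (z p) v)) (fun q => z (Equiv.swap 0 p q.succ)) := by
  unfold symm
  rw [← Equiv.sum_comp Equiv.Perm.decomposeFin.symm, Fintype.sum_prod_type]
  refine Finset.sum_congr rfl fun p _ => ?_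
  rw [Finset.mul_sum]
  refine Finset.sum_congr rfl fun e _ => ?_
  rw [Fin.prod_univ_succ, Fin.prod_Ioi_zero]
  simp only [Fin.prod_Ioi_succ, Equiv.Perm.decomposeFin_symm_apply_zero,
    Equiv.Perm.decomposeFin_symm_apply_succ]
  rw [Equiv.prod_comp e fun q => (z (Equiv.swap 0 p q.succ) - z p - 1) /
    (z (Equiv.swap 0 p q.succ) - z p), mul_assoc]
  congr 2
  congr 1
  funext k
  refine Fin.cases ?_ (fun k => ?_) k
  · simp
  · simp

theorem image_swap_succ {N : ℕ} {z : Fin (N + 1) → ℂ} (hz : Function.Injective z)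
    (p : Fin (N + 1)) :
    Finset.univ.image (fun q : Fin N => z (Equiv.swap 0 p q.succ)) =
      (Finset.univ.image z).erase (z p) := by
  ext u
  simp only [Finset.mem_image, Finset.mem_univ, true_and, Finset.mem_erase]
  constructor
  · rintro ⟨q, rfl⟩
    refine ⟨fun h => ?_, _, rfl⟩
    have h1 := congrArg (Equiv.swap 0 p) (hz h)
    rw [Equiv.swap_apply_self, Equiv.swap_apply_right] at h1
    exact Fin.succ_ne_zero q h1
  · rintro ⟨hu, i, rfl⟩
    have : Equiv.swap 0 p i ≠ 0 := by
      intro h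
      have h1 := congrArg (Equiv.swap 0 p) h
      rw [Equiv.swap_apply_self, Equiv.swap_apply_left] at h1
      exact hu (by rw [h1])
    obtain ⟨q, hq⟩ := Fin.exists_succ_eq_of_ne_zero this
    exact ⟨q, by rw [hq, Equiv.swap_apply_self]⟩

/-- With the symmetrization depending only on the set of points, shortening a string is the deletion
of one point and the order of the strings is immaterial. -/
theorem symm_eq_symmSet {N : ℕ} : ∀ (F : (Fin N → ℂ) → ℂ) {z : Fin N → ℂ},
    Function.Injective z → symm F z = symmSet N F (Finset.univ.image z) := by
  induction N with
  | zero =>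
    intro F z _
    simp only [symm, symmSet, Finset.univ_unique, Finset.sum_singleton, Finset.univ_eq_empty,
      Finset.prod_empty, one_mul]
    congr 1
    exact Subsingleton.elim _ _
  | succ N ih =>
    intro F z hz
    rw [symm_succ, symmSet, Finset.sum_image fun i _ j _ h => hz h]
    refine Finset.sum_congr rfl fun p _ => ?_
    have hinj : Function.Injective fun q : Fin N => z (Equiv.swap 0 p q.succ) := fun i j h =>
      Fin.succ_injective _ ((Equiv.swap 0 p).injective (hz h))
    rw [ih _ hinj, ← image_swap_succ hz p, Finset.prod_image fun i _ j _ h => hinj h]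

theorem symmSet_const_mul (c : ℂ) (N : ℕ) : ∀ (F : (Fin N → ℂ) → ℂ) (S : Finset ℂ),
    symmSet N (fun v => c * F v) S = c * symmSet N F S := by
  induction N with
  | zero => intro F S; rfl
  | succ N ih =>
    intro F S
    simp only [symmSet]
    rw [Finset.mul_sum]
    refine Finset.sum_congr rfl fun p _ => ?_
    rw [ih]
    ring

/-- A symmetric factor has the same value in all terms. It is applied to the interaction of the
first variable with the others. -/
theorem symmSet_prod_mul (g : ℂ → ℂ) (N : ℕ) : ∀ (F : (Fin N → ℂ) → ℂ) {S : Finset ℂ},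
    S.card = N → symmSet N (fun v => (∏ j, g (v j)) * F v) S = (∏ x ∈ S, g x) * symmSet N F S := by
  induction N with
  | zero =>
    intro F S hS
    rw [Finset.card_eq_zero] at hS
    simp [symmSet, hS]
  | succ N ih =>
    intro F S hS
    simp only [symmSet]
    rw [Finset.mul_sum]
    refine Finset.sum_congr rfl fun p hp => ?_
    have h1 : (fun v : Fin N → ℂ => (∏ j, g ((Fin.cons p v : Fin (N + 1) → ℂ) j)) *
        F (Fin.cons p v)) = fun v => (∏ j, g (v j)) * (g p * F (Fin.cons p v)) := by
      funext v
      rw [Fin.prod_univ_succ]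
      simp only [Fin.cons_zero, Fin.cons_succ]
      ring
    rw [h1, ih (fun v => g p * F (Fin.cons p v)) (by rw [Finset.card_erase_of_mem hp, hS]; rfl),
      symmSet_const_mul, ← Finset.mul_prod_erase S g hp]
    ring
/-! ### Strings -/

/-- No two of the numbers differ by an integer. -/
def IntSeparated {n : ℕ} (w : Fin n → ℂ) : Prop :=
  ∀ i j, i ≠ j → ∀ m : ℤ, w i ≠ w j + m

/-- The set of all `wᵢ + s` with `0 ≤ s < cᵢ`. -/
def stringSet {n : ℕ} (c : Fin n → ℕ) (w : Fin n → ℂ) : Finset ℂ :=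
  Finset.univ.biUnion fun i => (Finset.range (c i)).image fun s : ℕ => w i + s

theorem mem_stringSet {n : ℕ} {c : Fin n → ℕ} {w : Fin n → ℂ} {u : ℂ} :
    u ∈ stringSet c w ↔ ∃ i, ∃ s < c i, w i + (s : ℂ) = u := by
  simp [stringSet]

theorem IntSeparated.eq_of_add_eq {n : ℕ} {w : Fin n → ℂ} (hw : IntSeparated w) {i j : Fin n}
    {s t : ℕ} (h : w i + (s : ℂ) = w j + t) : i = j ∧ s = t := by
  by_cases hij : i = j
  · subst hij
    refine ⟨rfl, ?_⟩
    exact_mod_cast add_left_cancel h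
  · refine absurd ?_ (hw i j hij ((t : ℤ) - s))
    push_cast
    linear_combination h

theorem IntSeparated.sub_ne {n : ℕ} {w : Fin n → ℂ} (hw : IntSeparated w) {i j : Fin n}
    (hij : i ≠ j) (m : ℤ) : w i - w j - m ≠ 0 := fun h =>
  hw i j hij m (by linear_combination h)

/-- Integer separation makes the strings disjoint, so each point is counted once. -/
theorem prod_stringSet {n : ℕ} {M : Type*} [CommMonoid M] {w : Fin n → ℂ} (hw : IntSeparated w)
    (c : Fin n → ℕ) (g : ℂ → M) :
    ∏ x ∈ stringSet c w, g x = ∏ i, ∏ s ∈ Finset.range (c i), g (w i + s) := by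
  rw [stringSet, Finset.prod_biUnion]
  · refine Finset.prod_congr rfl fun i _ => Finset.prod_image fun s _ t _ h => ?_
    exact (hw.eq_of_add_eq h).2
  · intro i _ j _ hij
    rw [Function.onFun, Finset.disjoint_left]
    intro u hu hv
    simp only [Finset.mem_image, Finset.mem_range] at hu hv
    obtain ⟨s, _, rfl⟩ := hu
    obtain ⟨t, _, h⟩ := hv
    exact hij (hw.eq_of_add_eq h).1.symm

theorem sum_stringSet {n : ℕ} {w : Fin n → ℂ} (hw : IntSeparated w)
    (c : Fin n → ℕ) (g : ℂ → ℂ) :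
    ∑ x ∈ stringSet c w, g x = ∑ i, ∑ s ∈ Finset.range (c i), g (w i + s) := by
  have := prod_stringSet (M := Multiplicative ℂ) hw c fun x => Multiplicative.ofAdd (g x)
  exact this

theorem card_stringSet {n : ℕ} {w : Fin n → ℂ} (hw : IntSeparated w) (c : Fin n → ℕ) :
    (stringSet c w).card = ∑ i, c i := by
  have := prod_stringSet (M := Multiplicative ℕ) hw c fun _ => Multiplicative.ofAdd 1
  have h2 : ∑ _x ∈ stringSet c w, 1 = ∑ i, ∑ _s ∈ Finset.range (c i), 1 := this
  simpa using h2

theorem prod_range_div_succ (f : ℕ → ℂ) : ∀ c : ℕ, (∀ s ≤ c, f s ≠ 0) →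
    ∏ s ∈ Finset.range c, f s / f (s + 1) = f 0 / f c := by
  intro c
  induction c with
  | zero => intro h; simp [div_self (h 0 le_rfl)]
  | succ c ih =>
    intro h
    rw [Finset.prod_range_succ, ih fun s hs => h s (by omega)]
    exact div_mul_div_cancel₀ (h c (by omega))

/-- The product telescopes along each string: the numerator of the bottom point and the denominator
of the top point survive. -/
theorem prod_stringSet_div {n : ℕ} {w : Fin n → ℂ} (hw : IntSeparated w) (c : Fin n → ℕ) {z : ℂ}
    (hz : ∀ i, ∀ s : ℕ, s ≤ c i → z - w i - s ≠ 0) :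
    ∏ x ∈ stringSet c w, (z - x) / (z - x - 1) = ∏ i, (z - w i) / (z - w i - c i) := by
  rw [prod_stringSet hw]
  refine Finset.prod_congr rfl fun i _ => ?_
  have := prod_range_div_succ (fun s => z - w i - s) (c i) (hz i)
  rw [Nat.cast_zero, sub_zero] at this
  rw [← this]
  refine Finset.prod_congr rfl fun s _ => ?_
  push_cast
  congr 1 <;> ring

theorem stringSet_comp_perm {n : ℕ} (c : Fin n → ℕ) (w : Fin n → ℂ) (τ : Equiv.Perm (Fin n)) :
    stringSet (fun i => c (τ i)) (fun i => w (τ i)) = stringSet c w := by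
  ext u
  simp only [mem_stringSet]
  exact τ.exists_congr_left.trans (by simp)

/-- Empty strings are allowed so that a newly split-off variable can be treated as a string of
length zero about to be lengthened. -/
theorem stringSet_cons_zero {n : ℕ} (c : Fin n → ℕ) (w : Fin (n + 1) → ℂ) :
    stringSet (Fin.cons 0 c) w = stringSet c (Fin.tail w) := by
  ext u
  simp only [mem_stringSet, Fin.exists_fin_succ, Fin.cons_zero, Fin.cons_succ, Fin.tail]
  simp

theorem stringSet_cons_succ_erase {n : ℕ} (m : ℕ) (c : Fin n → ℕ) {w : Fin (n + 1) → ℂ}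
    (hw : IntSeparated w) :
    (stringSet (Fin.cons (m + 1) c) w).erase (w 0 + m) = stringSet (Fin.cons m c) w := by
  ext u
  simp only [Finset.mem_erase, mem_stringSet, Fin.exists_fin_succ, Fin.cons_zero, Fin.cons_succ]
  constructor
  · rintro ⟨hu, ⟨s, hs, rfl⟩ | h⟩
    · refine Or.inl ⟨s, lt_of_le_of_ne (Nat.lt_succ_iff.1 hs) ?_, rfl⟩
      rintro rfl
      exact hu rfl
    · exact Or.inr h
  · rintro (⟨s, hs, rfl⟩ | ⟨i, s, hs, rfl⟩)
    · refine ⟨fun h => ?_, Or.inl ⟨s, by omega, rfl⟩⟩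
      exact hs.ne (hw.eq_of_add_eq h).2
    · refine ⟨fun h => ?_, Or.inr ⟨i, s, hs, rfl⟩⟩
      exact Fin.succ_ne_zero i (hw.eq_of_add_eq h).1

/-- The vector that enumerates `stringSet c w`. -/
def stringVec {n N : ℕ} (c : Fin n → ℕ) (h : ∑ i, c i = N) (w : Fin n → ℂ) : Fin N → ℂ := fun k =>
  let p := finSigmaFinEquiv.symm (Fin.cast h.symm k)
  w p.1 + ((p.2 : ℕ) : ℂ)

theorem stringVec_injective {n N : ℕ} (c : Fin n → ℕ) (h : ∑ i, c i = N) {w : Fin n → ℂ}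
    (hw : IntSeparated w) : Function.Injective (stringVec c h w) := by
  intro k l hkl
  obtain ⟨h1, h2⟩ := hw.eq_of_add_eq hkl
  have h3 : finSigmaFinEquiv.symm (Fin.cast h.symm k) =
      finSigmaFinEquiv.symm (Fin.cast h.symm l) := by
    refine Sigma.ext h1 ?_
    exact (Fin.heq_ext_iff (by rw [h1])).2 h2
  exact Fin.cast_injective _ (finSigmaFinEquiv.symm.injective h3)

theorem image_stringVec {n N : ℕ} (c : Fin n → ℕ) (h : ∑ i, c i = N) (w : Fin n → ℂ) :
    Finset.univ.image (stringVec c h w) = stringSet c w := by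
  ext u
  simp only [Finset.mem_image, Finset.mem_univ, true_and, mem_stringSet, stringVec]
  constructor
  · rintro ⟨k, rfl⟩
    exact ⟨_, _, (finSigmaFinEquiv.symm (Fin.cast h.symm k)).2.isLt, rfl⟩
  · rintro ⟨i, s, hs, rfl⟩
    refine ⟨Fin.cast h (finSigmaFinEquiv ⟨i, ⟨s, hs⟩⟩), ?_⟩
    have h1 : finSigmaFinEquiv.symm (Fin.cast h.symm (Fin.cast h
        (finSigmaFinEquiv (n := c) ⟨i, ⟨s, hs⟩⟩))) = ⟨i, ⟨s, hs⟩⟩ := by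
      rw [Fin.cast_cast, Fin.cast_eq_self, Equiv.symm_apply_apply]
    rw [h1]

theorem symmSet_stringSet_eq {n N : ℕ} (F : (Fin N → ℂ) → ℂ) (c : Fin n → ℕ) (h : ∑ i, c i = N)
    {w : Fin n → ℂ} (hw : IntSeparated w) :
    symmSet N F (stringSet c w) = symm F (stringVec c h w) := by
  rw [symm_eq_symmSet F (stringVec_injective c h hw), image_stringVec]

/-- Both kinds of factors telescope: the string that lost its top yields its length `c j`, every
other string a single quotient. -/
theorem prod_erase_stringSet {n : ℕ} {w : Fin n → ℂ} (hw : IntSeparated w) (c : Fin n → ℕ)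
    (j : Fin n) {m : ℕ} (hm : c j = m + 1) :
    ∏ q ∈ (stringSet c w).erase (w j + m), (q - (w j + m) - 1) / (q - (w j + m)) =
      (c j : ℂ) * ∏ i ∈ Finset.univ.erase j, (w j + c j - w i) / (w j + c j - (w i + c i)) := by
  have hmem : w j + (m : ℂ) ∈ stringSet c w := mem_stringSet.2 ⟨j, m, by omega, rfl⟩
  -- The value `1` at the deleted top lets the product run over complete strings.
  set g : ℂ → ℂ := fun q => if q = w j + m then 1 else (q - (w j + m) - 1) / (q - (w j + m))
    with hg
  have h1 : ∏ q ∈ (stringSet c w).erase (w j + m), (q - (w j + m) - 1) / (q - (w j + m)) =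
      ∏ q ∈ stringSet c w, g q := by
    rw [← Finset.mul_prod_erase _ g hmem]
    simp only [hg, if_true, one_mul]
    refine Finset.prod_congr rfl fun q hq => ?_
    rw [if_neg (Finset.ne_of_mem_erase hq)]
  rw [h1, prod_stringSet hw, ← Finset.mul_prod_erase _ _ (Finset.mem_univ j)]
  congr 1
  · rw [hm, Finset.prod_range_succ]
    have h2 : g (w j + (m : ℂ)) = 1 := by simp [hg]
    rw [h2, mul_one]
    have h3 := prod_range_div_succ (fun s => (s : ℂ) - m - 1) m (by
      intro s hs h0
      have h4 : (s : ℂ) = ((m + 1 : ℕ) : ℂ) := by push_cast; linear_combination h0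
      have := Nat.cast_injective h4
      omega)
    have h5 : ((0 : ℕ) : ℂ) - m - 1 = -((m + 1 : ℕ) : ℂ) := by push_cast; ring
    have h6 : (m : ℂ) - m - 1 = -1 := by ring
    simp only [h5, h6] at h3
    rw [neg_div_neg_eq, div_one] at h3
    rw [← h3]
    refine Finset.prod_congr rfl fun s hs => ?_
    have hsm : w j + (s : ℂ) ≠ w j + m := fun h => by
      have := Nat.cast_injective (add_left_cancel h)
      exact (Finset.mem_range.1 hs).ne this
    simp only [hg, if_neg hsm]
    push_cast
    congr 1 <;> ring
  · refine Finset.prod_congr rfl fun i hi => ?_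
    have hij := Finset.ne_of_mem_erase hi
    have h3 := prod_range_div_succ (fun s => w i + (s : ℂ) - (w j + m) - 1) (c i) (by
      intro s hs h0
      refine hw.sub_ne hij ((m : ℤ) + 1 - s) ?_
      push_cast
      linear_combination h0)
    have h4 : (w j + (c j : ℂ) - w i) / (w j + c j - (w i + c i)) =
        (w i + ((0 : ℕ) : ℂ) - (w j + m) - 1) / (w i + (c i : ℂ) - (w j + m) - 1) := by
      rw [← neg_div_neg_eq, hm]
      push_cast
      congr 1 <;> ring
    rw [h4, ← h3]
    refine Finset.prod_congr rfl fun s _ => ?_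
    have hsm : w i + (s : ℂ) ≠ w j + m := fun h => hij (hw.eq_of_add_eq h).1
    simp only [hg, if_neg hsm]
    push_cast
    congr 1; ring

/-- Only the top points of the strings can be the first variable. -/
theorem symmSet_stringSet_succ {n N : ℕ} (F : (Fin (N + 1) → ℂ) → ℂ) {w : Fin n → ℂ}
    (hw : IntSeparated w) (c : Fin n → ℕ) (hc : ∀ i, 0 < c i) :
    symmSet (N + 1) F (stringSet c w) = ∑ j, (c j : ℂ) *
      (∏ i ∈ Finset.univ.erase j, (w j + c j - w i) / (w j + c j - (w i + c i))) *
      symmSet N (fun v => F (Fin.cons (w j + c j - 1) v))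
        ((stringSet c w).erase (w j + c j - 1)) := by
  rw [symmSet, sum_stringSet hw]
  refine Finset.sum_congr rfl fun j _ => ?_
  obtain ⟨m, hm⟩ : ∃ m, c j = m + 1 := ⟨c j - 1, by have := hc j; omega⟩
  have htop : w j + (c j : ℂ) - 1 = w j + m := by rw [hm]; push_cast; ring
  rw [htop, ← prod_erase_stringSet hw c j hm, hm, Finset.sum_range_succ, Finset.sum_eq_zero,
    zero_add]
  intro s hs
  have hs' := Finset.mem_range.1 hs
  -- Below the top, the successor `q = p + 1` still belongs to the set, and its factor `q - p - 1`
  -- vanishes.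
  rw [Finset.prod_eq_zero (i := w j + (s : ℂ) + 1), zero_mul]
  · rw [Finset.mem_erase]
    refine ⟨by simp, mem_stringSet.2 ⟨j, s + 1, by omega, by push_cast; ring⟩⟩
  · simp

/-! ### Cauchy determinants -/

/-- Subtracting `(x 0 - y 0) / (x i - y 0)` times the first row from the others clears the first
column; the remaining minor is a Cauchy matrix with rescaled rows and columns. -/
theorem det_cauchy_succ {n : ℕ} (x y : Fin (n + 1) → ℂ) (h : ∀ i j, x i - y j ≠ 0) :
    (Matrix.of fun i j => 1 / (x i - y j)).det =
      1 / (x 0 - y 0) * ((∏ i : Fin n, (x 0 - x i.succ) / (x i.succ - y 0)) *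
        ((∏ j : Fin n, (y j.succ - y 0) / (x 0 - y j.succ)) *
          (Matrix.of fun i j : Fin n => 1 / (x i.succ - y j.succ)).det)) := by
  set c : Fin (n + 1) → ℂ := Fin.cons 0 fun i => (x 0 - y 0) / (x i.succ - y 0) with hc
  set B : Matrix (Fin (n + 1)) (Fin (n + 1)) ℂ :=
    Matrix.of fun i j => 1 / (x i - y j) - c i * (1 / (x 0 - y j)) with hB
  have hc0 : c 0 = 0 := rfl
  rw [Matrix.det_eq_of_forall_row_eq_smul_add_const (B := B) c 0 hc0 (by
    intro i j
    simp only [hB, Matrix.of_apply, hc0]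
    ring), Matrix.det_succ_column_zero, Fin.sum_univ_succ, Finset.sum_eq_zero, add_zero]
  · have hsub : B.submatrix (Fin.succAbove 0) Fin.succ = Matrix.of fun i j : Fin n =>
        (x 0 - x i.succ) / (x i.succ - y 0) * (Matrix.of fun i j : Fin n =>
          (y j.succ - y 0) / (x 0 - y j.succ) *
            (Matrix.of fun i j : Fin n => 1 / (x i.succ - y j.succ)) i j) i j := by
      ext i j
      simp only [hB, hc, Matrix.submatrix_apply, Matrix.of_apply, Fin.zero_succAbove,
        Fin.cons_succ]
      have h1 := h i.succ 0
      have h2 := h 0 j.succ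
      have h3 := h i.succ j.succ
      field_simp
      ring
    rw [hsub, Matrix.det_mul_column, Matrix.det_mul_row]
    simp [hB, hc0]
  · intro i _
    have h1 := h i.succ 0
    have h2 := h 0 0
    have h3 : B i.succ 0 = 0 := by
      simp only [hB, hc, Matrix.of_apply, Fin.cons_succ]
      field_simp
      simp
    rw [h3]
    ring

/-- The determinant `det[1/(wᵢ + cᵢ - wⱼ)]`. -/
def cauchyD {n : ℕ} (c : Fin n → ℕ) (w : Fin n → ℂ) : ℂ :=
  (Matrix.of fun i j : Fin n => 1 / (w i + (c i : ℂ) - w j)).det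

/-- The coefficient of the residue at the top of the `j`-th string. -/
def topCoeff {n : ℕ} (c : Fin n → ℕ) (w : Fin n → ℂ) (j : Fin n) : ℂ :=
  cauchyD c w * ((c j : ℂ) *
    ∏ i ∈ Finset.univ.erase j, (w j + c j - w i) / (w j + c j - (w i + c i)))

/-- The determinant times the interaction of one more variable with all strings. -/
def stringKernel {n : ℕ} (c : Fin n → ℕ) (z : ℂ) (w : Fin n → ℂ) : ℂ :=
  cauchyD c w * ∏ i, (z - w i) / (z - w i - c i)

theorem cauchyD_comp_perm {n : ℕ} (c : Fin n → ℕ) (w : Fin n → ℂ) (τ : Equiv.Perm (Fin n)) :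
    cauchyD (fun i => c (τ i)) (fun i => w (τ i)) = cauchyD c w := by
  unfold cauchyD
  rw [← Matrix.det_submatrix_equiv_self τ (Matrix.of fun i j : Fin n => 1 / (w i + (c i : ℂ) - w j))]
  rfl

theorem topCoeff_comp_perm {n : ℕ} (c : Fin n → ℕ) (w : Fin n → ℂ) (τ : Equiv.Perm (Fin n))
    (j : Fin n) :
    topCoeff (fun i => c (τ i)) (fun i => w (τ i)) j = topCoeff c w (τ j) := by
  unfold topCoeff
  rw [cauchyD_comp_perm]
  congr 2
  refine Finset.prod_bij (fun i _ => τ i) ?_ ?_ ?_ ?_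
  · intro i hi
    simp only [Finset.mem_erase, Finset.mem_univ, and_true] at hi ⊢
    exact fun h => hi (τ.injective h)
  · exact fun i _ k _ h => τ.injective h
  · intro i hi
    refine ⟨τ.symm i, ?_, by simp⟩
    simp only [Finset.mem_erase, Finset.mem_univ, and_true] at hi ⊢
    exact fun h => hi (by rw [← h, Equiv.apply_symm_apply])
  · exact fun i _ => rfl

/-- In the Cauchy expansion with `x i = w i + d i` and `y i = w i`, the factor `1 / (x 0 - y 0) = 1
/ m` cancels the length, and the factors containing `w 0 + m` cancel the product in `topCoeff`. The
independence of `m` is what matches residues at strings of length `m` with tops of strings of length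
`m + 1`. -/
theorem topCoeff_cons {n : ℕ} {m : ℕ} (hm : 0 < m) {c : Fin n → ℕ} (hc : ∀ i, 0 < c i)
    {w : Fin (n + 1) → ℂ} (hw : IntSeparated w) :
    topCoeff (Fin.cons m c) w 0 = stringKernel c (w 0) (Fin.tail w) := by
  set d : Fin (n + 1) → ℕ := Fin.cons m c with hd
  have hd0 : d 0 = m := rfl
  have hds : ∀ i : Fin n, d i.succ = c i := fun i => rfl
  have hdpos : ∀ i, 0 < d i := Fin.cases hm hc
  have hne : ∀ i j, w i + (d i : ℂ) - w j ≠ 0 := by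
    intro i j h
    by_cases hij : i = j
    · subst hij
      have h1 : (d i : ℂ) = 0 := by linear_combination h
      exact (hdpos i).ne' (Nat.cast_eq_zero.1 h1)
    · refine hw.sub_ne hij (-(d i : ℤ)) ?_
      push_cast
      linear_combination h
  have herase : (Finset.univ : Finset (Fin (n + 1))).erase 0 = Finset.Ioi 0 := by
    ext i; simp
  have hdet := det_cauchy_succ (fun i => w i + (d i : ℂ)) w hne
  have h1 : cauchyD c (Fin.tail w) =
      (Matrix.of fun i j : Fin n => 1 / (w i.succ + (d i.succ : ℂ) - w j.succ)).det := rfl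
  have h2 : cauchyD d w = (Matrix.of fun i j => 1 / (w i + (d i : ℂ) - w j)).det := rfl
  rw [topCoeff, stringKernel, h2, hdet, ← h1, herase, Fin.prod_Ioi_zero]
  have hm0 : (m : ℂ) ≠ 0 := by exact_mod_cast hm.ne'
  have h3 : w 0 + (d 0 : ℂ) - w 0 = m := by rw [hd0]; ring
  rw [h3, hd0]
  have h4 : ∏ i : Fin n, (w 0 - Fin.tail w i) / (w 0 - Fin.tail w i - c i) =
      (∏ i : Fin n, (w 0 + (d 0 : ℂ) - (w i.succ + (d i.succ : ℂ))) /
        (w i.succ + (d i.succ : ℂ) - w 0)) *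
      ((∏ j : Fin n, (w j.succ - w 0) / (w 0 + (d 0 : ℂ) - w j.succ)) *
      ∏ i : Fin n, (w 0 + (d 0 : ℂ) - w i.succ) /
        (w 0 + (d 0 : ℂ) - (w i.succ + (d i.succ : ℂ)))) := by
    rw [← Finset.prod_mul_distrib, ← Finset.prod_mul_distrib]
    refine Finset.prod_congr rfl fun i _ => ?_
    have e1 := hne 0 i.succ
    have e2 := hne i.succ 0
    have e3 : w 0 + (d 0 : ℂ) - (w i.succ + (d i.succ : ℂ)) ≠ 0 := by
      have := hw.sub_ne (Fin.succ_ne_zero i).symm ((d i.succ : ℤ) - d 0)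
      push_cast at this
      intro h0
      exact this (by linear_combination h0)
    rw [← neg_div_neg_eq (w 0 - Fin.tail w i)]
    have e4 : -(w 0 - Fin.tail w i - c i) = w i.succ + (d i.succ : ℂ) - w 0 := by
      rw [hds, Fin.tail]; ring
    have e5 : -(w 0 - Fin.tail w i) = w i.succ - w 0 := by rw [Fin.tail]; ring
    rw [e4, e5]
    field_simp
  rw [h4, hd0]
  field_simp

/-! ### Points on a vertical line -/

theorem linePoint_intSeparated {n : ℕ} (θ : ℝ) {y : Fin n → ℝ} (hy : Function.Injective y) :
    IntSeparated (linePoint (fun _ => θ) y) := by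
  intro i j hij m h
  have := congrArg Complex.im h
  simp [linePoint] at this
  exact hij (hy this)

theorem linePoint_re {n : ℕ} (a y : Fin n → ℝ) (k : Fin n) : (linePoint a y k).re = a k := by
  simp [linePoint]

theorem linePoint_im {n : ℕ} (a y : Fin n → ℝ) (k : Fin n) : (linePoint a y k).im = y k := by
  simp [linePoint]

theorem linePoint_cons {n : ℕ} (a : Fin (n + 1) → ℝ) (t : ℝ) (y : Fin n → ℝ) :
    linePoint a (Fin.cons t y) =
      Fin.cons ((a 0 : ℂ) + t * Complex.I) (linePoint (Fin.tail a) y) := by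
  funext k
  refine Fin.cases ?_ (fun k => ?_) k <;> simp [linePoint, Fin.tail]

theorem continuous_linePoint {n : ℕ} (a : Fin n → ℝ) : Continuous (linePoint a) := by
  unfold linePoint
  fun_prop

/-- Each diagonal is a proper linear subspace, hence null. Off the diagonals, points of a common
vertical line are integer-separated. -/
theorem ae_injective (n : ℕ) : ∀ᵐ y : Fin n → ℝ, Function.Injective y := by
  have h : ∀ i j : Fin n, i ≠ j → ∀ᵐ y : Fin n → ℝ, y i ≠ y j := by
    intro i j hij
    set L : (Fin n → ℝ) →ₗ[ℝ] ℝ := (LinearMap.proj i : (Fin n → ℝ) →ₗ[ℝ] ℝ) - LinearMap.proj j with hL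
    have hne : LinearMap.ker L ≠ ⊤ := by
      intro htop
      have : Pi.single i (1 : ℝ) ∈ LinearMap.ker L := htop ▸ Submodule.mem_top
      rw [LinearMap.mem_ker] at this
      simp [hL, hij.symm] at this
    have h0 := Measure.addHaar_submodule (volume : Measure (Fin n → ℝ)) (LinearMap.ker L) hne
    rw [ae_iff]
    refine measure_mono_null (fun y hy => ?_) h0
    simp only [mem_ofPred_eq, not_not] at hy
    simp [hL, hy]
  have h' : ∀ᵐ y : Fin n → ℝ, ∀ i j : Fin n, i ≠ j → y i ≠ y j := by
    rw [ae_all_iff]; intro i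
    rw [ae_all_iff]; intro j
    by_cases hij : i = j
    · exact Eventually.of_forall fun _ h => absurd hij h
    · filter_upwards [h i j hij] with y hy _
      exact hy
  filter_upwards [h'] with y hy i j hij
  by_contra hne
  exact hy i j hne hij

theorem norm_inv_le_of_re {u : ℂ} {t : ℝ} (ht : 0 < t) (h : t ≤ |u.re|) : ‖1 / u‖ ≤ 1 / t := by
  rw [norm_div, norm_one]
  exact one_div_le_one_div_of_le ht (h.trans (Complex.abs_re_le_norm u))

/-- On a common vertical line the denominators have real part `c i ≥ 1`, so each of the `n!` terms
of the determinant is at most `1`. -/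
theorem norm_cauchyD_linePoint_le {n : ℕ} {c : Fin n → ℕ} (hc : ∀ i, 0 < c i) (θ : ℝ)
    (y : Fin n → ℝ) : ‖cauchyD c (linePoint (fun _ => θ) y)‖ ≤ n.factorial := by
  rw [cauchyD, Matrix.det_apply]
  refine (norm_sum_le_of_le _ (f := fun σ : Equiv.Perm (Fin n) => _) (n := fun _ => (1 : ℝ))
    fun σ _ => ?_).trans ?_
  · rw [Units.smul_def, zsmul_eq_mul, norm_mul, norm_prod]
    have h1 : ‖(((Equiv.Perm.sign σ : ℤˣ) : ℤ) : ℂ)‖ = 1 := by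
      rcases Int.units_eq_one_or (Equiv.Perm.sign σ) with h | h <;> rw [h] <;> simp
    rw [h1, one_mul]
    refine Finset.prod_le_one (fun _ _ => norm_nonneg _) fun i _ => ?_
    rw [Matrix.of_apply]
    have h2 : (1 : ℝ) ≤ c (σ i) := by exact_mod_cast hc (σ i)
    refine (norm_inv_le_of_re one_pos ?_).trans (by norm_num)
    simp only [Complex.sub_re, Complex.add_re, linePoint_re, Complex.natCast_re]
    rw [add_sub_cancel_left, abs_of_nonneg (by linarith)]
    exact h2
  · simp [Fintype.card_perm]

theorem norm_div_sub_le {u : ℂ} {c : ℕ} {t : ℝ} (ht : 0 < t) (h : t ≤ |u.re - c|) :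
    ‖u / (u - c)‖ ≤ 1 + c / t := by
  have hre : (u - c).re = u.re - c := by simp
  have hne : u - c ≠ 0 := by
    intro h0
    rw [← hre, h0, Complex.zero_re, abs_zero] at h
    linarith
  have h1 : u / (u - c) = 1 + c * (1 / (u - c)) := by field_simp; ring
  rw [h1]
  refine (norm_add_le _ _).trans ?_
  rw [norm_one, norm_mul, Complex.norm_natCast, div_eq_mul_one_div (c : ℝ)]
  have := norm_inv_le_of_re ht (u := u - c) (by rw [hre]; exact h)
  gcongr

theorem norm_stringKernel_le {n : ℕ} {c : Fin n → ℕ} (hc : ∀ i, 0 < c i) {θ t : ℝ} (ht : 0 < t)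
    (y : Fin n → ℝ) {z : ℂ} (hz : ∀ i, t ≤ |z.re - θ - c i|) :
    ‖stringKernel c z (linePoint (fun _ => θ) y)‖ ≤ n.factorial * ∏ i, (1 + (c i : ℝ) / t) := by
  rw [stringKernel, norm_mul, norm_prod]
  refine mul_le_mul (norm_cauchyD_linePoint_le hc θ y) ?_
    (Finset.prod_nonneg fun _ _ => norm_nonneg _) (by positivity)
  refine Finset.prod_le_prod (fun _ _ => norm_nonneg _) fun i _ => norm_div_sub_le ht ?_
  rw [Complex.sub_re, linePoint_re]
  exact hz i

/-! ### Iterated integrals -/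

theorem cons_eq_piFinSuccAbove_symm (n : ℕ) :
    (fun q : ℝ × (Fin n → ℝ) => (Fin.cons q.1 q.2 : Fin (n + 1) → ℝ)) =
      (MeasurableEquiv.piFinSuccAbove (fun _ : Fin (n + 1) => ℝ) 0).symm := by
  funext q
  exact (Fin.insertNth_zero' q.1 q.2).symm

theorem measurePreserving_cons (n : ℕ) : MeasurePreserving
    (fun q : ℝ × (Fin n → ℝ) => (Fin.cons q.1 q.2 : Fin (n + 1) → ℝ)) volume volume := by
  rw [cons_eq_piFinSuccAbove_symm]
  exact (volume_preserving_piFinSuccAbove (fun _ : Fin (n + 1) => ℝ) 0).symm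

theorem measurableEmbedding_cons (n : ℕ) : MeasurableEmbedding
    (fun q : ℝ × (Fin n → ℝ) => (Fin.cons q.1 q.2 : Fin (n + 1) → ℝ)) := by
  rw [cons_eq_piFinSuccAbove_symm]
  exact (MeasurableEquiv.piFinSuccAbove (fun _ : Fin (n + 1) => ℝ) 0).symm.measurableEmbedding

theorem integrable_cons {n : ℕ} {g : (Fin (n + 1) → ℝ) → ℂ} (hg : Integrable g) :
    Integrable (fun q : ℝ × (Fin n → ℝ) => g (Fin.cons q.1 q.2)) (volume.prod volume) :=
  (measurePreserving_cons n).integrable_comp_of_integrable hg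

theorem integral_cons_eq {n : ℕ} {g : (Fin (n + 1) → ℝ) → ℂ} (hg : Integrable g) :
    ∫ y, g y = ∫ t : ℝ, ∫ y : Fin n → ℝ, g (Fin.cons t y) := by
  rw [← (measurePreserving_cons n).integral_comp (measurableEmbedding_cons n)]
  exact integral_prod _ (integrable_cons hg)

theorem integral_cons_symm_eq {n : ℕ} {g : (Fin (n + 1) → ℝ) → ℂ} (hg : Integrable g) :
    ∫ y, g y = ∫ y : Fin n → ℝ, ∫ t : ℝ, g (Fin.cons t y) := by
  rw [← (measurePreserving_cons n).integral_comp (measurableEmbedding_cons n)]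
  exact integral_prod_symm _ (integrable_cons hg)

theorem measurePreserving_comp_perm {n : ℕ} (τ : Equiv.Perm (Fin n)) :
    MeasurePreserving (fun y : Fin n → ℝ => fun i => y (τ i)) volume volume ∧
      MeasurableEmbedding (fun y : Fin n → ℝ => fun i => y (τ i)) := by
  have e : (fun y : Fin n → ℝ => fun i => y (τ i)) =
      MeasurableEquiv.piCongrLeft (fun _ : Fin n => ℝ) τ.symm := by
    funext y i
    have := MeasurableEquiv.piCongrLeft_apply_apply (β := fun _ : Fin n => ℝ) τ.symm y (τ i)
    rw [Equiv.symm_apply_apply] at this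
    exact this.symm
  rw [e]
  exact ⟨volume_measurePreserving_piCongrLeft (fun _ : Fin n => ℝ) τ.symm,
    MeasurableEquiv.measurableEmbedding _⟩

theorem integral_comp_perm {n : ℕ} (τ : Equiv.Perm (Fin n)) (g : (Fin n → ℝ) → ℂ) :
    ∫ y : Fin n → ℝ, g (fun i => y (τ i)) = ∫ y, g y :=
  (measurePreserving_comp_perm τ).1.integral_comp (measurePreserving_comp_perm τ).2 g

theorem integrable_comp_perm {n : ℕ} (τ : Equiv.Perm (Fin n)) {g : (Fin n → ℝ) → ℂ}
    (hg : Integrable g) : Integrable fun y : Fin n → ℝ => g (fun i => y (τ i)) :=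
  (measurePreserving_comp_perm τ).1.integrable_comp_of_integrable hg

/-! ### Decay -/

/-- The weight `∏ (1 + |yₖ|)^(-p)`. -/
def lineWeight {n : ℕ} (p : ℝ) (y : Fin n → ℝ) : ℝ := ∏ k, (1 + |y k|) ^ (-p)

theorem lineWeight_nonneg {n : ℕ} (p : ℝ) (y : Fin n → ℝ) : 0 ≤ lineWeight p y :=
  Finset.prod_nonneg fun _ _ => Real.rpow_nonneg (by positivity) _

theorem lineWeight_cons {n : ℕ} (p : ℝ) (t : ℝ) (y : Fin n → ℝ) :
    lineWeight p (Fin.cons t y : Fin (n + 1) → ℝ) = (1 + |t|) ^ (-p) * lineWeight p y := by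
  simp [lineWeight, Fin.prod_univ_succ]

theorem integrable_one_add_abs_rpow {p : ℝ} (hp : 1 < p) :
    Integrable fun y : ℝ => (1 + |y|) ^ (-p) := by
  have h := integrable_one_add_norm (E := ℝ) (μ := volume) (r := p) (by simpa using hp)
  simpa using h

theorem integrable_lineWeight (n : ℕ) {p : ℝ} (hp : 1 < p) :
    Integrable fun y : Fin n → ℝ => lineWeight p y := by
  unfold lineWeight
  exact Integrable.fintype_prod fun _ => integrable_one_add_abs_rpow hp

theorem rpow_neg_norm_le_im {p : ℝ} (hp : 0 ≤ p) (u : ℂ) :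
    (1 + ‖u‖) ^ (-p) ≤ (1 + |u.im|) ^ (-p) :=
  Real.rpow_le_rpow_of_nonpos (by positivity) (by linarith [Complex.abs_im_le_norm u])
    (by linarith)

theorem rpow_neg_one_add_le_one {p x : ℝ} (hp : 0 ≤ p) (hx : 0 ≤ x) : (1 + x) ^ (-p) ≤ 1 :=
  Real.rpow_le_one_of_one_le_of_nonpos (by linarith) (by linarith)

theorem decay_linePoint_le {n : ℕ} {p : ℝ} (hp : 0 ≤ p) (a y : Fin n → ℝ) :
    decay p (linePoint a y) ≤ lineWeight p y := by
  unfold decay lineWeight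
  refine Finset.prod_le_prod (fun _ _ => Real.rpow_nonneg (by positivity) _) fun k _ => ?_
  have := rpow_neg_norm_le_im hp (linePoint a y k)
  rwa [linePoint_im] at this

/-- Only the bottom point of each string in `s` is kept, all other weights being at most `1`. The
set `s` must leave out empty strings, which provide no decay. -/
theorem decay_stringVec_le {n N : ℕ} {p : ℝ} (hp : 0 ≤ p) (c : Fin n → ℕ) (h : ∑ i, c i = N)
    {w : Fin n → ℂ} (hw : IntSeparated w) (s : Finset (Fin n)) (hs : ∀ i ∈ s, 0 < c i) :
    decay p (stringVec c h w) ≤ ∏ i ∈ s, (1 + |(w i).im|) ^ (-p) := by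
  have h1 : decay p (stringVec c h w) = ∏ x ∈ stringSet c w, (1 + ‖x‖) ^ (-p) := by
    rw [← image_stringVec c h w, Finset.prod_image fun i _ j _ h' => stringVec_injective c h hw h']
    rfl
  have hnn : ∀ x : ℂ, 0 ≤ (1 + ‖x‖) ^ (-p) := fun x => Real.rpow_nonneg (by positivity) _
  have hle : ∀ x : ℂ, (1 + ‖x‖) ^ (-p) ≤ 1 := fun x => rpow_neg_one_add_le_one hp (norm_nonneg x)
  have h0 : ∏ i ∈ s, (1 + |(w i).im|) ^ (-p) =
      ∏ i, if i ∈ s then (1 + |(w i).im|) ^ (-p) else 1 := by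
    rw [Finset.prod_ite_mem, Finset.univ_inter]
  rw [h1, prod_stringSet hw, h0]
  refine Finset.prod_le_prod (fun _ _ => Finset.prod_nonneg fun _ _ => hnn _) fun i _ => ?_
  split_ifs with hi
  · obtain ⟨m, hm⟩ : ∃ m, c i = m + 1 := ⟨c i - 1, by have := hs i hi; omega⟩
    rw [hm, Finset.prod_range_succ']
    have h2 := rpow_neg_norm_le_im hp (w i)
    have h3 : ∏ k ∈ Finset.range m, (1 + ‖w i + ((k + 1 : ℕ) : ℂ)‖) ^ (-p) ≤ 1 :=
      Finset.prod_le_one (fun _ _ => hnn _) fun _ _ => hle _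
    rw [Nat.cast_zero, add_zero]
    calc _ ≤ 1 * (1 + ‖w i‖) ^ (-p) := mul_le_mul_of_nonneg_right h3 (hnn _)
      _ ≤ _ := by rwa [one_mul]
  · exact Finset.prod_le_one (fun _ _ => hnn _) fun _ _ => hle _

/-- `F` is holomorphic on the tube and bounded there by `C ∏ (1 + |zₖ|)^(-p)`. -/
structure TubeDecay {N : ℕ} (α β p C : ℝ) (F : (Fin N → ℂ) → ℂ) : Prop where
  differentiableOn : DifferentiableOn ℂ F (tube N α β)
  bound : ∀ z ∈ tube N α β, ‖F z‖ ≤ C * decay p z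

theorem TubeDecay.nonneg {N : ℕ} {α β p C : ℝ} {F : (Fin N → ℂ) → ℂ} (hF : TubeDecay α β p C F)
    {z : Fin N → ℂ} (hz : z ∈ tube N α β) : 0 ≤ C :=
  nonneg_of_mul_nonneg_left ((norm_nonneg _).trans (hF.bound z hz)) (decay_pos p z)

theorem cons_mem_tube {N : ℕ} {α β : ℝ} {x : ℂ} (hx : α < x.re ∧ x.re < β) {v : Fin N → ℂ}
    (hv : v ∈ tube N α β) : (Fin.cons x v : Fin (N + 1) → ℂ) ∈ tube (N + 1) α β :=
  Fin.cases hx hv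

theorem decay_cons {N : ℕ} (p : ℝ) (x : ℂ) (v : Fin N → ℂ) :
    decay p (Fin.cons x v : Fin (N + 1) → ℂ) = (1 + ‖x‖) ^ (-p) * decay p v := by
  simp [decay, Fin.prod_univ_succ]

theorem differentiable_cons {N : ℕ} (x : ℂ) :
    Differentiable ℂ fun v : Fin N → ℂ => (Fin.cons x v : Fin (N + 1) → ℂ) := by
  rw [differentiable_pi]
  refine Fin.cases ?_ fun i => ?_
  · simp
  · simp only [Fin.cons_succ]
    fun_prop

/-- The decay in the first variable moves into the constant; therefore bounds for symmetrizations
have to be linear in `C` and otherwise uniform in the function. -/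
theorem TubeDecay.slice {N : ℕ} {α β p C : ℝ} {F : (Fin (N + 1) → ℂ) → ℂ}
    (hF : TubeDecay α β p C F) {x : ℂ} (hx : α < x.re ∧ x.re < β) :
    TubeDecay α β p (C * (1 + ‖x‖) ^ (-p)) fun v : Fin N → ℂ => F (Fin.cons x v) where
  differentiableOn := hF.differentiableOn.comp (differentiable_cons x).differentiableOn
    fun _ hv => cons_mem_tube hx hv
  bound := fun v hv => by
    rw [mul_assoc, ← decay_cons]
    exact hF.bound _ (cons_mem_tube hx hv)

theorem stringVec_mem_tube {n N : ℕ} {α β θ : ℝ} (hα : α < θ) (hβ : θ + ((N : ℝ) - 1) < β)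
    (c : Fin n → ℕ) (h : ∑ i, c i = N) (y : Fin n → ℝ) :
    stringVec c h (linePoint (fun _ => θ) y) ∈ tube N α β := by
  intro k
  simp only [stringVec, Complex.add_re, linePoint_re, Complex.natCast_re]
  set q := finSigmaFinEquiv.symm (Fin.cast h.symm k)
  have h1 : (q.2 : ℕ) + 1 ≤ N := by
    have h2 := q.2.isLt
    have h3 : c q.1 ≤ ∑ i, c i := Finset.single_le_sum (fun _ _ => Nat.zero_le _)
      (Finset.mem_univ _)
    omega
  have h2 : ((q.2 : ℕ) : ℝ) + 1 ≤ N := by exact_mod_cast h1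
  have h3 : (0 : ℝ) ≤ ((q.2 : ℕ) : ℝ) := Nat.cast_nonneg _
  constructor <;> linarith

theorem exists_norm_symmSet_le (N : ℕ) {α β θ p : ℝ} (hp : 0 ≤ p) (hα : α < θ)
    (hβ : θ + ((N : ℝ) - 1) < β) :
    ∃ K : ℝ, 0 ≤ K ∧ ∀ (C : ℝ) (G : (Fin N → ℂ) → ℂ), TubeDecay α β p C G →
      ∀ (n : ℕ) (c : Fin n → ℕ), ∑ i, c i = N → ∀ s : Finset (Fin n), (∀ i ∈ s, 0 < c i) →
      ∀ y : Fin n → ℝ, Function.Injective y →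
        ‖symmSet N G (stringSet c (linePoint (fun _ => θ) y))‖ ≤
          K * C * ∏ i ∈ s, (1 + |y i|) ^ (-p) := by
  -- A quarter of the distance from `[θ, θ + N - 1]` to the boundary of the strip, so that all
  -- strings stay in the tube shrunk by `2ρ`.
  set ρ : ℝ := min (θ - α) (β - (θ + ((N : ℝ) - 1))) / 4 with hρ
  have hm : 0 < min (θ - α) (β - (θ + ((N : ℝ) - 1))) := lt_min (by linarith) (by linarith)
  have hρ0 : 0 < ρ := by positivity
  have h1 : 4 * ρ ≤ θ - α := by rw [hρ]; linarith [min_le_left (θ - α) (β - (θ + ((N : ℝ) - 1)))]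
  have h2 : 4 * ρ ≤ β - (θ + ((N : ℝ) - 1)) := by
    rw [hρ]; linarith [min_le_right (θ - α) (β - (θ + ((N : ℝ) - 1)))]
  obtain ⟨K, hK, hKb⟩ := exists_norm_symm_le N hρ0 hp
  refine ⟨K, hK, fun C G hG n c hc s hs y hy => ?_⟩
  have hw := linePoint_intSeparated θ hy
  rw [symmSet_stringSet_eq G c hc hw]
  refine (hKb α β C G hG.differentiableOn hG.bound _ (stringVec_injective c hc hw)
    (stringVec_mem_tube (by linarith) (by linarith) c hc y)).trans ?_
  have hC : 0 ≤ C := hG.nonneg (stringVec_mem_tube hα hβ c hc y)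
  refine mul_le_mul_of_nonneg_left ?_ (mul_nonneg hK hC)
  have := decay_stringVec_le hp c hc hw s hs
  simpa only [linePoint_im] using this

/-! ### Measurability -/

/-- Division by zero can make `symm` discontinuous on the diagonals, so only measurability is
available there. -/
theorem measurable_symm {Y : Type*} [TopologicalSpace Y] [MeasurableSpace Y]
    [OpensMeasurableSpace Y] {N : ℕ} {G : Y → (Fin N → ℂ) → ℂ} {v : Y → Fin N → ℂ}
    (hv : Continuous v) (hG : ∀ σ : Equiv.Perm (Fin N), Continuous fun y => G y fun k => v y (σ k)) :
    Measurable fun y => symm (G y) (v y) := by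
  have hvk : ∀ k, Measurable fun y => v y k := fun k =>
    ((continuous_apply k).comp hv).measurable
  unfold symm
  refine Finset.measurable_sum _ fun σ _ => ?_
  refine Measurable.mul ?_ (hG σ).measurable
  refine Finset.measurable_prod _ fun B _ => Finset.measurable_prod _ fun A _ => ?_
  exact (((hvk _).sub (hvk _)).sub_const 1).div ((hvk _).sub (hvk _))

theorem continuous_stringVec {n N : ℕ} (c : Fin n → ℕ) (h : ∑ i, c i = N) :
    Continuous (stringVec c h) := by
  unfold stringVec
  fun_prop

theorem measurable_cauchyD {n : ℕ} (c : Fin n → ℕ) : Measurable (cauchyD c) := by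
  unfold cauchyD
  simp_rw [Matrix.det_apply, Units.smul_def, zsmul_eq_mul]
  refine Finset.measurable_sum _ fun σ _ => Measurable.const_mul ?_ _
  refine Finset.measurable_prod _ fun i _ => ?_
  simp only [Matrix.of_apply]
  fun_prop

theorem measurable_stringKernel {n : ℕ} (c : Fin n → ℕ) {Y : Type*} [MeasurableSpace Y]
    {x : Y → ℂ} {v : Y → Fin n → ℂ} (hx : Measurable x) (hv : Measurable v) :
    Measurable fun y => stringKernel c (x y) (v y) := by
  unfold stringKernel
  refine ((measurable_cauchyD c).comp hv).mul (Finset.measurable_prod _ fun i _ => ?_)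
  have := (measurable_pi_apply i).comp hv
  exact (hx.sub this).div ((hx.sub this).sub_const _)

/-! ### Integrability of the integrands -/

theorem norm_interaction_le {N : ℕ} {a : Fin N → ℝ} (ha : ∀ i j, i < j → 1 < a i - a j)
    {z : Fin N → ℂ} (hz : ∀ k, (z k).re = a k) :
    ‖∏ i : Fin N, ∏ j ∈ Finset.Ioi i, (z i - z j) / (z i - z j - 1)‖ ≤
      ∏ i : Fin N, ∏ j ∈ Finset.Ioi i, (1 + 1 / (a i - a j - 1)) := by
  rw [norm_prod]
  refine Finset.prod_le_prod (fun _ _ => norm_nonneg _) fun i _ => ?_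
  rw [norm_prod]
  refine Finset.prod_le_prod (fun _ _ => norm_nonneg _) fun j hj => ?_
  have h1 := ha i j (Finset.mem_Ioi.1 hj)
  have h2 := norm_div_sub_le (u := z i - z j) (c := 1) (t := a i - a j - 1) (by linarith) (by
    rw [Complex.sub_re, hz, hz, Nat.cast_one]
    exact le_abs_self _)
  simpa using h2

theorem sub_sub_one_ne_zero {u v : ℂ} (h : 1 < u.re - v.re) : u - v - 1 ≠ 0 := by
  intro h0
  have := congrArg Complex.re h0
  simp at this
  linarith

theorem linePoint_mem_tube {N : ℕ} {α β : ℝ} {a : Fin N → ℝ} (h : ∀ k, α < a k ∧ a k < β)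
    (y : Fin N → ℝ) : linePoint a y ∈ tube N α β := fun k => by
  rw [linePoint_re]; exact h k

theorem integrable_nestedIntegrand {N : ℕ} {α β p C : ℝ} {F : (Fin N → ℂ) → ℂ} (hp : 1 < p)
    (hF : TubeDecay α β p C F) {a : Fin N → ℝ} (ha : ∀ i j, i < j → 1 < a i - a j)
    (haαβ : ∀ k, α < a k ∧ a k < β) :
    Integrable fun y : Fin N → ℝ => nestedIntegrand F (linePoint a y) := by
  have hmem := linePoint_mem_tube haαβ
  have hC : 0 ≤ C := hF.nonneg (hmem 0)
  set P : ℝ := ∏ i : Fin N, ∏ j ∈ Finset.Ioi i, (1 + 1 / (a i - a j - 1)) with hP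
  have hP0 : 0 ≤ P := (norm_nonneg _).trans (norm_interaction_le ha (linePoint_re a 0))
  have hcont : Continuous fun y : Fin N → ℝ => nestedIntegrand F (linePoint a y) := by
    unfold nestedIntegrand
    have hk : ∀ k, Continuous fun y : Fin N → ℝ => linePoint a y k := fun k =>
      (continuous_apply k).comp (continuous_linePoint a)
    refine Continuous.mul ?_ (hF.differentiableOn.continuousOn.comp_continuous
      (continuous_linePoint a) hmem)
    refine continuous_finsetProd _ fun i _ => continuous_finsetProd _ fun j hj => ?_
    refine ((hk i).sub (hk j)).div (((hk i).sub (hk j)).sub continuous_const) fun y => ?_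
    refine sub_sub_one_ne_zero ?_
    rw [linePoint_re, linePoint_re]
    exact ha i j (Finset.mem_Ioi.1 hj)
  refine ((integrable_lineWeight N hp).const_mul (P * C)).mono' hcont.aestronglyMeasurable
    (Eventually.of_forall fun y => ?_)
  rw [nestedIntegrand, norm_mul, mul_assoc]
  refine mul_le_mul (norm_interaction_le ha (linePoint_re a y)) ?_ (norm_nonneg _) hP0
  exact (hF.bound _ (hmem y)).trans
    (mul_le_mul_of_nonneg_left (decay_linePoint_le (by linarith) a y) hC)

/-- The integrand attached to strings of lengths `c`. -/
def stringTerm {N n : ℕ} (F : (Fin N → ℂ) → ℂ) (c : Fin n → ℕ) (w : Fin n → ℂ) : ℂ :=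
  cauchyD c w * symmSet N F (stringSet c w)

/-- The integrand attached to strings of lengths `m + 1` and `c`, when the top of the first string
is the first variable of `F`. -/
def topTerm {N n : ℕ} (F : (Fin (N + 1) → ℂ) → ℂ) (m : ℕ) (c : Fin n → ℕ)
    (w : Fin (n + 1) → ℂ) : ℂ :=
  stringKernel c (w 0) (Fin.tail w) *
    symmSet N (fun v => F (Fin.cons (w 0 + m) v)) (stringSet (Fin.cons m c) w)

theorem integrable_stringTerm {N n : ℕ} {α β θ p C : ℝ} {F : (Fin N → ℂ) → ℂ} (hp : 1 < p)
    (hF : TubeDecay α β p C F) (hα : α < θ) (hβ : θ + ((N : ℝ) - 1) < β) {c : Fin n → ℕ}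
    (hc : ∀ i, 0 < c i) (h : ∑ i, c i = N) :
    Integrable fun y : Fin n → ℝ => stringTerm F c (linePoint (fun _ => θ) y) := by
  obtain ⟨K, hK, hKb⟩ := exists_norm_symmSet_le N (p := p) (by linarith) hα hβ
  have hmeas : Measurable fun y : Fin n → ℝ => cauchyD c (linePoint (fun _ => θ) y) *
      symm F (stringVec c h (linePoint (fun _ => θ) y)) := by
    have hl : Continuous fun y : Fin n → ℝ => linePoint (fun _ => θ) y := continuous_linePoint _
    have hv := (continuous_stringVec c h).comp hl
    refine ((measurable_cauchyD c).comp hl.measurable).mul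
      (measurable_symm (G := fun _ => F) hv fun σ => ?_)
    refine hF.differentiableOn.continuousOn.comp_continuous
      (continuous_pi fun k => (continuous_apply (σ k)).comp hv) fun y k => ?_
    exact stringVec_mem_tube hα hβ c h y (σ k)
  refine ((integrable_lineWeight n hp).const_mul (n.factorial * (K * C))).mono'
    (hmeas.aestronglyMeasurable.congr ?_) ?_
  · filter_upwards [ae_injective n] with y hy
    rw [stringTerm, symmSet_stringSet_eq F c h (linePoint_intSeparated θ hy)]
  · filter_upwards [ae_injective n] with y hy
    rw [stringTerm, norm_mul, mul_assoc]
    exact mul_le_mul (norm_cauchyD_linePoint_le hc θ y)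
      (hKb C F hF n c h Finset.univ (fun i _ => hc i) y hy) (norm_nonneg _) (Nat.cast_nonneg _)

theorem prod_Ioi_zero_eq_lineWeight_tail {n : ℕ} (p : ℝ) (y : Fin (n + 1) → ℝ) :
    ∏ i ∈ Finset.Ioi (0 : Fin (n + 1)), (1 + |y i|) ^ (-p) = lineWeight p (Fin.tail y) := by
  rw [Fin.prod_Ioi_zero]; rfl

theorem lineWeight_eq_zero_mul_tail {n : ℕ} (p : ℝ) (y : Fin (n + 1) → ℝ) :
    lineWeight p y = (1 + |y 0|) ^ (-p) * lineWeight p (Fin.tail y) := by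
  rw [← lineWeight_cons, Fin.cons_self_tail]

theorem topTerm_zero {N n : ℕ} (F : (Fin (N + 1) → ℂ) → ℂ) (c : Fin n → ℕ)
    (w : Fin (n + 1) → ℂ) : topTerm F 0 c w = stringKernel c (w 0) (Fin.tail w) *
      symmSet N (fun v => F (Fin.cons (w 0) v)) (stringSet c (Fin.tail w)) := by
  rw [topTerm, stringSet_cons_zero, Nat.cast_zero, add_zero]

theorem tail_injective {n : ℕ} {y : Fin (n + 1) → ℝ} (hy : Function.Injective y) :
    Function.Injective (Fin.tail y) := fun _ _ h => Fin.succ_injective _ (hy h)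

theorem continuous_slice {N : ℕ} {α β p C : ℝ} {F : (Fin (N + 1) → ℂ) → ℂ}
    (hF : TubeDecay α β p C F) {Y : Type*} [TopologicalSpace Y] {x : Y → ℂ} (hx : Continuous x)
    (hxm : ∀ y, α < (x y).re ∧ (x y).re < β) {v : Y → Fin N → ℂ} (hv : Continuous v)
    (hvm : ∀ y, v y ∈ tube N α β) : Continuous fun y => F (Fin.cons (x y) (v y)) := by
  refine hF.differentiableOn.continuousOn.comp_continuous ?_ fun y => cons_mem_tube (hxm y) (hvm y)
  refine continuous_pi (Fin.cases ?_ fun i => ?_)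
  · simpa using hx
  · simp only [Fin.cons_succ]
    exact (continuous_apply i).comp hv

theorem integrable_topTerm_zero {N n : ℕ} {α β θ a t p C : ℝ} {F : (Fin (N + 1) → ℂ) → ℂ}
    (hp : 1 < p) (hF : TubeDecay α β p C F) (hα : α < θ) (hβ : θ + ((N : ℝ) - 1) < β)
    (ha : α < a ∧ a < β) {c : Fin n → ℕ} (hc : ∀ i, 0 < c i) (h : ∑ i, c i = N) (ht : 0 < t)
    (hat : ∀ i, t ≤ |a - θ - c i|) :
    Integrable fun y : Fin (n + 1) → ℝ =>
      topTerm F 0 c (linePoint (Fin.cons a fun _ => θ) y) := by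
  obtain ⟨K, hK, hKb⟩ := exists_norm_symmSet_le N (p := p) (by linarith) hα hβ
  set z : (Fin (n + 1) → ℝ) → ℂ := fun y => linePoint (Fin.cons a fun _ => θ) y 0 with hz
  set v : (Fin (n + 1) → ℝ) → Fin n → ℂ := fun y => linePoint (fun _ => θ) (Fin.tail y) with hv
  have hzre : ∀ y, (z y).re = a := fun y => by simp [hz, linePoint_re]
  have hzim : ∀ y, (z y).im = y 0 := fun y => by simp [hz, linePoint_im]
  have hzab : ∀ y, α < (z y).re ∧ (z y).re < β := fun y => by rw [hzre]; exact ha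
  have htail : Continuous fun y : Fin (n + 1) → ℝ => Fin.tail y :=
    continuous_pi fun i => continuous_apply i.succ
  have hvc : Continuous v := (continuous_linePoint _).comp htail
  have hzc : Continuous z := (continuous_apply 0).comp (continuous_linePoint _)
  have hsv := (continuous_stringVec c h).comp hvc
  have heq : ∀ y, topTerm F 0 c (linePoint (Fin.cons a fun _ => θ) y) =
      stringKernel c (z y) (v y) * symmSet N (fun u => F (Fin.cons (z y) u))
        (stringSet c (v y)) := fun y => topTerm_zero _ _ _
  have hmeas : Measurable fun y => stringKernel c (z y) (v y) *
      symm (fun u => F (Fin.cons (z y) u)) (stringVec c h (v y)) := by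
    refine (measurable_stringKernel c hzc.measurable hvc.measurable).mul
      (measurable_symm (G := fun y u => F (Fin.cons (z y) u)) hsv fun σ => ?_)
    exact continuous_slice hF hzc hzab
      (continuous_pi fun k => (continuous_apply (σ k)).comp hsv)
      fun y k => stringVec_mem_tube hα hβ c h (Fin.tail y) (σ k)
  simp_rw [heq]
  refine ((integrable_lineWeight (n + 1) hp).const_mul
    ((n.factorial * ∏ i, (1 + (c i : ℝ) / t)) * (K * C))).mono'
    (hmeas.aestronglyMeasurable.congr ?_) ?_
  · filter_upwards [ae_injective (n + 1)] with y hy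
    rw [symmSet_stringSet_eq _ c h (linePoint_intSeparated θ (tail_injective hy))]
  · filter_upwards [ae_injective (n + 1)] with y hy
    rw [norm_mul, mul_assoc]
    refine mul_le_mul (norm_stringKernel_le hc ht (Fin.tail y) fun i => by rw [hzre]; exact hat i)
      ?_ (norm_nonneg _) (by positivity)
    have hC : 0 ≤ C := hF.nonneg (cons_mem_tube (hzab y) (stringVec_mem_tube hα hβ c h (Fin.tail y)))
    refine (hKb _ _ (hF.slice (hzab y)) n c h Finset.univ (fun i _ => hc i) _
      (tail_injective hy)).trans ?_
    rw [lineWeight_eq_zero_mul_tail, ← hzim y]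
    have h1 := rpow_neg_norm_le_im (p := p) (by linarith) (z y)
    have h2 := lineWeight_nonneg p (Fin.tail y)
    calc K * (C * (1 + ‖z y‖) ^ (-p)) * ∏ i, (1 + |Fin.tail y i|) ^ (-p)
        = K * C * ((1 + ‖z y‖) ^ (-p) * lineWeight p (Fin.tail y)) := by
          rw [lineWeight]; ring
      _ ≤ _ := by gcongr

theorem integrable_topTerm {N n m : ℕ} {α β θ p C : ℝ} {F : (Fin (N + 1) → ℂ) → ℂ}
    (hp : 1 < p) (hF : TubeDecay α β p C F) (hα : α < θ) (hβ : θ + (N : ℝ) < β)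
    {c : Fin n → ℕ} (hc : ∀ i, 0 < c i) (h : m + ∑ i, c i = N) :
    Integrable fun y : Fin (n + 1) → ℝ => topTerm F m c (linePoint (fun _ => θ) y) := by
  have hβ' : θ + ((N : ℝ) - 1) < β := by linarith
  obtain ⟨K, hK, hKb⟩ := exists_norm_symmSet_le N (p := p) (by linarith) hα hβ'
  have h' : ∑ i, (Fin.cons m c : Fin (n + 1) → ℕ) i = N := by rw [Fin.sum_cons]; exact h
  set d : Fin (n + 1) → ℕ := Fin.cons m c with hd
  set w : (Fin (n + 1) → ℝ) → Fin (n + 1) → ℂ := fun y => linePoint (fun _ => θ) y with hw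
  have hmN : (m : ℝ) ≤ N := by exact_mod_cast (by omega : m ≤ N)
  have hm0 : (0 : ℝ) ≤ m := Nat.cast_nonneg m
  set z : (Fin (n + 1) → ℝ) → ℂ := fun y => w y 0 + m with hz
  have hzre : ∀ y, (z y).re = θ + m := fun y => by simp [hz, hw, linePoint_re]
  have hzim : ∀ y, (z y).im = y 0 := fun y => by simp [hz, hw, linePoint_im]
  have hzab : ∀ y, α < (z y).re ∧ (z y).re < β := fun y => by
    rw [hzre]; constructor <;> linarith
  have hwc : Continuous w := continuous_linePoint _
  have hw0 : Continuous fun y => w y 0 := (continuous_apply 0).comp hwc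
  have hzc : Continuous z := hw0.add continuous_const
  have htc : Continuous fun y => Fin.tail (w y) :=
    continuous_pi fun i => (continuous_apply i.succ).comp hwc
  have hsv := (continuous_stringVec d h').comp hwc
  have hmeas : Measurable fun y => stringKernel c (w y 0) (Fin.tail (w y)) *
      symm (fun u => F (Fin.cons (z y) u)) (stringVec d h' (w y)) := by
    refine (measurable_stringKernel c hw0.measurable htc.measurable).mul
      (measurable_symm (G := fun y u => F (Fin.cons (z y) u)) hsv fun σ => ?_)
    exact continuous_slice hF hzc hzab
      (continuous_pi fun k => (continuous_apply (σ k)).comp hsv)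
      fun y k => stringVec_mem_tube hα hβ' d h' y (σ k)
  refine ((integrable_lineWeight (n + 1) hp).const_mul
    ((n.factorial * ∏ i, (1 + (c i : ℝ) / 1)) * (K * C))).mono'
    (hmeas.aestronglyMeasurable.congr ?_) ?_
  · filter_upwards [ae_injective (n + 1)] with y hy
    rw [topTerm, symmSet_stringSet_eq _ d h' (linePoint_intSeparated θ hy)]
  · filter_upwards [ae_injective (n + 1)] with y hy
    rw [topTerm, norm_mul, mul_assoc]
    refine mul_le_mul (norm_stringKernel_le hc one_pos (Fin.tail y) fun i => ?_)
      ?_ (norm_nonneg _) (by positivity)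
    · have h1 : (1 : ℝ) ≤ c i := by exact_mod_cast hc i
      rw [linePoint_re, sub_self, zero_sub, abs_neg]
      exact h1.trans (le_abs_self _)
    have hC : 0 ≤ C := hF.nonneg (cons_mem_tube (hzab y) (stringVec_mem_tube hα hβ' d h' y))
    -- The first string may be empty (`m = 0`), so the decay in `y 0` is taken from the first
    -- argument of `F` and the strings supply only the rest.
    refine (hKb _ _ (hF.slice (hzab y)) (n + 1) d h' (Finset.Ioi 0) (fun i hi => ?_) y hy).trans ?_
    · obtain ⟨j, rfl⟩ := Fin.exists_succ_eq_of_ne_zero (Finset.mem_Ioi.1 hi).ne'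
      exact hc j
    rw [lineWeight_eq_zero_mul_tail, ← hzim y, prod_Ioi_zero_eq_lineWeight_tail]
    have h1 := rpow_neg_norm_le_im (p := p) (by linarith) (z y)
    have h2 := lineWeight_nonneg p (Fin.tail y)
    calc K * (C * (1 + ‖z y‖) ^ (-p)) * lineWeight p (Fin.tail y)
        = K * C * ((1 + ‖z y‖) ^ (-p) * lineWeight p (Fin.tail y)) := by ring
      _ ≤ _ := by gcongr

/-! ### Reduction to the first string -/

theorem linePoint_const_comp {n : ℕ} (θ : ℝ) (y : Fin n → ℝ) (τ : Equiv.Perm (Fin n)) :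
    (fun i => linePoint (fun _ => θ) y (τ i)) = linePoint (fun _ => θ) (fun i => y (τ i)) := rfl

/-- All variables run over the same line, so relabelling them by a swap moves the distinguished
string to position `0`. -/
theorem integral_equivariant {n : ℕ} (θ : ℝ)
    {Q : (Fin (n + 1) → ℕ) → (Fin (n + 1) → ℂ) → Fin (n + 1) → ℂ}
    (hQ : ∀ c w j (τ : Equiv.Perm (Fin (n + 1))),
      Q (fun i => c (τ i)) (fun i => w (τ i)) j = Q c w (τ j))
    (c : Fin (n + 1) → ℕ) (j : Fin (n + 1)) :
    ∫ y : Fin (n + 1) → ℝ, Q c (linePoint (fun _ => θ) y) j =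
      ∫ y : Fin (n + 1) → ℝ,
        Q (fun i => c (Equiv.swap 0 j i)) (linePoint (fun _ => θ) y) 0 := by
  rw [← integral_comp_perm (Equiv.swap 0 j) fun y =>
    Q (fun i => c (Equiv.swap 0 j i)) (linePoint (fun _ => θ) y) 0]
  congr 1
  funext y
  rw [← linePoint_const_comp, hQ, Equiv.swap_apply_left]

theorem integrable_equivariant {n : ℕ} (θ : ℝ)
    {Q : (Fin (n + 1) → ℕ) → (Fin (n + 1) → ℂ) → Fin (n + 1) → ℂ}
    (hQ : ∀ c w j (τ : Equiv.Perm (Fin (n + 1))),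
      Q (fun i => c (τ i)) (fun i => w (τ i)) j = Q c w (τ j))
    (c : Fin (n + 1) → ℕ) (j : Fin (n + 1))
    (h : Integrable fun y : Fin (n + 1) → ℝ =>
        Q (fun i => c (Equiv.swap 0 j i)) (linePoint (fun _ => θ) y) 0) :
    Integrable fun y : Fin (n + 1) → ℝ => Q c (linePoint (fun _ => θ) y) j := by
  refine (integrable_comp_perm (Equiv.swap 0 j) h).congr (Eventually.of_forall fun y => ?_)
  simp only []
  rw [← linePoint_const_comp, hQ, Equiv.swap_apply_left]

/-- The integrand when the top of the `j`-th string is the first variable. -/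
def jthTopTerm {N n : ℕ} (F : (Fin (N + 1) → ℂ) → ℂ) (c : Fin n → ℕ) (w : Fin n → ℂ)
    (j : Fin n) : ℂ :=
  topCoeff c w j * symmSet N (fun v => F (Fin.cons (w j + c j - 1) v))
    ((stringSet c w).erase (w j + c j - 1))

/-- The residue when the first variable joins the `j`-th string. -/
def jthResidue {N n : ℕ} (F : (Fin (N + 1) → ℂ) → ℂ) (c : Fin n → ℕ) (w : Fin n → ℂ)
    (j : Fin n) : ℂ :=
  topCoeff c w j * symmSet N (fun v => F (Fin.cons (w j + c j) v)) (stringSet c w)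

theorem jthTopTerm_comp_perm {N n : ℕ} (F : (Fin (N + 1) → ℂ) → ℂ) (c : Fin n → ℕ)
    (w : Fin n → ℂ) (j : Fin n) (τ : Equiv.Perm (Fin n)) :
    jthTopTerm F (fun i => c (τ i)) (fun i => w (τ i)) j = jthTopTerm F c w (τ j) := by
  rw [jthTopTerm, jthTopTerm, topCoeff_comp_perm, stringSet_comp_perm]

theorem jthResidue_comp_perm {N n : ℕ} (F : (Fin (N + 1) → ℂ) → ℂ) (c : Fin n → ℕ)
    (w : Fin n → ℂ) (j : Fin n) (τ : Equiv.Perm (Fin n)) :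
    jthResidue F (fun i => c (τ i)) (fun i => w (τ i)) j = jthResidue F c w (τ j) := by
  rw [jthResidue, jthResidue, topCoeff_comp_perm, stringSet_comp_perm]

/-- Deleting the top of a string of length `m + 1` leaves length `m`, and `topCoeff` does not see
the difference. The right-hand side is the same as in `jthResidue_cons`, which is the matching
behind the induction. -/
theorem jthTopTerm_cons {N n m : ℕ} (F : (Fin (N + 1) → ℂ) → ℂ) {c : Fin n → ℕ}
    (hc : ∀ i, 0 < c i) {w : Fin (n + 1) → ℂ} (hw : IntSeparated w) :
    jthTopTerm F (Fin.cons (m + 1) c) w 0 = topTerm F m c w := by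
  have h : w 0 + ((Fin.cons (m + 1) c : Fin (n + 1) → ℕ) 0 : ℂ) - 1 = w 0 + m := by
    rw [Fin.cons_zero]; push_cast; ring
  rw [jthTopTerm, topTerm, topCoeff_cons m.succ_pos hc hw, h, stringSet_cons_succ_erase m c hw]

theorem jthResidue_cons {N n m : ℕ} (F : (Fin (N + 1) → ℂ) → ℂ) (hm : 0 < m) {c : Fin n → ℕ}
    (hc : ∀ i, 0 < c i) {w : Fin (n + 1) → ℂ} (hw : IntSeparated w) :
    jthResidue F (Fin.cons m c) w 0 = topTerm F m c w := by
  rw [jthResidue, topTerm, topCoeff_cons hm hc hw, Fin.cons_zero]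

/-- The integral of `topTerm`. -/
def topIntegral {N n : ℕ} (θ : ℝ) (F : (Fin (N + 1) → ℂ) → ℂ) (m : ℕ) (c : Fin n → ℕ) : ℂ :=
  ∫ y : Fin (n + 1) → ℝ, topTerm F m c (linePoint (fun _ => θ) y)

theorem integral_jthTopTerm {N n : ℕ} {α β θ p C : ℝ} {F : (Fin (N + 1) → ℂ) → ℂ}
    (hp : 1 < p) (hF : TubeDecay α β p C F) (hα : α < θ) (hβ : θ + (N : ℝ) < β)
    {c : Fin (n + 1) → ℕ} (hc : ∀ i, 0 < c i) (h : ∑ i, c i = N + 1) (j : Fin (n + 1)) :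
    (Integrable fun y : Fin (n + 1) → ℝ => jthTopTerm F c (linePoint (fun _ => θ) y) j) ∧
    ∫ y : Fin (n + 1) → ℝ, jthTopTerm F c (linePoint (fun _ => θ) y) j =
      topIntegral θ F (c (Equiv.swap 0 j 0) - 1) (Fin.tail fun i => c (Equiv.swap 0 j i)) := by
  set d : Fin (n + 1) → ℕ := fun i => c (Equiv.swap 0 j i) with hd
  obtain ⟨m, hm⟩ : ∃ m, d 0 = m + 1 := ⟨d 0 - 1, by have : 0 < d 0 := hc _; omega⟩
  have hdc : d = Fin.cons (m + 1) (Fin.tail d) := by rw [← hm, Fin.cons_self_tail]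
  have hdpos : ∀ i, 0 < Fin.tail d i := fun i => hc _
  have hsum : m + ∑ i, Fin.tail d i = N := by
    have h1 : ∑ i, d i = N + 1 := by rw [← h]; exact Equiv.sum_comp (Equiv.swap 0 j) c
    rw [Fin.sum_univ_succ, hm] at h1
    have h2 : ∑ i, Fin.tail d i = ∑ i : Fin n, d i.succ := rfl
    omega
  have hae : (fun y : Fin (n + 1) → ℝ => topTerm F m (Fin.tail d) (linePoint (fun _ => θ) y))
      =ᵐ[volume] fun y => jthTopTerm F d (linePoint (fun _ => θ) y) 0 := by
    filter_upwards [ae_injective (n + 1)] with y hy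
    rw [hdc, jthTopTerm_cons F hdpos (linePoint_intSeparated θ hy), ← hdc]
  have hint := integrable_topTerm hp hF hα hβ hdpos hsum
  have hm' : c (Equiv.swap 0 j 0) - 1 = m := by
    have : c (Equiv.swap 0 j 0) = m + 1 := hm
    omega
  refine ⟨integrable_equivariant θ (jthTopTerm_comp_perm F) c j (hint.congr hae), ?_⟩
  rw [integral_equivariant θ (jthTopTerm_comp_perm F), ← integral_congr_ae hae, hm']
  rfl

theorem integral_jthResidue {N n : ℕ} {α β θ p C : ℝ} {F : (Fin (N + 1) → ℂ) → ℂ}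
    (hp : 1 < p) (hF : TubeDecay α β p C F) (hα : α < θ) (hβ : θ + (N : ℝ) < β)
    {c : Fin (n + 1) → ℕ} (hc : ∀ i, 0 < c i) (h : ∑ i, c i = N) (j : Fin (n + 1)) :
    (Integrable fun y : Fin (n + 1) → ℝ => jthResidue F c (linePoint (fun _ => θ) y) j) ∧
    ∫ y : Fin (n + 1) → ℝ, jthResidue F c (linePoint (fun _ => θ) y) j =
      topIntegral θ F (c (Equiv.swap 0 j 0)) (Fin.tail fun i => c (Equiv.swap 0 j i)) := by
  set d : Fin (n + 1) → ℕ := fun i => c (Equiv.swap 0 j i) with hd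
  have hdc : d = Fin.cons (d 0) (Fin.tail d) := by rw [Fin.cons_self_tail]
  have hdpos : ∀ i, 0 < Fin.tail d i := fun i => hc _
  have hsum : d 0 + ∑ i, Fin.tail d i = N := by
    have h1 : ∑ i, d i = N := by rw [← h]; exact Equiv.sum_comp (Equiv.swap 0 j) c
    rw [Fin.sum_univ_succ] at h1
    exact h1
  have hae : (fun y : Fin (n + 1) → ℝ => topTerm F (d 0) (Fin.tail d) (linePoint (fun _ => θ) y))
      =ᵐ[volume] fun y => jthResidue F d (linePoint (fun _ => θ) y) 0 := by
    filter_upwards [ae_injective (n + 1)] with y hy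
    have := jthResidue_cons F (hc (Equiv.swap 0 j 0) : 0 < d 0) hdpos (linePoint_intSeparated θ hy)
    rw [← hdc] at this
    exact this.symm
  have hint := integrable_topTerm hp hF hα hβ hdpos hsum
  refine ⟨integrable_equivariant θ (jthResidue_comp_perm F) c j (hint.congr hae), ?_⟩
  rw [integral_equivariant θ (jthResidue_comp_perm F), ← integral_congr_ae hae]
  rfl

theorem integral_stringTerm {N n : ℕ} {α β θ p C : ℝ} {F : (Fin (N + 1) → ℂ) → ℂ}
    (hp : 1 < p) (hF : TubeDecay α β p C F) (hα : α < θ) (hβ : θ + (N : ℝ) < β)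
    {c : Fin (n + 1) → ℕ} (hc : ∀ i, 0 < c i) (h : ∑ i, c i = N + 1) :
    ∫ y : Fin (n + 1) → ℝ, stringTerm F c (linePoint (fun _ => θ) y) =
      ∑ j, topIntegral θ F (c (Equiv.swap 0 j 0) - 1)
        (Fin.tail fun i => c (Equiv.swap 0 j i)) := by
  have hae : (fun y : Fin (n + 1) → ℝ => stringTerm F c (linePoint (fun _ => θ) y))
      =ᵐ[volume] fun y => ∑ j, jthTopTerm F c (linePoint (fun _ => θ) y) j := by
    filter_upwards [ae_injective (n + 1)] with y hy
    rw [stringTerm, symmSet_stringSet_succ F (linePoint_intSeparated θ hy) c hc, Finset.mul_sum]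
    refine Finset.sum_congr rfl fun j _ => ?_
    rw [jthTopTerm, topCoeff]
    ring
  rw [integral_congr_ae hae,
    integral_finsetSum _ fun j _ => (integral_jthTopTerm hp hF hα hβ hc h j).1]
  exact Finset.sum_congr rfl fun j _ => (integral_jthTopTerm hp hF hα hβ hc h j).2

/-! ### Moving the first variable to the line of the strings -/

/-- Only the `j`-th factor is singular, with a simple pole whose numerator `z - w j` becomes `c j`;
the others are regular by integer separation. -/
theorem tendsto_sub_mul_stringKernel {n : ℕ} {c : Fin n → ℕ} {w : Fin n → ℂ}
    (hw : IntSeparated w) (j : Fin n) :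
    Tendsto (fun z => (z - (w j + c j)) * stringKernel c z w) (𝓝[≠] (w j + c j))
      (𝓝 (topCoeff c w j)) := by
  have hne : ∀ i ∈ Finset.univ.erase j, w j + (c j : ℂ) - w i - c i ≠ 0 := by
    intro i hi h
    refine hw.sub_ne (Finset.ne_of_mem_erase hi).symm ((c i : ℤ) - c j) ?_
    push_cast
    linear_combination h
  have hcont : ContinuousAt (fun z => cauchyD c w * ((z - w j) *
      ∏ i ∈ Finset.univ.erase j, (z - w i) / (z - w i - c i))) (w j + c j) := by
    refine ContinuousAt.mul continuousAt_const (ContinuousAt.mul (by fun_prop) ?_)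
    refine tendsto_finsetProd _ fun i hi => ?_
    exact ContinuousAt.div (f := fun z : ℂ => z - w i) (g := fun z => z - w i - c i)
      (by fun_prop) (by fun_prop) (hne i hi)
  have h1 := hcont.tendsto.mono_left (nhdsWithin_le_nhds (s := {w j + (c j : ℂ)}ᶜ))
  have h2 : cauchyD c w * ((w j + c j - w j) * ∏ i ∈ Finset.univ.erase j,
      (w j + c j - w i) / (w j + c j - w i - c i)) = topCoeff c w j := by
    rw [topCoeff]
    congr 2
    · ring
    · refine Finset.prod_congr rfl fun i _ => ?_
      rw [sub_sub (w j + (c j : ℂ)) (w i)]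
  rw [h2] at h1
  refine h1.congr' ?_
  filter_upwards [self_mem_nhdsWithin] with z hz
  have hz' : z - w j - c j ≠ 0 := by
    rw [sub_sub]; exact sub_ne_zero.2 hz
  rw [stringKernel, ← Finset.mul_prod_erase _ _ (Finset.mem_univ j)]
  have : z - (w j + (c j : ℂ)) = z - w j - c j := by ring
  rw [this]
  field_simp

theorem differentiableAt_stringKernel {n : ℕ} {c : Fin n → ℕ} {w : Fin n → ℂ} {z : ℂ}
    (hz : ∀ j, z ≠ w j + c j) : DifferentiableAt ℂ (fun z => stringKernel c z w) z := by
  unfold stringKernel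
  refine DifferentiableAt.const_mul (DifferentiableAt.fun_finsetProd fun i _ => ?_) _
  refine DifferentiableAt.div (by fun_prop) (by fun_prop) fun h => hz i ?_
  linear_combination h

theorem differentiableAt_symm_slice {N : ℕ} {α β p C : ℝ} {F : (Fin (N + 1) → ℂ) → ℂ}
    (hF : TubeDecay α β p C F) {v : Fin N → ℂ} (hv : v ∈ tube N α β) {z : ℂ}
    (hz : α < z.re ∧ z.re < β) :
    DifferentiableAt ℂ (fun z => symm (fun u => F (Fin.cons z u)) v) z := by
  unfold symm
  refine DifferentiableAt.fun_sum fun σ _ => DifferentiableAt.const_mul ?_ _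
  have h1 : DifferentiableAt ℂ F (Fin.cons z fun k => v (σ k)) :=
    hF.differentiableOn.differentiableAt ((isOpen_tube _ _ _).mem_nhds
      (cons_mem_tube hz fun k => hv (σ k)))
  refine h1.comp z (f := fun z => (Fin.cons z fun k => v (σ k) : Fin (N + 1) → ℂ)) ?_
  rw [differentiableAt_pi]
  refine Fin.cases ?_ fun i => ?_
  · simp
  · simp

theorem tendsto_one_add_rpow_neg {p : ℝ} (hp : 0 < p) (M : ℝ) :
    Tendsto (fun T : ℝ => M * (1 + T) ^ (-p)) atTop (𝓝 0) := by
  have h := (tendsto_rpow_neg_atTop hp).comp (tendsto_atTop_add_const_left atTop (1 : ℝ) tendsto_id)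
  simpa using h.const_mul M

theorem norm_stringKernel_le_of_im {n : ℕ} {c : Fin n → ℕ} {w : Fin n → ℂ} {z : ℂ}
    (hz : ∀ i, 1 ≤ |z.im - (w i).im|) :
    ‖stringKernel c z w‖ ≤ ‖cauchyD c w‖ * ∏ i, (1 + (c i : ℝ)) := by
  rw [stringKernel, norm_mul, norm_prod]
  refine mul_le_mul_of_nonneg_left ?_ (norm_nonneg _)
  refine Finset.prod_le_prod (fun _ _ => norm_nonneg _) fun i _ => ?_
  have h1 : 1 ≤ ‖z - w i - c i‖ := by
    refine (hz i).trans ?_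
    have := Complex.abs_im_le_norm (z - w i - c i)
    simpa using this
  have hne : z - w i - c i ≠ 0 := norm_pos_iff.1 (by linarith)
  have h2 : (z - w i) / (z - w i - c i) = 1 + c i / (z - w i - c i) := by field_simp; ring
  rw [h2]
  refine (norm_add_le _ _).trans ?_
  rw [norm_one, norm_div, Complex.norm_natCast]
  have := div_le_self (Nat.cast_nonneg (α := ℝ) (c i)) h1
  linarith

/-- With the strings fixed, the symmetrized factor is holomorphic in `z`, and the poles between the
lines are the points `w j + c j`: right of `θ` because `c j > 0`, left of `a` by `hca`. -/
theorem shift_first_variable {N n : ℕ} {α β θ a p C : ℝ} {F : (Fin (N + 1) → ℂ) → ℂ}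
    (hp : 1 < p) (hF : TubeDecay α β p C F) (hα : α < θ) (hβ : θ + ((N : ℝ) - 1) < β)
    (haβ : a < β) {c : Fin n → ℕ} (hc : ∀ i, 0 < c i) (h : ∑ i, c i = N) (hθa : θ ≤ a)
    (hca : ∀ i, θ + c i < a) {y : Fin n → ℝ} (hy : Function.Injective y) :
    (∫ t : ℝ, stringKernel c (a + t * Complex.I) (linePoint (fun _ => θ) y) *
        symmSet N (fun v => F (Fin.cons (a + t * Complex.I) v))
          (stringSet c (linePoint (fun _ => θ) y))) -
      (∫ t : ℝ, stringKernel c (θ + t * Complex.I) (linePoint (fun _ => θ) y) *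
        symmSet N (fun v => F (Fin.cons (θ + t * Complex.I) v))
          (stringSet c (linePoint (fun _ => θ) y))) =
      2 * Real.pi * ∑ j, jthResidue F c (linePoint (fun _ => θ) y) j := by
  set w : Fin n → ℂ := linePoint (fun _ => θ) y with hwdef
  have hw : IntSeparated w := linePoint_intSeparated θ hy
  have hwre : ∀ i, (w i).re = θ := linePoint_re _ _
  set v : Fin N → ℂ := stringVec c h w with hv
  have hvt : v ∈ tube N α β := stringVec_mem_tube hα hβ c h y
  set f : ℂ → ℂ := fun z => stringKernel c z w *
    symmSet N (fun v => F (Fin.cons z v)) (stringSet c w) with hf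
  obtain ⟨K, hK, hKb⟩ := exists_norm_symmSet_le N (p := p) (by linarith) hα hβ
  set x : Fin n → ℂ := fun j => w j + c j with hx
  have hxinj : Function.Injective x := fun i j hij => by
    by_contra hne
    refine hw.sub_ne hne ((c j : ℤ) - c i) ?_
    have : w i + (c i : ℂ) = w j + c j := hij
    push_cast
    linear_combination this
  have hxre : ∀ j, (x j).re = θ + c j := fun j => by simp [hx, hwre]
  set S : Finset ℂ := Finset.univ.image x with hS
  have hmemS : ∀ z, z ∉ S → ∀ j, z ≠ w j + c j := fun z hz j h =>
    hz (Finset.mem_image.2 ⟨j, Finset.mem_univ j, h.symm⟩)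
  have hfd : ∀ z : ℂ, α < z.re ∧ z.re < β → z ∉ S → DifferentiableAt ℂ f z := by
    intro z hz hzS
    simp only [hf, symmSet_stringSet_eq _ c h hw]
    exact (differentiableAt_stringKernel (hmemS z hzS)).mul (differentiableAt_symm_slice hF hvt hz)
  have hsymm : ∀ z : ℂ, α < z.re ∧ z.re < β →
      ‖symmSet N (fun v => F (Fin.cons z v)) (stringSet c w)‖ ≤ K * C * (1 + |z.im|) ^ (-p) := by
    intro z hz
    -- The positions of the strings are fixed, so only the decay in `z` matters and the empty set
    -- suffices.
    have h1 := hKb _ _ (hF.slice hz) n c h ∅ (by simp) y hy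
    rw [Finset.prod_empty, mul_one, ← mul_assoc] at h1
    have hC : 0 ≤ C := hF.nonneg (cons_mem_tube hz hvt)
    exact h1.trans (mul_le_mul_of_nonneg_left (rpow_neg_norm_le_im (by linarith) z)
      (mul_nonneg hK hC))
  have hKC : 0 ≤ K * C := mul_nonneg hK (hF.nonneg (cons_mem_tube (x := (θ : ℂ))
    ⟨by simpa using hα, by rw [Complex.ofReal_re]; linarith⟩ hvt))
  have hline : ∀ b : ℝ, (α < b ∧ b < β) → ∀ t > 0, (∀ i, t ≤ |b - θ - c i|) →
      Integrable fun s : ℝ => f (b + s * Complex.I) := by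
    intro b hb t ht hbt
    have hre : ∀ s : ℝ, ((b : ℂ) + s * Complex.I).re = b := fun s => by simp
    have him : ∀ s : ℝ, ((b : ℂ) + s * Complex.I).im = s := fun s => by simp
    refine ((integrable_one_add_abs_rpow hp).const_mul
      ((n.factorial * ∏ i, (1 + (c i : ℝ) / t)) * (K * C))).mono' ?_ (Eventually.of_forall fun s => ?_)
    · refine Continuous.aestronglyMeasurable (continuous_iff_continuousAt.2 fun s => ?_)
      refine ContinuousAt.comp (f := fun s : ℝ => (b : ℂ) + s * Complex.I)
        (hfd _ (by rw [hre]; exact hb) fun hs => ?_).continuousAt (by fun_prop)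
      obtain ⟨j, _, hj⟩ := Finset.mem_image.1 hs
      have h1 := congrArg Complex.re hj
      rw [hxre, hre] at h1
      have h2 := hbt j
      rw [← h1] at h2
      simp at h2
      linarith
    · simp only [hf]
      rw [norm_mul, mul_assoc]
      refine mul_le_mul (norm_stringKernel_le hc ht y fun i => by rw [hre]; exact hbt i) ?_
        (norm_nonneg _) (by positivity)
      have := hsymm (b + s * Complex.I) (by rw [hre]; exact hb)
      rwa [him] at this
  have hint_θ : Integrable fun s : ℝ => f (θ + s * Complex.I) :=
    hline θ ⟨hα, by linarith⟩ 1 one_pos fun i => by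
      have h1 : (1 : ℝ) ≤ c i := by exact_mod_cast hc i
      rw [sub_self, zero_sub, abs_neg]
      exact h1.trans (le_abs_self _)
  have hint_a : Integrable fun s : ℝ => f (a + s * Complex.I) := by
    obtain ⟨t, ht, hta⟩ : ∃ t > 0, ∀ i, t ≤ |a - θ - c i| := by
      have h1 : ∀ i, ∀ᶠ t in 𝓝[>] (0 : ℝ), t ≤ |a - θ - c i| := fun i =>
        nhdsWithin_le_nhds (Iic_mem_nhds (abs_pos.2 (by linarith [hca i])))
      obtain ⟨t, h2, h3⟩ := ((eventually_all.2 h1).and self_mem_nhdsWithin).exists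
      exact ⟨t, h3, h2⟩
    exact hline a ⟨by linarith, haβ⟩ t ht hta
  have key := integral_vertical_sub_eq_sum_residues hα hθa haβ S (by
      intro s hs
      obtain ⟨j, _, rfl⟩ := Finset.mem_image.1 hs
      rw [hxre]
      have h1 : (0 : ℝ) < c j := by exact_mod_cast hc j
      exact ⟨by linarith, hca j⟩) (f := f)
    (fun z hz => (hfd z hz.1 hz.2).differentiableWithinAt)
    -- The residue formula is indexed by points; since `x` is injective, the sum selects the string
    -- whose pole is `s`.
    (fun s => ∑ j, if x j = s then jthResidue F c w j else 0) (by
      intro s hs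
      obtain ⟨j, _, rfl⟩ := Finset.mem_image.1 hs
      have h1 : ∑ i, (if x i = x j then jthResidue F c w i else 0) = jthResidue F c w j := by
        simp [hxinj.eq_iff]
      rw [h1]
      have h3 : α < (x j).re ∧ (x j).re < β := by
        rw [hxre]
        have h4 : (0 : ℝ) < c j := by exact_mod_cast hc j
        exact ⟨by linarith, by linarith [hca j]⟩
      have h2 : ContinuousAt (fun z => symmSet N (fun v => F (Fin.cons z v)) (stringSet c w))
          (x j) := by
        simp only [symmSet_stringSet_eq _ c h hw]
        exact (differentiableAt_symm_slice hF hvt h3).continuousAt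
      have := (tendsto_sub_mul_stringKernel (c := c) hw j).mul
        (h2.tendsto.mono_left (nhdsWithin_le_nhds (s := {x j}ᶜ)))
      refine this.congr fun z => ?_
      simp only [hf, hx]
      ring) hint_θ hint_a
    (tendsto_one_add_rpow_neg (p := p) (by linarith)
      (‖cauchyD c w‖ * (∏ i, (1 + (c i : ℝ))) * (K * C))) (by
      have hbig : ∀ᶠ T : ℝ in atTop, ∀ i, 1 + |y i| ≤ T :=
        eventually_all.2 fun i => eventually_ge_atTop _
      filter_upwards [hbig] with T hT z hz1 hz2 hz
      simp only [hf]
      rw [norm_mul, mul_assoc _ (K * C), ← hz]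
      refine mul_le_mul (norm_stringKernel_le_of_im fun i => ?_)
        (hsymm z ⟨by linarith, by linarith⟩) (norm_nonneg _) (by positivity)
      rw [hwdef, linePoint_im]
      have := abs_sub_abs_le_abs_sub z.im (y i)
      linarith [hT i])
  rw [key, Finset.sum_image fun i _ j _ hij => hxinj hij]
  congr 1
  refine Finset.sum_congr rfl fun j _ => ?_
  simp [hxinj.eq_iff]

/-! ### Compositions -/

/-- The vectors of `n` positive integers with sum `N`. -/
def comps (n N : ℕ) : Finset (Fin n → ℕ) :=
  (Finset.piAntidiag Finset.univ N).filter fun c => ∀ i, 0 < c i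

theorem mem_comps {n N : ℕ} {c : Fin n → ℕ} : c ∈ comps n N ↔ ∑ i, c i = N ∧ ∀ i, 0 < c i := by
  simp [comps]

theorem comps_zero_succ (N : ℕ) : comps 0 (N + 1) = ∅ :=
  Finset.eq_empty_of_forall_notMem fun c hc => by
    have := (mem_comps.1 hc).1
    simp at this

theorem comps_eq_empty {n N : ℕ} (h : N < n) : comps n N = ∅ :=
  Finset.eq_empty_of_forall_notMem fun c hc => by
    obtain ⟨h1, h2⟩ := mem_comps.1 hc
    have h3 : ∑ _i : Fin n, 1 ≤ ∑ i, c i := Finset.sum_le_sum fun i _ => h2 i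
    simp only [Finset.sum_const, Finset.card_univ, Fintype.card_fin, smul_eq_mul, mul_one] at h3
    omega

theorem sum_comps_comp_perm {n N : ℕ} (g : (Fin n → ℕ) → ℂ) (τ : Equiv.Perm (Fin n)) :
    ∑ c ∈ comps n N, g (fun i => c (τ i)) = ∑ c ∈ comps n N, g c := by
  refine Finset.sum_bij (fun c _ => fun i => c (τ i)) ?_ ?_ ?_ fun _ _ => rfl
  · intro c hc
    obtain ⟨h1, h2⟩ := mem_comps.1 hc
    exact mem_comps.2 ⟨(Equiv.sum_comp τ c).trans h1, fun i => h2 _⟩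
  · intro c _ d _ h
    funext i
    have := congrFun h (τ.symm i)
    simpa using this
  · intro c hc
    obtain ⟨h1, h2⟩ := mem_comps.1 hc
    exact ⟨fun i => c (τ.symm i), mem_comps.2 ⟨(Equiv.sum_comp τ.symm c).trans h1, fun i => h2 _⟩,
      by simp⟩

theorem sum_comps_succ {n M : ℕ} (g : (Fin (n + 1) → ℕ) → ℂ) :
    ∑ c ∈ comps (n + 1) (M + 1), g c =
      ∑ m ∈ Finset.range (M + 1), ∑ c ∈ comps n (M - m), g (Fin.cons (m + 1) c) := by
  rw [Finset.sum_sigma']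
  refine (Finset.sum_bij (fun (x : (_ : ℕ) × (Fin n → ℕ)) _ => Fin.cons (x.1 + 1) x.2)
    ?_ ?_ ?_ fun _ _ => rfl).symm
  · rintro ⟨m, c⟩ hx
    rw [Finset.mem_sigma, Finset.mem_range, mem_comps] at hx
    obtain ⟨h1, h2, h3⟩ := hx
    refine mem_comps.2 ⟨?_, Fin.cases (Nat.succ_pos _) h3⟩
    rw [Fin.sum_cons]
    simp only at h1 h2 ⊢
    omega
  · rintro ⟨m, c⟩ _ ⟨m', c'⟩ _ h
    have h1 := congrFun h 0
    have h2 : c = c' := by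
      funext i
      have := congrFun h i.succ
      simpa using this
    simp at h1
    rw [h1, h2]
  · intro c hc
    obtain ⟨h1, h2⟩ := mem_comps.1 hc
    rw [Fin.sum_univ_succ] at h1
    have h3 := h2 0
    refine ⟨⟨c 0 - 1, Fin.tail c⟩, ?_, ?_⟩
    · rw [Finset.mem_sigma, Finset.mem_range, mem_comps]
      have h4 : ∑ i, Fin.tail c i = ∑ i : Fin n, c i.succ := rfl
      refine ⟨by simp only; omega, by simp only; omega, fun i => h2 _⟩
    · simp only
      rw [Nat.sub_add_cancel h3, Fin.cons_self_tail]

/-- The set of compositions is invariant under permutations, so all `n + 1` positions contribute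
equally. -/
theorem sum_comps_sum_swap {n N : ℕ} (g : (Fin (n + 1) → ℕ) → ℂ) :
    ∑ c ∈ comps (n + 1) N, ∑ j, g (fun i => c (Equiv.swap 0 j i)) =
      ((n + 1 : ℕ) : ℂ) * ∑ c ∈ comps (n + 1) N, g c := by
  rw [Finset.sum_comm]
  simp_rw [sum_comps_comp_perm]
  simp

/-! ### The first variable of the nested integral -/

theorem nestedIntegrand_cons {N : ℕ} (F : (Fin (N + 1) → ℂ) → ℂ) (z : ℂ) (v : Fin N → ℂ) :
    nestedIntegrand F (Fin.cons z v) =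
      nestedIntegrand (fun u => (∏ j, (z - u j) / (z - u j - 1)) * F (Fin.cons z u)) v := by
  unfold nestedIntegrand
  rw [Fin.prod_univ_succ, Fin.prod_Ioi_zero]
  simp only [Fin.prod_Ioi_succ, Fin.cons_zero, Fin.cons_succ]
  ring

theorem norm_div_sub_one_le {u v : ℂ} {t : ℝ} (ht : 0 < t) (h : t ≤ u.re - v.re - 1) :
    ‖(u - v) / (u - v - 1)‖ ≤ 1 + 1 / t := by
  have := norm_div_sub_le (u := u - v) (c := 1) ht (by
    rw [Complex.sub_re, Nat.cast_one]
    exact h.trans (le_abs_self _))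
  simpa using this

/-- The poles `u j = x - 1` lie outside the narrower tube, at distance at least `x.re - 1 - β'`. -/
theorem TubeDecay.slice_interaction {N : ℕ} {α β β' p C : ℝ} {F : (Fin (N + 1) → ℂ) → ℂ}
    (hF : TubeDecay α β p C F) {x : ℂ} (hx : α < x.re ∧ x.re < β) (hβ' : β' < x.re - 1) :
    TubeDecay α β' p ((1 + 1 / (x.re - 1 - β')) ^ N * (C * (1 + ‖x‖) ^ (-p)))
      fun u : Fin N → ℂ => (∏ j, (x - u j) / (x - u j - 1)) * F (Fin.cons x u) where
  differentiableOn := by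
    have hsub : tube N α β' ⊆ tube N α β := fun v hv k => ⟨(hv k).1, by linarith [(hv k).2, hx.2]⟩
    have h1 : ∀ j : Fin N, DifferentiableOn ℂ
        (fun u : Fin N → ℂ => (x - u j) / (x - u j - 1)) (tube N α β') := fun j => by
      simp_rw [div_eq_mul_inv]
      refine DifferentiableOn.mul (by fun_prop) (DifferentiableOn.inv (by fun_prop) fun u hu => ?_)
      exact sub_sub_one_ne_zero (by linarith [(hu j).2])
    have h2 : DifferentiableOn ℂ (fun u : Fin N → ℂ => ∏ j, (x - u j) / (x - u j - 1))
        (tube N α β') := fun u hu =>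
      (HasFDerivWithinAt.finsetProd fun j _ => (h1 j u hu).hasFDerivWithinAt).differentiableWithinAt
    exact h2.mul ((hF.slice hx).differentiableOn.mono hsub)
  bound := fun u hu => by
    have hsub : u ∈ tube N α β := fun k => ⟨(hu k).1, by linarith [(hu k).2, hx.2]⟩
    rw [norm_mul, mul_assoc]
    have ht : 0 < x.re - 1 - β' := by linarith
    refine mul_le_mul ?_ ((hF.slice hx).bound u hsub) (norm_nonneg _) (by positivity)
    rw [norm_prod]
    refine (Finset.prod_le_prod (fun _ _ => norm_nonneg _) fun j _ =>
      norm_div_sub_one_le (u := x) (v := u j) ht (by linarith [(hu j).2])).trans ?_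
    rw [Finset.prod_const, Finset.card_univ, Fintype.card_fin]

/-- Moving the first contour to the right only increases `Re (z 0 - z j)`, which already exceeds
`1`; no pole is met. -/
theorem integral_nested_shift_first {N : ℕ} {α β p C b : ℝ} {F : (Fin (N + 1) → ℂ) → ℂ}
    (hp : 1 < p) (hF : TubeDecay α β p C F) {a : Fin (N + 1) → ℝ}
    (ha : ∀ i j, i < j → 1 < a i - a j) (haαβ : ∀ k, α < a k ∧ a k < β) (hab : a 0 ≤ b)
    (hb : b < β) :
    ∫ y, nestedIntegrand F (linePoint a y) =
      ∫ y, nestedIntegrand F (linePoint (Fin.cons b (Fin.tail a)) y) := by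
  have hconsa : ∀ (c : ℝ) (i j : Fin (N + 1)), a 0 ≤ c → i < j →
      1 < (Fin.cons c (Fin.tail a) : Fin (N + 1) → ℝ) i -
        (Fin.cons c (Fin.tail a) : Fin (N + 1) → ℝ) j := by
    intro c i j hc hij
    obtain ⟨j, rfl⟩ := Fin.exists_succ_eq_of_ne_zero (Fin.ne_zero_of_lt hij)
    rw [Fin.cons_succ]
    refine Fin.cases (fun hij => ?_) (fun i hij => ?_) i hij
    · rw [Fin.cons_zero]
      have := ha _ _ hij
      rw [Fin.tail]; linarith
    · exact ha _ _ hij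
  have hconsαβ : ∀ (c : ℝ), α < c → c < β → ∀ k,
      α < (Fin.cons c (Fin.tail a) : Fin (N + 1) → ℝ) k ∧
        (Fin.cons c (Fin.tail a) : Fin (N + 1) → ℝ) k < β :=
    fun c h1 h2 => Fin.cases ⟨h1, h2⟩ fun i => haαβ i.succ
  have hαb : α < b := (haαβ 0).1.trans_le hab
  rw [integral_cons_symm_eq (integrable_nestedIntegrand hp hF ha haαβ),
    integral_cons_symm_eq (integrable_nestedIntegrand hp hF (fun i j => hconsa b i j hab)
      (hconsαβ b hαb hb))]
  congr 1
  funext y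
  set v : Fin N → ℂ := linePoint (Fin.tail a) y with hv
  have hvt : v ∈ tube N α β := linePoint_mem_tube (fun k => haαβ k.succ) y
  have hvre : ∀ k, (v k).re = a k.succ := fun k => linePoint_re _ _ k
  have e1 : ∀ t : ℝ, linePoint a (Fin.cons t y) = Fin.cons ((a 0 : ℂ) + t * Complex.I) v :=
    fun t => linePoint_cons a t y
  have e2 : ∀ t : ℝ, linePoint (Fin.cons b (Fin.tail a)) (Fin.cons t y) =
      Fin.cons ((b : ℂ) + t * Complex.I) v := fun t => by
    rw [linePoint_cons, Fin.cons_zero, Fin.tail_cons]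
  simp_rw [e1, e2]
  set P : ℝ := ‖∏ i : Fin N, ∏ j ∈ Finset.Ioi i, (v i - v j) / (v i - v j - 1)‖ with hP
  set Q : ℝ := ∏ j : Fin N, (1 + 1 / (a 0 - a j.succ - 1)) with hQ
  have hC : 0 ≤ C := hF.nonneg (linePoint_mem_tube haαβ 0)
  have hd : ∀ z : ℂ, a 0 ≤ z.re → z.re ≤ b →
      DifferentiableAt ℂ (fun z => nestedIntegrand F (Fin.cons z v)) z := by
    intro z h1 h2
    simp_rw [nestedIntegrand_cons, nestedIntegrand]
    refine DifferentiableAt.const_mul (DifferentiableAt.mul ?_ ?_) _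
    · refine DifferentiableAt.fun_finsetProd fun j _ => ?_
      refine DifferentiableAt.div (by fun_prop) (by fun_prop) (sub_sub_one_ne_zero ?_)
      have := ha 0 j.succ (Fin.succ_pos j)
      rw [hvre]; linarith
    · have h3 : DifferentiableAt ℂ F (Fin.cons z v) :=
        hF.differentiableOn.differentiableAt ((isOpen_tube _ _ _).mem_nhds
          (cons_mem_tube ⟨by linarith [(haαβ 0).1], by linarith⟩ hvt))
      refine h3.comp z (f := fun z => (Fin.cons z v : Fin (N + 1) → ℂ)) ?_
      rw [differentiableAt_pi]
      refine Fin.cases ?_ fun i => ?_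
      · simp
      · simp
  have hbound : ∀ z : ℂ, a 0 ≤ z.re → z.re ≤ b →
      ‖nestedIntegrand F (Fin.cons z v)‖ ≤ P * (Q * (C * decay p v)) * (1 + |z.im|) ^ (-p) := by
    intro z h1 h2
    rw [nestedIntegrand_cons, nestedIntegrand, norm_mul, norm_mul, mul_assoc, mul_assoc]
    refine mul_le_mul_of_nonneg_left ?_ (norm_nonneg _)
    have ht : ∀ j : Fin N, 0 < a 0 - a j.succ - 1 := fun j => by
      have := ha 0 j.succ (Fin.succ_pos j)
      linarith
    have hQ0 : 0 ≤ Q := Finset.prod_nonneg fun j _ => by have := ht j; positivity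
    refine mul_le_mul ?_ ?_ (norm_nonneg _) hQ0
    · rw [norm_prod]
      refine Finset.prod_le_prod (fun _ _ => norm_nonneg _) fun j _ =>
        norm_div_sub_one_le (ht j) ?_
      rw [hvre]; linarith
    · refine (hF.bound _ (cons_mem_tube ⟨by linarith [(haαβ 0).1], by linarith⟩ hvt)).trans ?_
      rw [decay_cons, mul_assoc, mul_comm (decay p v)]
      have := rpow_neg_norm_le_im (p := p) (by linarith) z
      have h0 := (decay_pos p v).le
      gcongr
  have hline : ∀ c : ℝ, a 0 ≤ c → c ≤ b →
      Integrable fun t : ℝ => nestedIntegrand F (Fin.cons ((c : ℂ) + t * Complex.I) v) := by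
    intro c h1 h2
    refine ((integrable_one_add_abs_rpow hp).const_mul (P * (Q * (C * decay p v)))).mono'
      (Continuous.aestronglyMeasurable (continuous_iff_continuousAt.2 fun t => ?_))
      (Eventually.of_forall fun t => ?_)
    · exact ContinuousAt.comp (f := fun t : ℝ => (c : ℂ) + t * Complex.I)
        (hd _ (by simpa using h1) (by simpa using h2)).continuousAt (by fun_prop)
    · have := hbound (c + t * Complex.I) (by simpa using h1) (by simpa using h2)
      simpa using this
  refine integral_vertical_eq hab (f := fun z => nestedIntegrand F (Fin.cons z v))
    (fun z hz => (hd z hz.1 hz.2).differentiableWithinAt) (hline _ le_rfl hab) (hline _ hab le_rfl)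
    (tendsto_one_add_rpow_neg (p := p) (by linarith) (P * (Q * (C * decay p v))))
    (Eventually.of_forall fun T z h1 h2 h3 => ?_)
  rw [← h3]
  exact hbound z h1 h2

/-! ### The expansion of the nested integral over compositions -/

/-- The factor `dzₖ/(2πi)` relative to `dyₖ`. -/
def lineConst : ℂ := Complex.I / (2 * (Real.pi : ℂ) * Complex.I)

theorem lineConst_mul : lineConst * (2 * Real.pi) = 1 := by
  have h1 : (Real.pi : ℂ) ≠ 0 := by exact_mod_cast Real.pi_ne_zero
  have h2 := Complex.I_ne_zero
  rw [lineConst]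
  field_simp

theorem lineIntegral_eq {n : ℕ} (a : Fin n → ℝ) (f : (Fin n → ℂ) → ℂ) :
    lineIntegral a f = lineConst ^ n * ∫ y : Fin n → ℝ, f (linePoint a y) := by
  rw [lineIntegral, integral_mul_const, mul_comm]
  rfl

/-- The one-variable residue identity integrated over the strings. Since `c i ≤ N`, the condition `θ
+ N < a` puts every pole to the left of the line `a`. -/
theorem integral_topTerm_zero_shift {N n : ℕ} {α β θ a p C : ℝ} {F : (Fin (N + 1) → ℂ) → ℂ}
    (hp : 1 < p) (hF : TubeDecay α β p C F) (hα : α < θ) (hβ : θ + (N : ℝ) < β)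
    (hθa : θ + N < a) (haβ : a < β) {c : Fin n → ℕ} (hc : c ∈ comps n N) :
    (Integrable fun y : Fin (n + 1) → ℝ => topTerm F 0 c (linePoint (Fin.cons a fun _ => θ) y)) ∧
    ∫ y : Fin (n + 1) → ℝ, topTerm F 0 c (linePoint (Fin.cons a fun _ => θ) y) =
      topIntegral θ F 0 c +
        2 * Real.pi * ∑ j, ∫ y : Fin n → ℝ, jthResidue F c (linePoint (fun _ => θ) y) j := by
  obtain ⟨hsum, hpos⟩ := mem_comps.1 hc
  have hN0 : (0 : ℝ) ≤ N := Nat.cast_nonneg N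
  have hca : ∀ i, θ + c i < a := fun i => by
    have h1 : c i ≤ N := hsum ▸ Finset.single_le_sum (fun _ _ => Nat.zero_le _) (Finset.mem_univ i)
    have h2 : (c i : ℝ) ≤ N := by exact_mod_cast h1
    linarith
  have hA : Integrable fun y : Fin (n + 1) → ℝ =>
      topTerm F 0 c (linePoint (Fin.cons a fun _ => θ) y) := by
    refine integrable_topTerm_zero hp hF hα (by linarith) ⟨by linarith, haβ⟩ hpos hsum
      (t := a - (θ + N)) (by linarith) fun i => ?_
    have h1 : c i ≤ N := hsum ▸ Finset.single_le_sum (fun _ _ => Nat.zero_le _) (Finset.mem_univ i)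
    have h2 : (c i : ℝ) ≤ N := by exact_mod_cast h1
    exact le_trans (by linarith) (le_abs_self _)
  have hB : Integrable fun y : Fin (n + 1) → ℝ => topTerm F 0 c (linePoint (fun _ => θ) y) :=
    integrable_topTerm hp hF hα hβ hpos (by rw [zero_add]; exact hsum)
  have hR : ∀ j, Integrable fun y : Fin n → ℝ => jthResidue F c (linePoint (fun _ => θ) y) j := by
    intro j
    cases n with
    | zero => exact j.elim0
    | succ n => exact (integral_jthResidue hp hF hα hβ hpos hsum j).1
  refine ⟨hA, ?_⟩
  have eA : ∀ (t : ℝ) (y : Fin n → ℝ),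
      topTerm F 0 c (linePoint (Fin.cons a fun _ => θ) (Fin.cons t y)) =
        stringKernel c (a + t * Complex.I) (linePoint (fun _ => θ) y) *
          symmSet N (fun v => F (Fin.cons (a + t * Complex.I) v))
            (stringSet c (linePoint (fun _ => θ) y)) := by
    intro t y
    rw [linePoint_cons, topTerm_zero, Fin.cons_zero, Fin.tail_cons, Fin.tail_cons, Fin.cons_zero]
  have eB : ∀ (t : ℝ) (y : Fin n → ℝ),
      topTerm F 0 c (linePoint (fun _ => θ) (Fin.cons t y)) =
        stringKernel c (θ + t * Complex.I) (linePoint (fun _ => θ) y) *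
          symmSet N (fun v => F (Fin.cons (θ + t * Complex.I) v))
            (stringSet c (linePoint (fun _ => θ) y)) := by
    intro t y
    rw [linePoint_cons, topTerm_zero, Fin.cons_zero, Fin.tail_cons]
    rfl
  have hBi : Integrable fun y : Fin n → ℝ =>
      ∫ t : ℝ, topTerm F 0 c (linePoint (fun _ => θ) (Fin.cons t y)) :=
    (integrable_cons hB).integral_prod_right
  rw [topIntegral, integral_cons_symm_eq hA, integral_cons_symm_eq hB,
    ← integral_finsetSum _ fun j _ => hR j, ← integral_const_mul,
    ← integral_add hBi ((integrable_finsetSum _ fun j _ => hR j).const_mul _)]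
  refine integral_congr_ae ?_
  filter_upwards [ae_injective n] with y hy
  have := shift_first_variable hp hF hα (by linarith) haβ hpos hsum (by linarith) hca hy
  simp_rw [eA, eB]
  rw [← this]
  ring

/-- The symmetric interaction leaves the symmetrization and telescopes into the product in
`stringKernel`; `θ + N < Re z` keeps all denominators nonzero. -/
theorem stringTerm_slice_interaction {N n : ℕ} (F : (Fin (N + 1) → ℂ) → ℂ) {θ : ℝ} {z : ℂ}
    (hz : θ + N < z.re) {c : Fin n → ℕ} (hc : ∑ i, c i = N) {y : Fin n → ℝ}
    (hy : Function.Injective y) :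
    stringTerm (fun u : Fin N → ℂ => (∏ j, (z - u j) / (z - u j - 1)) * F (Fin.cons z u)) c
      (linePoint (fun _ => θ) y) = topTerm F 0 c (Fin.cons z (linePoint (fun _ => θ) y)) := by
  have hw := linePoint_intSeparated θ hy
  have hne : ∀ i, ∀ s : ℕ, s ≤ c i → z - linePoint (fun _ => θ) y i - s ≠ 0 := by
    intro i s hs h0
    have h1 := congrArg Complex.re h0
    simp only [Complex.sub_re, linePoint_re, Complex.natCast_re, Complex.zero_re] at h1
    have h2 : c i ≤ N := hc ▸ Finset.single_le_sum (fun _ _ => Nat.zero_le _) (Finset.mem_univ i)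
    have h3 : (s : ℝ) ≤ N := by exact_mod_cast hs.trans h2
    linarith
  rw [topTerm_zero, Fin.cons_zero, Fin.tail_cons, stringTerm, stringKernel,
    symmSet_prod_mul (fun x => (z - x) / (z - x - 1)) N (fun u => F (Fin.cons z u))
      (by rw [card_stringSet hw, hc]), prod_stringSet_div hw c hne, mul_assoc]

/-- Split according to whether the first string has length one (a new string) or at least two (a
string lengthened by one point). -/
theorem sum_comps_topIntegral {N n : ℕ} (θ : ℝ) (F : (Fin (N + 1) → ℂ) → ℂ) :
    ∑ c ∈ comps (n + 1) (N + 1), topIntegral θ F (c 0 - 1) (Fin.tail c) =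
      ∑ c ∈ comps n N, topIntegral θ F 0 c +
        ∑ c ∈ comps (n + 1) N, topIntegral θ F (c 0) (Fin.tail c) := by
  rw [sum_comps_succ, Finset.sum_range_succ']
  simp only [Fin.cons_zero, Fin.tail_cons, Nat.add_sub_cancel, Nat.sub_zero, zero_add]
  rw [add_comm]
  congr 1
  cases N with
  | zero =>
    rw [comps_eq_empty (Nat.succ_pos n)]
    simp
  | succ N =>
    rw [sum_comps_succ]
    refine Finset.sum_congr rfl fun m _ => ?_
    rw [Nat.succ_sub_succ]
    simp

theorem sum_comps_succ_stringTerm {N : ℕ} {α β θ p C : ℝ} {F : (Fin (N + 1) → ℂ) → ℂ}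
    (hp : 1 < p) (hF : TubeDecay α β p C F) (hα : α < θ) (hβ : θ + (N : ℝ) < β) (n : ℕ) :
    ∑ c ∈ comps (n + 1) (N + 1),
        ∫ y : Fin (n + 1) → ℝ, stringTerm F c (linePoint (fun _ => θ) y) =
      ((n + 1 : ℕ) : ℂ) *
        ∑ c ∈ comps (n + 1) (N + 1), topIntegral θ F (c 0 - 1) (Fin.tail c) := by
  rw [← sum_comps_sum_swap fun c => topIntegral θ F (c 0 - 1) (Fin.tail c)]
  refine Finset.sum_congr rfl fun c hc => ?_
  obtain ⟨h1, h2⟩ := mem_comps.1 hc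
  exact integral_stringTerm hp hF hα hβ h2 h1

theorem sum_comps_succ_residue {N : ℕ} {α β θ p C : ℝ} {F : (Fin (N + 1) → ℂ) → ℂ}
    (hp : 1 < p) (hF : TubeDecay α β p C F) (hα : α < θ) (hβ : θ + (N : ℝ) < β) (n : ℕ) :
    ∑ c ∈ comps (n + 1) N, ∑ j,
        ∫ y : Fin (n + 1) → ℝ, jthResidue F c (linePoint (fun _ => θ) y) j =
      ((n + 1 : ℕ) : ℂ) *
        ∑ c ∈ comps (n + 1) N, topIntegral θ F (c 0) (Fin.tail c) := by
  rw [← sum_comps_sum_swap fun c => topIntegral θ F (c 0) (Fin.tail c)]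
  refine Finset.sum_congr rfl fun c hc => Finset.sum_congr rfl fun j _ => ?_
  obtain ⟨h1, h2⟩ := mem_comps.1 hc
  exact (integral_jthResidue hp hF hα hβ h2 h1 j).2

theorem inv_factorial_succ_mul (n : ℕ) (x : ℂ) :
    (((n + 1).factorial : ℕ) : ℂ)⁻¹ * (((n + 1 : ℕ) : ℂ) * x) = ((n.factorial : ℕ) : ℂ)⁻¹ * x := by
  have h1 : ((n + 1 : ℕ) : ℂ) ≠ 0 := by exact_mod_cast n.succ_ne_zero
  have h2 : ((n.factorial : ℕ) : ℂ) ≠ 0 := by exact_mod_cast n.factorial_ne_zero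
  rw [Nat.factorial_succ, Nat.cast_mul]
  field_simp

/-- The contributions of the strings for `N + 1` variables, from those for `N` variables. -/
theorem sum_comps_recursion {N : ℕ} {α β θ p C : ℝ} {F : (Fin (N + 1) → ℂ) → ℂ}
    (hp : 1 < p) (hF : TubeDecay α β p C F) (hα : α < θ) (hβ : θ + (N : ℝ) < β) :
    ∑ n ∈ Finset.range (N + 2), ((n.factorial : ℕ) : ℂ)⁻¹ * ∑ c ∈ comps n (N + 1),
        lineIntegral (fun _ => θ) (stringTerm F c) =
      ∑ n ∈ Finset.range (N + 1), ((n.factorial : ℕ) : ℂ)⁻¹ * ∑ c ∈ comps n N,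
        lineConst ^ (n + 1) * (topIntegral θ F 0 c + 2 * Real.pi * ∑ j,
          ∫ y : Fin n → ℝ, jthResidue F c (linePoint (fun _ => θ) y) j) := by
  -- `A` collects the terms in which the first variable starts a new string, `B` those in which it
  -- joins an existing one.
  set A : ℕ → ℂ := fun n => ((n.factorial : ℕ) : ℂ)⁻¹ *
    (lineConst ^ (n + 1) * ∑ c ∈ comps n N, topIntegral θ F 0 c) with hA
  set B : ℕ → ℂ := fun n => ((n.factorial : ℕ) : ℂ)⁻¹ *
    (lineConst ^ (n + 1) * ∑ c ∈ comps (n + 1) N, topIntegral θ F (c 0) (Fin.tail c)) with hB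
  have hL : ∑ n ∈ Finset.range (N + 2), ((n.factorial : ℕ) : ℂ)⁻¹ * ∑ c ∈ comps n (N + 1),
        lineIntegral (fun _ => θ) (stringTerm F c) = ∑ n ∈ Finset.range (N + 1), (A n + B n) := by
    rw [Finset.sum_range_succ', comps_zero_succ, Finset.sum_empty, mul_zero, add_zero]
    refine Finset.sum_congr rfl fun n _ => ?_
    simp_rw [lineIntegral_eq]
    rw [← Finset.mul_sum, sum_comps_succ_stringTerm hp hF hα hβ, mul_left_comm (lineConst ^ (n + 1)),
      inv_factorial_succ_mul, sum_comps_topIntegral]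
    simp only [hA, hB]
    ring
  have hR : ∀ n ∈ Finset.range (N + 1), ((n.factorial : ℕ) : ℂ)⁻¹ * ∑ c ∈ comps n N,
        lineConst ^ (n + 1) * (topIntegral θ F 0 c + 2 * Real.pi * ∑ j,
          ∫ y : Fin n → ℝ, jthResidue F c (linePoint (fun _ => θ) y) j) =
      A n + ((n.factorial : ℕ) : ℂ)⁻¹ * (lineConst ^ n * ∑ c ∈ comps n N, ∑ j,
          ∫ y : Fin n → ℝ, jthResidue F c (linePoint (fun _ => θ) y) j) := by
    intro n _
    rw [← Finset.mul_sum, Finset.sum_add_distrib, ← Finset.mul_sum]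
    simp only [hA]
    rw [pow_succ]
    -- A residue integrates out one variable, and its factor `2π` cancels one `lineConst`.
    linear_combination (((n.factorial : ℕ) : ℂ)⁻¹ * lineConst ^ n * ∑ c ∈ comps n N, ∑ j,
          ∫ y : Fin n → ℝ, jthResidue F c (linePoint (fun _ => θ) y) j) * lineConst_mul
  rw [hL, Finset.sum_congr rfl hR, Finset.sum_add_distrib, Finset.sum_add_distrib]
  congr 1
  -- The residue sums are indexed one step later than `B`: there is no residue for `n = 0`, and `B N
  -- = 0` because `N + 1` positive parts cannot sum to `N`.
  rw [Finset.sum_range_succ, Finset.sum_range_succ']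
  have h0 : B N = 0 := by
    simp only [hB]
    rw [comps_eq_empty (Nat.lt_succ_self N)]
    simp
  rw [h0]
  simp only [Finset.univ_eq_empty, Finset.sum_empty, Finset.sum_const_zero, mul_zero]
  congr 1
  refine Finset.sum_congr rfl fun n _ => ?_
  rw [sum_comps_succ_residue hp hF hα hβ, mul_left_comm (lineConst ^ (n + 1)),
    inv_factorial_succ_mul]

theorem lineIntegral_nestedIntegrand_zero {θ : ℝ} (a : Fin 0 → ℝ) (F : (Fin 0 → ℂ) → ℂ) :
    lineIntegral a (nestedIntegrand F) =
      ∑ n ∈ Finset.range 1, ((n.factorial : ℕ) : ℂ)⁻¹ * ∑ c ∈ comps n 0,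
        lineIntegral (fun _ => θ) (stringTerm F c) := by
  have h0 : comps 0 0 = {fun i => i.elim0} := by
    ext c
    simp only [mem_comps, Finset.mem_singleton]
    exact ⟨fun _ => Subsingleton.elim _ _, fun _ => ⟨by simp, fun i => i.elim0⟩⟩
  rw [Finset.sum_range_one, h0, Finset.sum_singleton, Nat.factorial_zero, Nat.cast_one, inv_one,
    one_mul, lineIntegral_eq, lineIntegral_eq]
  congr 2
  funext y
  simp only [nestedIntegrand, stringTerm, cauchyD, symmSet, Matrix.det_fin_zero,
    Finset.univ_eq_empty, Finset.prod_empty, one_mul]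
  congr 1
  exact Subsingleton.elim _ _

/-- The tube and the decay constants are quantified inside the induction because the hypothesis is
applied to slices of `F`, multiplied by interactions, on a narrower tube. -/
theorem lineIntegral_nestedIntegrand_eq (N : ℕ) : ∀ (a : Fin N → ℝ) (θ α β p C : ℝ)
    (F : (Fin N → ℂ) → ℂ), 1 < p → TubeDecay α β p C F → (∀ i j, i < j → 1 < a i - a j) →
    (∀ k, α < a k ∧ a k < β) → α < θ → θ + ((N : ℝ) - 1) < β →
    lineIntegral a (nestedIntegrand F) =
      ∑ n ∈ Finset.range (N + 1), ((n.factorial : ℕ) : ℂ)⁻¹ * ∑ c ∈ comps n N,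
        lineIntegral (fun _ => θ) (stringTerm F c) := by
  induction N with
  | zero => exact fun a θ α β p C F _ _ _ _ _ _ => lineIntegral_nestedIntegrand_zero a F
  | succ N ih =>
    intro a θ α β p C F hp hF ha haαβ hα hβ
    have hβN : θ + (N : ℝ) < β := by push_cast at hβ; linarith
    -- Right of `a 0`, the first contour moves to `b` freely; right of `θ + N`, it has all later
    -- poles on its left.
    obtain ⟨b, hb1, hbβ⟩ : ∃ b, max (a 0) (θ + N) < b ∧ b < β :=
      exists_between (max_lt (haαβ 0).2 hβN)
    have hab : a 0 < b := (le_max_left _ _).trans_lt hb1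
    have hθb : θ + N < b := (le_max_right _ _).trans_lt hb1
    have hαb : α < b := (haαβ 0).1.trans hab
    set a' : Fin (N + 1) → ℝ := Fin.cons b (Fin.tail a) with ha'
    have ha'gap : ∀ i j, i < j → 1 < a' i - a' j := by
      intro i j hij
      obtain ⟨j, rfl⟩ := Fin.exists_succ_eq_of_ne_zero (Fin.ne_zero_of_lt hij)
      simp only [ha', Fin.cons_succ]
      refine Fin.cases (fun hij => ?_) (fun i hij => ?_) i hij
      · rw [Fin.cons_zero]
        have := ha _ _ hij
        rw [Fin.tail]; linarith
      · exact ha _ _ hij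
    have ha'αβ : ∀ k, α < a' k ∧ a' k < β := Fin.cases ⟨hαb, hbβ⟩ fun i => haαβ i.succ
    -- The new tube must stop before the poles at real part `b - 1`, yet contain the other contours
    -- and all strings; this is possible since `a k.succ < a 0 - 1 < b - 1` and `θ + N - 1 < b - 1`.
    obtain ⟨β', hβ'b, hβ'θ, hβ'a⟩ : ∃ β', β' < b - 1 ∧ θ + ((N : ℝ) - 1) < β' ∧
        ∀ k : Fin N, a k.succ < β' := by
      have h1 : ∀ᶠ x in 𝓝[<] (b - 1), θ + ((N : ℝ) - 1) < x :=
        nhdsWithin_le_nhds (Ioi_mem_nhds (by linarith))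
      have h2 : ∀ᶠ x in 𝓝[<] (b - 1), ∀ k : Fin N, a k.succ < x := by
        refine eventually_all.2 fun k => nhdsWithin_le_nhds (Ioi_mem_nhds ?_)
        have := ha 0 k.succ (Fin.succ_pos k)
        linarith
      obtain ⟨x, ⟨h3, h4⟩, h5⟩ := ((h1.and h2).and self_mem_nhdsWithin).exists
      exact ⟨x, h5, h3, h4⟩
    have hnest := integrable_nestedIntegrand hp hF ha'gap ha'αβ
    set G : ℂ → (Fin N → ℂ) → ℂ := fun z u =>
      (∏ j, (z - u j) / (z - u j - 1)) * F (Fin.cons z u) with hG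
    have hre : ∀ t : ℝ, ((b : ℂ) + t * Complex.I).re = b := fun t => by simp
    have hGd : ∀ t : ℝ, TubeDecay α β' p _ (G (b + t * Complex.I)) := fun t =>
      hF.slice_interaction (x := b + t * Complex.I) (by rw [hre]; exact ⟨hαb, hbβ⟩)
        (by rw [hre]; exact hβ'b)
    have hIH : ∀ t : ℝ, lineIntegral (Fin.tail a) (nestedIntegrand (G (b + t * Complex.I))) =
        ∑ n ∈ Finset.range (N + 1), ((n.factorial : ℕ) : ℂ)⁻¹ * ∑ c ∈ comps n N,
          lineConst ^ n * ∫ y : Fin n → ℝ,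
            topTerm F 0 c (linePoint (Fin.cons b fun _ => θ) (Fin.cons t y)) := by
      intro t
      rw [ih (Fin.tail a) θ α β' p _ _ hp (hGd t) (fun i j hij => ha _ _ (Fin.succ_lt_succ_iff.2 hij))
        (fun k => ⟨(haαβ k.succ).1, hβ'a k⟩) hα hβ'θ]
      refine Finset.sum_congr rfl fun n _ => ?_
      congr 1
      refine Finset.sum_congr rfl fun c hc => ?_
      rw [lineIntegral_eq]
      congr 1
      refine integral_congr_ae ?_
      filter_upwards [ae_injective n] with y hy
      rw [stringTerm_slice_interaction F (by rw [hre]; exact hθb) (mem_comps.1 hc).1 hy,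
        linePoint_cons, Fin.cons_zero, Fin.tail_cons]
    have hshift : ∀ n, ∀ c ∈ comps n N, _ := fun n c hc =>
      integral_topTerm_zero_shift (n := n) hp hF hα hβN hθb hbβ hc
    have hinner : ∀ n, ∀ c ∈ comps n N, Integrable fun t : ℝ => ∫ y : Fin n → ℝ,
        topTerm F 0 c (linePoint (Fin.cons b fun _ => θ) (Fin.cons t y)) := fun n c hc =>
      (integrable_cons (hshift n c hc).1).integral_prod_left
    -- The first variable is integrated last here, so the induction hypothesis applies at each fixed
    -- value of it; contour shifts use the opposite order.
    have hsplit : lineIntegral a (nestedIntegrand F) = lineConst * ∫ t : ℝ,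
        lineIntegral (Fin.tail a) (nestedIntegrand (G (b + t * Complex.I))) := by
      rw [lineIntegral_eq, integral_nested_shift_first hp hF ha haαβ hab.le hbβ,
        integral_cons_eq hnest, pow_succ', mul_assoc, ← integral_const_mul]
      congr 2
      funext t
      rw [lineIntegral_eq]
      congr 2
      funext y
      rw [linePoint_cons, nestedIntegrand_cons]
      rfl
    rw [hsplit, sum_comps_recursion hp hF hα hβN]
    simp_rw [hIH]
    rw [integral_finsetSum _ fun n _ => ((integrable_finsetSum _ fun c hc =>
      (hinner n c hc).const_mul _).const_mul _), Finset.mul_sum]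
    refine Finset.sum_congr rfl fun n _ => ?_
    rw [integral_const_mul, integral_finsetSum _ fun c hc => (hinner n c hc).const_mul _,
      mul_left_comm, Finset.mul_sum]
    congr 1
    refine Finset.sum_congr rfl fun c hc => ?_
    rw [integral_const_mul, ← integral_cons_eq (hshift n c hc).1, (hshift n c hc).2]
    ring

/-! ### Compositions and partitions -/

/-- The multiset of the values of a vector. -/
def values {n : ℕ} (c : Fin n → ℕ) : Multiset ℕ := (Finset.univ : Finset (Fin n)).val.map c

theorem count_values {n : ℕ} (c : Fin n → ℕ) (i : ℕ) :
    (values c).count i = Fintype.card {a // c a = i} := by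
  rw [values, Multiset.count_map, Fintype.card_subtype, Finset.card_def, Finset.filter_val]
  simp only [eq_comm]

theorem exists_perm_of_values_eq {n : ℕ} {c d : Fin n → ℕ} (h : values c = values d) :
    ∃ τ : Equiv.Perm (Fin n), (fun i => d (τ i)) = c := by
  have hcard : ∀ i, Fintype.card {a // c a = i} = Fintype.card {a // d a = i} := fun i => by
    rw [← count_values, ← count_values, h]
  refine ⟨Equiv.ofFiberEquiv fun i => Fintype.equivOfCardEq (hcard i), ?_⟩
  funext i
  exact Equiv.ofFiberEquiv_map _ i

theorem values_comp_perm {n : ℕ} (c : Fin n → ℕ) (τ : Equiv.Perm (Fin n)) :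
    values (fun i => c (τ i)) = values c := by
  have : values (fun i => c (τ i)) = ((Finset.univ : Finset (Fin n)).val.map τ).map c := by
    rw [values, Multiset.map_map]; rfl
  rw [this, Multiset.map_univ_val_equiv]
  rfl

theorem values_part {N : ℕ} (l : Nat.Partition N) : values (part l) = l.parts := by
  have h : values (part l) = ((List.ofFn (part l) : List ℕ) : Multiset ℕ) := by
    rw [values, Fin.univ_val_map]
  have h2 : ((sortedParts l : List ℕ) : Multiset ℕ) = l.parts := Multiset.sort_eq _ _
  rw [h, ← h2]
  exact congrArg _ (List.ofFn_getElem (xs := sortedParts l))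

theorem card_values {n : ℕ} (c : Fin n → ℕ) : (values c).card = n := by
  simp [values]

theorem part_pos {N : ℕ} (l : Nat.Partition N) (i : Fin (len l)) : 0 < part l i :=
  l.parts_pos (by
    rw [← values_part l]
    exact Multiset.mem_map_of_mem _ (Finset.mem_univ_val i))

theorem len_le {N : ℕ} (l : Nat.Partition N) : len l ≤ N := by
  have h3 : ∑ _i : Fin (len l), 1 ≤ ∑ i, part l i := Finset.sum_le_sum fun i _ => part_pos l i
  rw [sum_part] at h3
  simpa using h3

/-- The stabilizer of the vector of parts is the product of the symmetric groups of its level sets;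
values that are not parts contribute `0! = 1`. -/
theorem card_perm_fixing_part {N : ℕ} (l : Nat.Partition N) :
    (Finset.univ.filter fun τ : Equiv.Perm (Fin (len l)) => (fun i => part l (τ i)) = part l).card =
      mult l := by
  have h := DomMulAct.stabilizer_card' (part l)
  rw [Fintype.card_subtype] at h
  have h1 : (Finset.univ.filter fun τ : Equiv.Perm (Fin (len l)) =>
      (fun i => part l (τ i)) = part l).card =
      (Finset.univ.filter fun τ : Equiv.Perm (Fin (len l)) => part l ∘ τ = part l).card := rfl
  rw [h1, h, mult]
  simp_rw [← count_values, values_part]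
  refine Finset.prod_subset (fun i hi => ?_) fun i _ hi => ?_
  · obtain ⟨a, _, rfl⟩ := Finset.mem_image.1 hi
    have h2 : part l a ≤ ∑ i, part l i :=
      Finset.single_le_sum (fun _ _ => Nat.zero_le _) (Finset.mem_univ a)
    rw [sum_part] at h2
    exact Finset.mem_Icc.2 ⟨part_pos l a, h2⟩
  · have h2 : i ∉ l.parts := fun h3 => hi (by
      rw [← values_part l] at h3
      obtain ⟨a, _, rfl⟩ := Multiset.mem_map.1 h3
      exact Finset.mem_image_of_mem _ (Finset.mem_univ a))
    rw [Multiset.count_eq_zero_of_notMem h2, Nat.factorial_zero]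

/-- These permutations form a coset of the stabilizer. -/
theorem card_perm_to {N : ℕ} (l : Nat.Partition N) {c : Fin (len l) → ℕ}
    (hc : values c = l.parts) :
    (Finset.univ.filter fun τ : Equiv.Perm (Fin (len l)) => (fun i => part l (τ i)) = c).card =
      mult l := by
  obtain ⟨ρ, hρ⟩ := exists_perm_of_values_eq (c := c) (d := part l) (by rw [hc, values_part])
  rw [← card_perm_fixing_part]
  refine Finset.card_bij (fun τ _ => τ * ρ⁻¹) ?_ ?_ ?_
  · intro τ hτ
    rw [Finset.mem_filter] at hτ ⊢
    refine ⟨Finset.mem_univ _, ?_⟩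
    funext i
    have h1 := congrFun hτ.2 (ρ⁻¹ i)
    have h2 := congrFun hρ (ρ⁻¹ i)
    rw [Equiv.Perm.mul_apply, h1, ← h2, Equiv.Perm.inv_def, Equiv.apply_symm_apply]
  · exact fun _ _ _ _ h => mul_right_cancel h
  · intro τ hτ
    rw [Finset.mem_filter] at hτ
    refine ⟨τ * ρ, ?_, by simp⟩
    rw [Finset.mem_filter]
    refine ⟨Finset.mem_univ _, ?_⟩
    funext i
    have h1 := congrFun hτ.2 (ρ i)
    have h2 := congrFun hρ i
    rw [Equiv.Perm.mul_apply, h1, h2]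

theorem mult_ne_zero {N : ℕ} (l : Nat.Partition N) : mult l ≠ 0 :=
  Finset.prod_ne_zero_iff.2 fun _ _ => Nat.factorial_ne_zero _

/-- Sorting the `n!` permutations by the rearrangement of the parts that they produce shows that
`n!` is `m(λ)` times the number of rearrangements, on all of which `T` takes the same value. -/
theorem sum_comps_of_values_eq {N : ℕ} (l : Nat.Partition N) {T : (Fin (len l) → ℕ) → ℂ}
    (hT : ∀ c (τ : Equiv.Perm (Fin (len l))), T (fun i => c (τ i)) = T c) :
    (((len l).factorial : ℕ) : ℂ)⁻¹ *
        ∑ c ∈ (comps (len l) N).filter (fun c => values c = l.parts), T c =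
      1 / (mult l : ℂ) * T (part l) := by
  set S := (comps (len l) N).filter (fun c => values c = l.parts) with hS
  have hmaps : ∀ τ ∈ (Finset.univ : Finset (Equiv.Perm (Fin (len l)))),
      (fun i => part l (τ i)) ∈ S := by
    intro τ _
    rw [hS, Finset.mem_filter, mem_comps]
    exact ⟨⟨(Equiv.sum_comp τ (part l)).trans (sum_part l), fun i => part_pos l _⟩,
      by rw [values_comp_perm, values_part]⟩
  have hcount := Finset.sum_fiberwise_of_maps_to hmaps fun _ => (1 : ℕ)
  have h1 : ∀ c ∈ S, ∑ _τ ∈ Finset.univ.filter (fun τ : Equiv.Perm (Fin (len l)) =>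
      (fun i => part l (τ i)) = c), 1 = mult l := by
    intro c hc
    rw [Finset.sum_const, smul_eq_mul, mul_one]
    exact card_perm_to l (Finset.mem_filter.1 hc).2
  rw [Finset.sum_congr rfl h1, Finset.sum_const, Finset.sum_const, smul_eq_mul, smul_eq_mul,
    mul_one, Finset.card_univ, Fintype.card_perm, Fintype.card_fin] at hcount
  have h2 : ∑ c ∈ S, T c = S.card * T (part l) := by
    rw [← nsmul_eq_mul, ← Finset.sum_const]
    refine Finset.sum_congr rfl fun c hc => ?_
    obtain ⟨ρ, hρ⟩ := exists_perm_of_values_eq (c := c) (d := part l) (by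
      rw [(Finset.mem_filter.1 hc).2, values_part])
    rw [← hρ, hT]
  rw [h2, ← hcount, Nat.cast_mul]
  have h3 : (mult l : ℂ) ≠ 0 := by exact_mod_cast mult_ne_zero l
  have h4 : (S.card : ℂ) ≠ 0 := by
    have : S.card ≠ 0 := fun h0 => by
      rw [h0, zero_mul] at hcount
      exact Nat.factorial_ne_zero _ hcount.symm
    exact_mod_cast this
  field_simp

theorem sum_comps_eq_sum_partition (N : ℕ) {T : (n : ℕ) → (Fin n → ℕ) → ℂ}
    (hT : ∀ n c (τ : Equiv.Perm (Fin n)), T n (fun i => c (τ i)) = T n c) :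
    ∑ n ∈ Finset.range (N + 1), ((n.factorial : ℕ) : ℂ)⁻¹ * ∑ c ∈ comps n N, T n c =
      ∑ l : Nat.Partition N, 1 / (mult l : ℂ) * T (len l) (part l) := by
  have h1 : ∀ n, ∑ c ∈ comps n N, T n c =
      ∑ l : Nat.Partition N, ∑ c ∈ (comps n N).filter (fun c => values c = l.parts), T n c := by
    intro n
    simp_rw [Finset.sum_filter]
    rw [Finset.sum_comm]
    refine Finset.sum_congr rfl fun c hc => ?_
    obtain ⟨hc1, hc2⟩ := mem_comps.1 hc
    let l₀ : Nat.Partition N := ⟨values c, fun {i} hi => by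
      obtain ⟨a, _, rfl⟩ := Multiset.mem_map.1 hi
      exact hc2 a, hc1⟩
    rw [Finset.sum_eq_single l₀]
    · rw [if_pos rfl]
    · intro l _ hl
      rw [if_neg]
      intro h
      exact hl (Nat.Partition.ext h.symm)
    · exact fun h => absurd (Finset.mem_univ _) h
  simp_rw [h1, Finset.mul_sum (s := (Finset.univ : Finset (Nat.Partition N)))]
  rw [Finset.sum_comm]
  refine Finset.sum_congr rfl fun l _ => ?_
  rw [Finset.sum_eq_single (len l)]
  · exact sum_comps_of_values_eq l (hT (len l))
  · intro n _ hn
    rw [Finset.sum_eq_zero, mul_zero]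
    intro c hc
    refine absurd ?_ hn
    rw [← card_values c, (Finset.mem_filter.1 hc).2, ← values_part l, card_values]
  · intro h
    exact absurd (Finset.mem_range.2 (Nat.lt_succ_of_le (len_le l))) h

theorem stringTerm_comp_perm {N n : ℕ} (F : (Fin N → ℂ) → ℂ) (c : Fin n → ℕ) (w : Fin n → ℂ)
    (τ : Equiv.Perm (Fin n)) :
    stringTerm F (fun i => c (τ i)) (fun i => w (τ i)) = stringTerm F c w := by
  rw [stringTerm, stringTerm, cauchyD_comp_perm, stringSet_comp_perm]

theorem lineIntegral_stringTerm_comp_perm {N : ℕ} (θ : ℝ) (F : (Fin N → ℂ) → ℂ) (n : ℕ)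
    (c : Fin n → ℕ) (τ : Equiv.Perm (Fin n)) :
    lineIntegral (fun _ => θ) (stringTerm F fun i => c (τ i)) =
      lineIntegral (fun _ => θ) (stringTerm F c) := by
  rw [lineIntegral_eq, lineIntegral_eq, ← integral_comp_perm τ]
  congr 2
  funext y
  rw [← linePoint_const_comp, stringTerm_comp_perm]

/-- One side sees the set of string points, the other the ordered vector; they agree whenever the
strings are disjoint. -/
theorem ae_partitionIntegrand_eq {N : ℕ} (θ : ℝ) (F : (Fin N → ℂ) → ℂ) (l : Nat.Partition N) :
    (fun y => 1 / (mult l : ℂ) * stringTerm F (part l) (linePoint (fun _ => θ) y)) =ᵐ[volume]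
      fun y => partitionIntegrand F l (linePoint (fun _ => θ) y) := by
  filter_upwards [ae_injective (len l)] with y hy
  rw [stringTerm, symmSet_stringSet_eq F (part l) (sum_part l) (linePoint_intSeparated θ hy),
    ← mul_assoc]
  rfl

theorem one_lt_sub_of_lt {N : ℕ} {a : Fin N → ℝ}
    (ha : ∀ i j : Fin N, (i : ℕ) + 1 = (j : ℕ) → 1 < a i - a j) :
    ∀ i j : Fin N, i < j → 1 < a i - a j := by
  have key : ∀ (k : ℕ) (i j : Fin N), (i : ℕ) + (k + 1) = (j : ℕ) → 1 < a i - a j := by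
    intro k
    induction k with
    | zero => exact fun i j h => ha i j h
    | succ k ih =>
      intro i j h
      have hj := j.isLt
      have h1 := ih i ⟨i + (k + 1), by omega⟩ rfl
      have h2 := ha ⟨i + (k + 1), by omega⟩ j (by simp only; omega)
      linarith
  intro i j hij
  have h : (i : ℕ) < j := hij
  exact key (j - i - 1) i j (by omega)

end ContourFormula

end

theorem lemma3p2 (N : ℕ) (hN : 1 ≤ N) (a : Fin N → ℝ)
    (ha : ∀ i j : Fin N, (i : ℕ) + 1 = (j : ℕ) → 1 < a i - a j)
    (θ α β : ℝ)
    (haαβ : ∀ k, α < a k ∧ a k < β)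
    (hθα : α < θ) (hθβ : θ + ((N : ℝ) - 1) < β)
    (F : (Fin N → ℂ) → ℂ)
    (hF : AnalyticOnNhd ℂ F (ContourFormula.tube N α β))
    (hdecay : ∃ C δ : ℝ, 0 < δ ∧ ∀ z ∈ ContourFormula.tube N α β,
      ‖F z‖ ≤ C * ∏ k, (1 + ‖z k‖) ^ (-(1 + δ))) :
    ContourFormula.LineIntegrable a (ContourFormula.nestedIntegrand F) ∧
    (∀ l : Nat.Partition N,
      ContourFormula.LineIntegrable (fun _ => θ) (ContourFormula.partitionIntegrand F l)) ∧
    ContourFormula.lineIntegral a (ContourFormula.nestedIntegrand F) =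
      ∑ l : Nat.Partition N,
        ContourFormula.lineIntegral (fun _ => θ) (ContourFormula.partitionIntegrand F l) := by
  obtain ⟨C, δ, hδ, hFC⟩ := hdecay
  have hp : 1 < 1 + δ := by linarith
  have hTD : ContourFormula.TubeDecay α β (1 + δ) C F := ⟨hF.differentiableOn, hFC⟩
  have ha' := ContourFormula.one_lt_sub_of_lt ha
  refine ⟨ContourFormula.integrable_nestedIntegrand hp hTD ha' haαβ, fun l => ?_, ?_⟩
  · exact ((ContourFormula.integrable_stringTerm hp hTD hθα hθβ (ContourFormula.part_pos l)
      (ContourFormula.sum_part l)).const_mul _).congr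
      (ContourFormula.ae_partitionIntegrand_eq θ F l)
  · rw [ContourFormula.lineIntegral_nestedIntegrand_eq N a θ α β (1 + δ) C F hp hTD ha' haαβ hθα
      hθβ, ContourFormula.sum_comps_eq_sum_partition N
        (T := fun _ c => ContourFormula.lineIntegral (fun _ => θ) (ContourFormula.stringTerm F c))
        fun n c τ => ContourFormula.lineIntegral_stringTerm_comp_perm θ F n c τ]
    refine Finset.sum_congr rfl fun l _ => ?_
    rw [ContourFormula.lineIntegral_eq, ContourFormula.lineIntegral_eq,
      ← integral_congr_ae (ContourFormula.ae_partitionIntegrand_eq θ F l), integral_const_mul]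
    ring
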